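/- **Setting.** An episodic two-player zero-sum Markov game has horizon $H\ge 1$, a measurable state space $\mathcal X$, finite action sets $\mathcal A,\mathcal B$, a fixed initial state $x^1$, deterministic rewards $r^h(x,a,b)\in[0,1]$ and transition kernels $\mathbb P_h(\cdot\mid x,a,b)$, $h\in[H]$. It is a *linear Markov game* of dimension $d$ if there are feature maps $\phi_h(x,a,b)\in\mathbb R^d$ with $\|\phi_h\|\le 1$, vectors $\theta^h_*$ and vectors $m_h$ of $d$ signed measures on $\mathcal X$ such that $r^h=\phi_h^\top\theta^h_*$, $\mathbb P_h(S\mid x,a,b)=\phi_h(x,a,b)^\top m_h(S)$, $\|\theta_*^h\|\le\sqrt d$, and $\|m_h(S)\|\le\sqrt d$ for all measurable $S$. For Markov policies $\mu,\nu$ let $V_1^{\mu,\nu}(x^1)$ be the expected total reward of an episode, $V_1^{\mu,\dagger}=\inf_\nu V_1^{\mu,\nu}$ and $V_1^*=\sup_\mu V_1^{\mu,\dagger}$. The function class is $\mathcal F=\mathcal F_1\times\cdots\times\mathcal F_H$ with $$\mathcal F_h=\{\phi_h^\top\theta:\ \|\theta\|\le (H+1-h)\sqrt d,\ 0\le \phi_h^\top\theta\le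 H+1-h \text{ on } \mathcal X\times\mathcal A\times\mathcal B\},$$ and the prior $p_0^h$ is the uniform distribution on this set of parameters $\theta$. For $f,g\in\mathcal F$ fix measurable choices of $\mu_{f,h}(x)\in\arg\max_{\mu}\min_\nu \mu^\top f^h(x,\cdot,\cdot)\nu$ and $\nu_{f,g,h}(x)\in\arg\min_\nu \mu_{f,h}(x)^\top g^h(x,\cdot,\cdot)\nu$, and put $V_{f,h}(x)=\max_\mu\min_\nu\mu^\top f^h(x,\cdot,\cdot)\nu$, $V^{\mu}_{g,h}(x)=\min_\nu\mu_h(x)^\top g^h(x,\cdot,\cdot)\nu$, $V_{f,H+1}=V^\mu_{g,H+1}=0$, $\mathcal T^\mu_h g=r^h+\mathbb P_hV^\mu_{g,h+1}$. Let $$\kappa(\epsilon)=\sup_{f,g\in\mathcal F}\sum_{h=1}^H\ln\frac1{p_0^h(\{g'\in\mathcal F_h:\ \sup_{x,a,b}|g'-\mathcal T_h^{\mu_f}g|\le\epsilon\})}.$$ **Algorithm** (conditional posterior sampling with booster, parameters $\eta,\lambda$). In episode $t=1,\dots,T$, given the trajectories $S_{t-1}$ of the earlier episodes, draw $f_t$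 from the density, with respect to $\prod_h p_0^h$, $$p(f\mid S_{t-1})\propto \exp(\lambda V_{f,1}(x^1))\prod_{h=1}^H\frac{\exp(-\eta L^h(f^h,f^{h+1}))}{\mathbb E_{\tilde f^h\sim p_0^h}\exp(-\eta L^h(\tilde f^h,f^{h+1}))},\quad L^h(f^h,f^{h+1})=\sum_{s<t}\big[f^h(x_s^h,a_s^h,b_s^h)-r_s^h-V_{f,h+1}(x_s^{h+1})\big]^2 ;$$ then draw $g_t$ from the analogous density in which $\lambda$ is replaced by $-\lambda$ and every value $V_{f,h}$ by $V^{\mu_{f_t}}_{g,h}$; then play $(\mu_t,\nu_t)=(\mu_{f_t},\nu_{f_t,g_t})$ for one episode and record its trajectory. Let $\mathrm{Reg}(T)=\sum_{t=1}^T[V_1^*(x^1)-V_1^{\mu_t,\dagger}(x^1)]$. **Corollary (Linear MG).** There is an absolute constant $C>0$ such that for every linear Markov game (and every choice of the argmax and argmin policies above): 1. $\kappa(\epsilon)\le C\,Hd\ln(1/\epsilon)$ for all $0<\epsilon\le 1/H$; 2. for all $T$ with $HT\ge 2$, the algorithm with $\eta=\dfrac{0.4}{H^2}$ and $\lambda=\sqrt{\dfrac{T\,\kappa(H/T^2)}{dH^3(1+\ln(2HT))}}$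 is well defined, $\mathrm{Reg}(T)$ is integrable, and $$\mathbb E\,\mathrm{Reg}(T)\le C\,H^2d\sqrt T\,\ln(HT).$$ -/

import Mathlib

open MeasureTheory ProbabilityTheory

namespace LinMG

/-! ### Zero-sum matrix games -/

section MatrixGame

/-- The bilinear payoff `pᵀ M q` of a matrix game. -/
noncomputable def payoff {A B : Type*} [Fintype A] [Fintype B]
    (p : A → ℝ) (M : A → B → ℝ) (q : B → ℝ) : ℝ :=
  ∑ a, ∑ b, p a * M a b * q b

/-- `min_{q ∈ Δ_B} pᵀ M q`. -/
noncomputable def respValue {A B : Type*} [Fintype A] [Fintype B]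
    (p : A → ℝ) (M : A → B → ℝ) : ℝ :=
  ⨅ q : stdSimplex ℝ B, payoff p M (q : B → ℝ)

/-- `max_{p ∈ Δ_A} min_{q ∈ Δ_B} pᵀ M q`. -/
noncomputable def gameValue {A B : Type*} [Fintype A] [Fintype B] (M : A → B → ℝ) : ℝ :=
  ⨆ p : stdSimplex ℝ A, respValue (p : A → ℝ) M

/-- The vector of point masses of a measure on a finite set of actions. -/
noncomputable def weights {A : Type*} [MeasurableSpace A] (m : Measure A) : A → ℝ :=
  fun a => m.real {a}

end MatrixGame

/-! ### Episodic two-player zero-sum Markov games (steps are indexed by `0, …, H - 1`) -/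

/-- An episodic Markov game with fixed initial state and deterministic rewards in `[0, 1]`. -/
structure Game (H : ℕ) (X A B : Type*) [MeasurableSpace X] [MeasurableSpace A]
    [MeasurableSpace B] where
  P : Fin H → Kernel (X × A × B) X
  markov : ∀ h, IsMarkovKernel (P h)
  r : Fin H → X × A × B → ℝ
  measurable_r : ∀ h, Measurable (r h)
  r_mem : ∀ h z, r h z ∈ Set.Icc (0 : ℝ) 1
  x₁ : X

/-- Trajectories `(x^h, a^h, b^h)_h` of one episode. The observed rewards are the deterministic
values `r^h (x^h, a^h, b^h)`. -/
abbrev Traj (H : ℕ) (X A B : Type*) : Type _ := Fin H → X × A × B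

/-- Markov policies: at each step a (measurable) map from states to distributions of actions. -/
def Policy (H : ℕ) (X A : Type*) [MeasurableSpace X] [MeasurableSpace A] : Type _ :=
  {π : Fin H → Kernel X A // ∀ h, IsMarkovKernel (π h)}

/-- Law of the trajectory of an episode of `H` steps that starts in the state `x`, under policies
that may depend measurably on a parameter `u`: the two actions are drawn independently from
`μ_0 (u, x)` and `ν_0 (u, x)`, the next state is drawn from `P_0`, and the remaining `H - 1` steps
are played from there. -/
noncomputable def rollout {U X A B : Type*} [MeasurableSpace U] [MeasurableSpace X]
    [MeasurableSpace A] [MeasurableSpace B] :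
    (H : ℕ) → (Fin H → Kernel (X × A × B) X) → (Fin H → Kernel (U × X) A) →
      (Fin H → Kernel (U × X) B) → Kernel (U × X) (Traj H X A B)
  | 0, _, _, _ => Kernel.const _ (Measure.dirac Fin.elim0)
  | H + 1, P, μ, ν =>
    let act : Kernel (U × X) (A × B) := (μ 0) ×ₖ (ν 0)
    let next : Kernel ((U × X) × (A × B)) (U × X) :=
      (Kernel.deterministic (fun z : (U × X) × (A × B) => z.1.1) (by fun_prop)) ×ₖ
        ((P 0).comap (fun z : (U × X) × (A × B) => (z.1.2, z.2.1, z.2.2)) (by fun_prop))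
    let rest : Kernel (U × X) (Traj H X A B) :=
      rollout H (fun h => P h.succ) (fun h => μ h.succ) (fun h => ν h.succ)
    ((Kernel.id : Kernel (U × X) (U × X)) ×ₖ (act ⊗ₖ (rest ∘ₖ next))).map
      (fun w : (U × X) × ((A × B) × Traj H X A B) =>
        (Fin.cons (w.1.2, w.2.1.1, w.2.1.2) w.2.2 : Traj (H + 1) X A B))

section Values

variable {H : ℕ} {X A B : Type*} [MeasurableSpace X] [MeasurableSpace A] [MeasurableSpace B]

/-- `V_1^{μ,ν}(x¹)`: the expected total reward of an episode. -/
noncomputable def value (G : Game H X A B) (μ : Fin H → Kernel X A) (ν : Fin H → Kernel X B) : ℝ :=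
  ∫ ζ, ∑ h, G.r h (ζ h) ∂(rollout (U := Unit) H G.P
    (fun h => (μ h).comap Prod.snd measurable_snd)
    (fun h => (ν h).comap Prod.snd measurable_snd) ((), G.x₁))

/-- `V_1^{μ,†}(x¹) = inf_ν V_1^{μ,ν}(x¹)`. -/
noncomputable def bestRespValue (G : Game H X A B) (μ : Fin H → Kernel X A) : ℝ :=
  ⨅ ν : Policy H X B, value G μ ν.1

/-- The Nash value `V_1^*(x¹) = sup_μ inf_ν V_1^{μ,ν}(x¹)`. -/
noncomputable def nashValue (G : Game H X A B) : ℝ :=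
  ⨆ μ : Policy H X A, bestRespValue G μ.1

end Values

/-! ### Linear Markov games, the function class and the uniform prior -/

/-- Parameters of one step. -/
abbrev Vec (d : ℕ) : Type := EuclideanSpace ℝ (Fin d)

/-- Parameters `θ = (θ^1, …, θ^H)` of a function `f_θ = (f^1, …, f^H)`. -/
abbrev Param (H d : ℕ) : Type := Fin H → Vec d

section Linear

variable {H d : ℕ} {X A B : Type*} [MeasurableSpace X] [MeasurableSpace A] [MeasurableSpace B]

/-- `G` is a linear Markov game with feature map `φ`: `‖φ‖ ≤ 1`, `r^h = φ^⊤ θ_*^h` and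
`P_h(S | x,a,b) = φ(x,a,b)^⊤ m_h(S)` for a vector `θ_*^h` and a vector of `d` signed measures `m_h`
with `‖θ_*^h‖ ≤ √d` and `‖m_h(S)‖ ≤ √d` for all measurable `S`. -/
structure IsLinear (G : Game H X A B) (φ : Fin H → X × A × B → Vec d) : Prop where
  measurable_feature : ∀ h, Measurable (φ h)
  norm_feature_le : ∀ h z, ‖φ h z‖ ≤ 1
  reward : ∀ h, ∃ θ : Vec d, ‖θ‖ ≤ √(d : ℝ) ∧ ∀ z, G.r h z = inner ℝ (φ h z) θ
  transition : ∀ h, ∃ m : VectorMeasure X (Vec d),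
    (∀ S, MeasurableSet S → ‖m S‖ ≤ √(d : ℝ)) ∧
    ∀ z S, MeasurableSet S → (G.P h z).real S = inner ℝ (φ h z) (m S)

/-- The matrix `f^h(x, ·, ·)` of the function `f^h = φ_h^⊤ θ`. -/
noncomputable def qmat (φ : Fin H → X × A × B → Vec d) (h : Fin H) (θ : Vec d) (x : X) :
    A → B → ℝ :=
  fun a b => inner ℝ (φ h (x, a, b)) θ

/-- The parameters of the class `F_h`: in one-based notation, `‖θ‖ ≤ (H+1-h)√d` and
`φ_h^⊤ θ ∈ [0, H+1-h]` everywhere. -/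
def paramSet (φ : Fin H → X × A × B → Vec d) (h : Fin H) : Set (Vec d) :=
  {θ | ‖θ‖ ≤ ((H : ℝ) - (h : ℕ)) * √(d : ℝ) ∧
    ∀ z, inner ℝ (φ h z) θ ∈ Set.Icc (0 : ℝ) ((H : ℝ) - (h : ℕ))}

/-- The parameters of the product class `F = F_1 × ⋯ × F_H`. -/
def classSet (φ : Fin H → X × A × B → Vec d) : Set (Param H d) :=
  {θ | ∀ h, θ h ∈ paramSet φ h}

/-- The uniform prior `p_0^h` on (the parameters of) `F_h`: normalized Lebesgue measure. -/
noncomputable def prior (φ : Fin H → X × A × B → Vec d) (h : Fin H) : Measure (Vec d) :=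
  cond volume (paramSet φ h)

/-- `V_{f,h}(x)` for `f = f_θ`. -/
noncomputable def mainVal [Fintype A] [Fintype B] (φ : Fin H → X × A × B → Vec d)
    (θ : Param H d) (h : Fin H) (x : X) : ℝ :=
  gameValue (qmat φ h (θ h) x)

/-- `V^{μ_f}_{g,h}(x)` for `f = f_θ`, `g = f_ϑ`, where `μ_{f,h}(x) = πA h (θ^h, x)`. -/
noncomputable def boostVal [Fintype A] [Fintype B] (φ : Fin H → X × A × B → Vec d)
    (πA : Fin H → Kernel (Vec d × X) A) (θ ϑ : Param H d) (h : Fin H) (x : X) : ℝ :=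
  respValue (weights (πA h (θ h, x))) (qmat φ h (ϑ h) x)

/-- `πA` is a (measurable) choice of the policies
`μ_{f,h}(x) ∈ argmax_μ min_ν μ^⊤ f^h(x,·,·) ν` for all `f` in the class. -/
structure IsMainRule [Fintype A] [Fintype B] (φ : Fin H → X × A × B → Vec d)
    (πA : Fin H → Kernel (Vec d × X) A) : Prop where
  markov : ∀ h, IsMarkovKernel (πA h)
  argmax : ∀ h, ∀ θ ∈ paramSet φ h, ∀ x, ∀ p ∈ stdSimplex ℝ A,
    respValue p (qmat φ h θ x) ≤ respValue (weights (πA h (θ, x))) (qmat φ h θ x)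

/-- `πB` is a (measurable) choice of the policies
`ν_{f,g,h}(x) ∈ argmin_ν μ_{f,h}(x)^⊤ g^h(x,·,·) ν` for all `f, g` in the class. -/
structure IsBoosterRule [Fintype A] [Fintype B] (φ : Fin H → X × A × B → Vec d)
    (πA : Fin H → Kernel (Vec d × X) A) (πB : Fin H → Kernel ((Vec d × Vec d) × X) B) : Prop where
  markov : ∀ h, IsMarkovKernel (πB h)
  argmin : ∀ h, ∀ θ ∈ paramSet φ h, ∀ ϑ ∈ paramSet φ h, ∀ x, ∀ q ∈ stdSimplex ℝ B,
    payoff (weights (πA h (θ, x))) (qmat φ h ϑ x) (weights (πB h ((θ, ϑ), x))) ≤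
      payoff (weights (πA h (θ, x))) (qmat φ h ϑ x) q

/-! ### The complexity measure `κ` -/

/-- `(T_h^μ g)(x,a,b) = r^h(x,a,b) + 𝔼_{x' ∼ P_h(·|x,a,b)} V^μ_{g,h+1}(x')` for `μ = μ_{f_θ}` and
`g = f_ϑ`, with `V_{g,H+1} = 0`. -/
noncomputable def bellman [Fintype A] [Fintype B] (G : Game H X A B)
    (φ : Fin H → X × A × B → Vec d) (πA : Fin H → Kernel (Vec d × X) A) (θ ϑ : Param H d)
    (h : Fin H) (z : X × A × B) : ℝ :=
  G.r h z + if hh : (h : ℕ) + 1 < H then ∫ x', boostVal φ πA θ ϑ ⟨h + 1, hh⟩ x' ∂(G.P h z) else 0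

/-- The parameters of `F_h^{μ_f}(ε, g^{h+1})`: functions in `F_h` with
`sup_{x,a,b} |g' - T_h^{μ_f} g| ≤ ε`. -/
def smallResidual [Fintype A] [Fintype B] (G : Game H X A B)
    (φ : Fin H → X × A × B → Vec d) (πA : Fin H → Kernel (Vec d × X) A) (ε : ℝ)
    (θ ϑ : Param H d) (h : Fin H) : Set (Vec d) :=
  {v | v ∈ paramSet φ h ∧ ∀ z, |inner ℝ (φ h z) v - bellman G φ πA θ ϑ h z| ≤ ε}

/-- `κ(ε) = sup_{f ∈ F} sup_{g ∈ F} ∑_h ln (1 / p_0^h(F_h^{μ_f}(ε, g^{h+1})))`, with values in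
`[0, ∞]`. -/
noncomputable def kappa [Fintype A] [Fintype B] (G : Game H X A B)
    (φ : Fin H → X × A × B → Vec d) (πA : Fin H → Kernel (Vec d × X) A) (ε : ℝ) : EReal :=
  ⨆ θ ∈ classSet φ, ⨆ ϑ ∈ classSet φ,
    ∑ h, ENNReal.log ((prior φ h (smallResidual G φ πA ε θ ϑ h))⁻¹)

/-! ### Conditional posterior sampling with booster -/

/-- The squared temporal-difference loss `∑_s [f^h(x_s^h,a_s^h,b_s^h) - r_s^h - V_{h+1}(x_s^{h+1})]²`
of `f^h = φ_h^⊤ w` on the trajectories `S`, with `V_{H+1} = 0`. -/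
noncomputable def tdLoss (G : Game H X A B) (φ : Fin H → X × A × B → Vec d)
    (V : Fin H → X → ℝ) (h : Fin H) (w : Vec d) {t : ℕ} (S : Fin t → Traj H X A B) : ℝ :=
  ∑ s, (inner ℝ (φ h (S s h)) w - G.r h (S s h) -
    (if hh : (h : ℕ) + 1 < H then V ⟨h + 1, hh⟩ (S s ⟨h + 1, hh⟩).1 else 0)) ^ 2

/-- The unnormalized density, with respect to the product prior, of
`exp(c V_1(x¹)) ∏_h q(f^h | f^{h+1}, S)`, where
`q(f^h | f^{h+1}, S) = p_0^h(f^h) exp(-η L^h) / 𝔼_{f^h ∼ p_0^h} exp(-η L^h)`. Here `V θ h` is the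
value function at step `h` that is induced by `f_θ`. -/
noncomputable def postWeight [NeZero H] (G : Game H X A B) (φ : Fin H → X × A × B → Vec d)
    (V : Param H d → Fin H → X → ℝ) (η c : ℝ) {t : ℕ} (S : Fin t → Traj H X A B)
    (θ : Param H d) : ℝ :=
  Real.exp (c * V θ 0 G.x₁) *
    ∏ h, (Real.exp (-η * tdLoss G φ (V θ) h (θ h) S) /
      ∫ w, Real.exp (-η * tdLoss G φ (V θ) h w S) ∂(prior φ h))

/-- The normalized density of the posterior with respect to the product prior. -/
noncomputable def postDensity [NeZero H] (G : Game H X A B) (φ : Fin H → X × A × B → Vec d)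
    (V : Param H d → Fin H → X → ℝ) (η c : ℝ) {t : ℕ} (S : Fin t → Traj H X A B)
    (θ : Param H d) : ENNReal :=
  ENNReal.ofReal (postWeight G φ V η c S θ /
    ∫ θ', postWeight G φ V η c S θ' ∂(Measure.pi (prior φ)))

/-- The product prior, as a constant kernel. -/
noncomputable def priorKernel (φ : Fin H → X × A × B → Vec d) (Ω : Type*) [MeasurableSpace Ω] :
    Kernel Ω (Param H d) :=
  Kernel.const Ω (Measure.pi (prior φ))

instance (φ : Fin H → X × A × B → Vec d) (Ω : Type*) [MeasurableSpace Ω] :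
    IsSFiniteKernel (priorKernel φ Ω) := by
  have : ∀ h, IsFiniteMeasure (prior φ h) := fun h => by unfold prior; infer_instance
  unfold priorKernel
  infer_instance

/-- The posterior `p(f | S)` of the main agent. -/
noncomputable def mainPosterior [NeZero H] [Fintype A] [Fintype B] (G : Game H X A B)
    (φ : Fin H → X × A × B → Vec d) (η lam : ℝ) (t : ℕ) :
    Kernel (Fin t → Traj H X A B) (Param H d) :=
  Kernel.withDensity (priorKernel φ _) (fun S θ => postDensity G φ (mainVal φ) η lam S θ)

/-- The posterior `p^{μ_f}(g | S)` of the booster agent. -/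
noncomputable def boosterPosterior [NeZero H] [Fintype A] [Fintype B] (G : Game H X A B)
    (φ : Fin H → X × A × B → Vec d) (πA : Fin H → Kernel (Vec d × X) A) (η lam : ℝ) (t : ℕ) :
    Kernel ((Fin t → Traj H X A B) × Param H d) (Param H d) :=
  Kernel.withDensity (priorKernel φ _)
    (fun Sθ ϑ => postDensity G φ (boostVal φ πA Sθ.2) η (-lam) Sθ.1 ϑ)

/-- The law of the trajectory of an episode played with `(μ_f, ν_{f,g})`. -/
noncomputable def episode (G : Game H X A B) (πA : Fin H → Kernel (Vec d × X) A)
    (πB : Fin H → Kernel ((Vec d × Vec d) × X) B) :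
    Kernel (Param H d × Param H d) (Traj H X A B) :=
  (rollout (U := Param H d × Param H d) H G.P
    (fun h => (πA h).comap (fun y => (y.1.1 h, y.2)) (by fun_prop))
    (fun h => (πB h).comap (fun y => ((y.1.1 h, y.1.2 h), y.2)) (by fun_prop))).comap
      (fun u => (u, G.x₁)) (by fun_prop)

/-- What happens in an episode: the two sampled functions `f_t`, `g_t` and the trajectory `ζ_t`. -/
abbrev Rec (H d : ℕ) (X A B : Type*) : Type _ := Param H d × Param H d × Traj H X A B

/-- One stage of the algorithm given the trajectories `S_{t-1}` collected so far: draw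
`f_t ∼ p(· | S_{t-1})`, then `g_t ∼ p^{μ_{f_t}}(· | S_{t-1})`, then play `(μ_{f_t}, ν_{f_t,g_t})`. -/
noncomputable def stage [NeZero H] [Fintype A] [Fintype B] (G : Game H X A B)
    (φ : Fin H → X × A × B → Vec d) (πA : Fin H → Kernel (Vec d × X) A)
    (πB : Fin H → Kernel ((Vec d × Vec d) × X) B) (η lam : ℝ) (t : ℕ) :
    Kernel (Fin t → Traj H X A B) (Rec H d X A B) :=
  mainPosterior G φ η lam t ⊗ₖ (boosterPosterior G φ πA η lam t ⊗ₖ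
    (episode G πA πB).comap
      (fun y : ((Fin t → Traj H X A B) × Param H d) × Param H d => (y.1.2, y.2)) (by fun_prop))

/-- The law of the first `t` stages of the algorithm. -/
noncomputable def runLaw [NeZero H] [Fintype A] [Fintype B] (G : Game H X A B)
    (φ : Fin H → X × A × B → Vec d) (πA : Fin H → Kernel (Vec d × X) A)
    (πB : Fin H → Kernel ((Vec d × Vec d) × X) B) (η lam : ℝ) :
    (t : ℕ) → Measure (Fin t → Rec H d X A B)
  | 0 => Measure.dirac Fin.elim0
  | t + 1 =>
    (runLaw G φ πA πB η lam t ⊗ₘ (stage G φ πA πB η lam t).comap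
      (fun (ω : Fin t → Rec H d X A B) s => (ω s).2.2) (by fun_prop)).map
      (fun y => (Fin.snoc y.1 y.2 : Fin (t + 1) → Rec H d X A B))

/-- `Reg(T) = ∑_t [V_1^*(x¹) - V_1^{μ_t,†}(x¹)]` with `μ_t = μ_{f_t}`. -/
noncomputable def regret (G : Game H X A B) (πA : Fin H → Kernel (Vec d × X) A) {T : ℕ}
    (ω : Fin T → Rec H d X A B) : ℝ :=
  ∑ t, (nashValue G -
    bestRespValue G (fun h => (πA h).comap (fun x => ((ω t).1 h, x)) (by fun_prop)))

/-- `λ = √(T κ(H/T²) / (d H³ (1 + ln(2HT))))`. -/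
noncomputable def optimismWeight [Fintype A] [Fintype B] (G : Game H X A B)
    (φ : Fin H → X × A × B → Vec d) (πA : Fin H → Kernel (Vec d × X) A) (T : ℕ) : ℝ :=
  √((T : ℝ) * (kappa G φ πA ((H : ℝ) / (T : ℝ) ^ 2)).toReal /
    ((d : ℝ) * (H : ℝ) ^ 3 * (1 + Real.log (2 * (H : ℝ) * (T : ℝ)))))

end Linear

end LinMG

set_option linter.unusedSectionVars false

/-! The class is closed under Bellman backups, since expectations of bounded functions of the next
state are linear in the features. So there are parameters `θ₀` solving the optimality equation and,
for each `θ`, parameters `g₀ θ` solving the equation of the opponent of `μ_θ`. The value of `θ₀` is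
at least the Nash value (`nashValue_le`), and that of `g₀ θ` is exactly the best-response value
(`bestRespValue_eq`). With the sampled pair `(θ, ϑ)`, the regret of an episode is therefore at most
the sum of three gaps: from `θ₀` to `θ`, from `θ` to `ϑ`, and from `ϑ` to `g₀ θ`.

The middle gap is at most the expected sum of Bellman residuals along the episode that is played,
because `ν` minimizes against the booster's own estimate (`mainVal_sub_boostVal_le`). The two outer
gaps are what the tilts by `λ` and `-λ` control: `lintegral_exp_gain_le` shows that `λ` times these
gaps plus `0.2 η` times the squared residuals on past data is, in expectation, of the order of `κ`.
Residuals are linear in the features, so an elliptic potential argument trades the current residuals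
for exactly these past squared residuals plus an increment of log-determinants (`residSum_le`). The
squared residuals cancel, the increments telescope (`integral_runLaw_le`), and `regret_rate` inserts
the parameters.

The exponential estimate rests on four facts. Replacing the squared loss by its excess over the loss
of the true backup does not change the posterior, because each factor is normalized separately. For
a fixed predictor and fixed value functions, the exponentiated excess loss is a supermartingale by
Hoeffding's lemma (`lintegral_runLaw_exp_le`). The posterior log-density is bounded by normalizers,
which prior mass near the backup keeps from being small (`optimism_le`), and by the total mass,
which is controlled by a reverse Markov bound around the reference parameter (`exp_four_mul_le`).
Finally convexity of `exp` (`exp_weighted_le`) splits the data-dependent average into terms in which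
the parameters are independent of the data or are integrated out as a density.

For `κ` itself, contracting the convex parameter set towards the backup by the factor `ε / (H - h)`
lands in the set of small residuals and scales volume by the `d`-th power. A constant lower bound on
`κ` is needed as well, since `λ` contains `√κ` and some terms of the regret are divided by `λ`. -/

namespace LinMG

/-! ### Values of zero-sum matrix games: bounds, stability and measurability. -/

section MatrixGameLemmas

variable {A B : Type*} [Fintype A] [Fintype B]

theorem payoff_eq_sum (p : A → ℝ) (M : A → B → ℝ) (q : B → ℝ) :
    payoff p M q = ∑ b, q b * ∑ a, p a * M a b := by
  unfold payoff
  rw [Finset.sum_comm]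
  refine Finset.sum_congr rfl fun b _ => ?_
  rw [Finset.mul_sum]
  exact Finset.sum_congr rfl fun a _ => by ring

theorem payoff_mono {p : A → ℝ} {q : B → ℝ} (hp : p ∈ stdSimplex ℝ A) (hq : q ∈ stdSimplex ℝ B)
    {M N : A → B → ℝ} (h : ∀ a b, M a b ≤ N a b) : payoff p M q ≤ payoff p N q := by
  unfold payoff
  refine Finset.sum_le_sum fun a _ => Finset.sum_le_sum fun b _ => ?_
  exact mul_le_mul_of_nonneg_right (mul_le_mul_of_nonneg_left (h a b) (hp.1 a)) (hq.1 b)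

theorem payoff_const {p : A → ℝ} {q : B → ℝ} (hp : p ∈ stdSimplex ℝ A) (hq : q ∈ stdSimplex ℝ B)
    (c : ℝ) : payoff p (fun _ _ => c) q = c := by
  rw [payoff_eq_sum]
  simp [← Finset.sum_mul, hp.2, hq.2]

theorem payoff_add (p : A → ℝ) (M N : A → B → ℝ) (q : B → ℝ) :
    payoff p (fun a b => M a b + N a b) q = payoff p M q + payoff p N q := by
  simp only [payoff, ← Finset.sum_add_distrib]
  exact Finset.sum_congr rfl fun a _ => Finset.sum_congr rfl fun b _ => by ring

theorem payoff_neg (p : A → ℝ) (M : A → B → ℝ) (q : B → ℝ) :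
    payoff p (fun a b => -M a b) q = -payoff p M q := by
  simp only [payoff, ← Finset.sum_neg_distrib]
  exact Finset.sum_congr rfl fun a _ => Finset.sum_congr rfl fun b _ => by ring

theorem payoff_single [DecidableEq B] (p : A → ℝ) (M : A → B → ℝ) (b : B) :
    payoff p M (Pi.single b 1) = ∑ a, p a * M a b := by
  rw [payoff_eq_sum, Finset.sum_eq_single b]
  · simp
  · intro c _ hc; simp [hc]
  · simp

/-- A linear function on the simplex is minimized at a vertex. The finite minimum makes
measurability in the data immediate. -/
theorem respValue_eq_inf' [Nonempty B] (p : A → ℝ) (M : A → B → ℝ) :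
    respValue p M = Finset.univ.inf' Finset.univ_nonempty fun b => ∑ a, p a * M a b := by
  classical
  have key : ∀ q : stdSimplex ℝ B,
      (Finset.univ.inf' Finset.univ_nonempty fun b => ∑ a, p a * M a b) ≤ payoff p M q := by
    intro q
    rw [payoff_eq_sum]
    calc _ = ∑ b, (q : B → ℝ) b *
          (Finset.univ.inf' Finset.univ_nonempty fun b => ∑ a, p a * M a b) := by
          rw [← Finset.sum_mul, show ∑ b, (q : B → ℝ) b = 1 from q.2.2, one_mul]
      _ ≤ _ := Finset.sum_le_sum fun b hb =>
          mul_le_mul_of_nonneg_left (Finset.inf'_le _ hb) (q.2.1 b)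
  have : Nonempty (stdSimplex ℝ B) :=
    ⟨⟨Pi.single (Classical.arbitrary B) 1, single_mem_stdSimplex ℝ _⟩⟩
  refine le_antisymm ?_ (le_ciInf key)
  refine Finset.le_inf' _ _ fun b _ => ?_
  refine (ciInf_le ⟨_, by rintro _ ⟨q, rfl⟩; exact key q⟩
    (⟨Pi.single b 1, single_mem_stdSimplex ℝ b⟩ : stdSimplex ℝ B)).trans ?_
  exact (payoff_single p M b).le

theorem respValue_le_payoff [Nonempty B] (p : A → ℝ) (M : A → B → ℝ) {q : B → ℝ}
    (hq : q ∈ stdSimplex ℝ B) : respValue p M ≤ payoff p M q := by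
  rw [respValue_eq_inf', payoff_eq_sum]
  calc _ = ∑ b, q b * (Finset.univ.inf' Finset.univ_nonempty fun b => ∑ a, p a * M a b) := by
        rw [← Finset.sum_mul, hq.2, one_mul]
    _ ≤ _ := Finset.sum_le_sum fun b hb =>
        mul_le_mul_of_nonneg_left (Finset.inf'_le _ hb) (hq.1 b)

theorem le_respValue [Nonempty B] {p : A → ℝ} {M : A → B → ℝ} {c : ℝ}
    (h : ∀ q ∈ stdSimplex ℝ B, c ≤ payoff p M q) : c ≤ respValue p M := by
  classical
  have : Nonempty (stdSimplex ℝ B) :=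
    ⟨⟨Pi.single (Classical.arbitrary B) 1, single_mem_stdSimplex ℝ _⟩⟩
  exact le_ciInf fun q => h q q.2

theorem respValue_le_add [Nonempty B] {p : A → ℝ} (hp : p ∈ stdSimplex ℝ A) {M N : A → B → ℝ}
    {c : ℝ} (h : ∀ a b, M a b ≤ N a b + c) : respValue p M ≤ respValue p N + c := by
  rw [← sub_le_iff_le_add]
  refine le_respValue fun q hq => ?_
  rw [sub_le_iff_le_add]
  calc _ ≤ payoff p M q := respValue_le_payoff p M hq
    _ ≤ payoff p (fun a b => N a b + c) q := payoff_mono hp hq h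
    _ = _ := by rw [payoff_add, payoff_const hp hq]

theorem respValue_const [Nonempty B] {p : A → ℝ} (hp : p ∈ stdSimplex ℝ A) (c : ℝ) :
    respValue p (fun (_ : A) (_ : B) => c) = c := by
  rw [respValue_eq_inf']
  simp [← Finset.sum_mul, hp.2]

theorem respValue_mem_Icc [Nonempty B] {p : A → ℝ} (hp : p ∈ stdSimplex ℝ A) {M : A → B → ℝ}
    {l u : ℝ} (h : ∀ a b, M a b ∈ Set.Icc l u) : respValue p M ∈ Set.Icc l u := by
  constructor
  · have := respValue_le_add (c := 0) hp (M := fun _ _ => l) (N := M)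
      (fun a b => by simpa using (h a b).1)
    rwa [respValue_const hp, add_zero] at this
  · have := respValue_le_add (c := 0) hp (M := M) (N := fun _ _ => u)
      (fun a b => by simpa using (h a b).2)
    rwa [respValue_const hp, add_zero] at this

theorem bddAbove_respValue [Nonempty B] (M : A → B → ℝ) :
    BddAbove (Set.range fun p : stdSimplex ℝ A => respValue (p : A → ℝ) M) := by
  refine ⟨∑ a, ∑ b, |M a b|, ?_⟩
  rintro _ ⟨p, rfl⟩
  refine (respValue_mem_Icc p.2 (M := M) (l := -∑ a, ∑ b, |M a b|) fun a b => ?_).2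
  have h : |M a b| ≤ ∑ a, ∑ b, |M a b| :=
    (Finset.single_le_sum (f := fun b => |M a b|) (fun _ _ => abs_nonneg _)
      (Finset.mem_univ b)).trans
      (Finset.single_le_sum (f := fun a => ∑ b, |M a b|)
        (fun _ _ => Finset.sum_nonneg fun _ _ => abs_nonneg _) (Finset.mem_univ a))
  exact ⟨(abs_le.1 h).1, (abs_le.1 h).2⟩

theorem respValue_le_gameValue [Nonempty B] {p : A → ℝ} (hp : p ∈ stdSimplex ℝ A)
    (M : A → B → ℝ) : respValue p M ≤ gameValue M :=
  le_ciSup (bddAbove_respValue M) (⟨p, hp⟩ : stdSimplex ℝ A)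

theorem gameValue_le_of_forall [Nonempty A] {M : A → B → ℝ} {c : ℝ}
    (h : ∀ p ∈ stdSimplex ℝ A, respValue p M ≤ c) : gameValue M ≤ c := by
  classical
  have : Nonempty (stdSimplex ℝ A) :=
    ⟨⟨Pi.single (Classical.arbitrary A) 1, single_mem_stdSimplex ℝ _⟩⟩
  exact ciSup_le fun p => h p p.2

theorem gameValue_le_add [Nonempty A] [Nonempty B] {M N : A → B → ℝ}
    {c : ℝ} (h : ∀ a b, M a b ≤ N a b + c) : gameValue M ≤ gameValue N + c :=
  gameValue_le_of_forall fun _ hp =>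
    (respValue_le_add hp h).trans (add_le_add_left (respValue_le_gameValue hp N) c)

theorem gameValue_mem_Icc [Nonempty A] [Nonempty B] {M : A → B → ℝ}
    {l u : ℝ} (h : ∀ a b, M a b ∈ Set.Icc l u) : gameValue M ∈ Set.Icc l u := by
  classical
  exact ⟨(respValue_mem_Icc (single_mem_stdSimplex ℝ (Classical.arbitrary A)) h).1.trans
    (respValue_le_gameValue (single_mem_stdSimplex ℝ _) M),
    gameValue_le_of_forall fun _ hp => (respValue_mem_Icc hp h).2⟩

/-- Perturbing every entry by at most `c` moves the value by at most `c`, so it is 1-Lipschitz in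
the sup norm. This is how measurability survives the supremum over an uncountable simplex. -/
theorem continuous_gameValue [Nonempty A] [Nonempty B] :
    Continuous (gameValue : (A → B → ℝ) → ℝ) := by
  refine (LipschitzWith.of_le_add fun M N => ?_).continuous
  refine gameValue_le_add fun a b => ?_
  have h1 : |M a b - N a b| ≤ dist M N := by
    rw [← Real.dist_eq]
    exact (dist_le_pi_dist (M a) (N a) b).trans (dist_le_pi_dist M N a)
  linarith [(abs_le.1 h1).2]

theorem measurable_gameValue [Nonempty A] [Nonempty B] {Y : Type*} [MeasurableSpace Y]
    {M : Y → A → B → ℝ} (hM : ∀ a b, Measurable fun y => M y a b) :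
    Measurable fun y => gameValue (M y) :=
  continuous_gameValue.measurable.comp
    (measurable_pi_lambda _ fun a => measurable_pi_lambda _ fun b => hM a b)

theorem measurable_respValue [Nonempty B] {Y : Type*} [MeasurableSpace Y]
    {p : Y → A → ℝ} (hp : ∀ a, Measurable fun y => p y a)
    {M : Y → A → B → ℝ} (hM : ∀ a b, Measurable fun y => M y a b) :
    Measurable fun y => respValue (p y) (M y) := by
  have h : Measurable (Finset.univ.inf' Finset.univ_nonempty fun b y => ∑ a, p y a * M y a b) :=
    Finset.inf'_induction Finset.univ_nonempty _ (p := Measurable)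
      (fun f hf g hg => hf.inf hg)
      (fun b _ => Finset.measurable_sum _ fun a _ => (hp a).mul (hM a b))
  convert h using 1
  ext y
  rw [respValue_eq_inf', Finset.inf'_apply]

end MatrixGameLemmas

/-! ### Measures on finite action sets as points of the simplex. -/

section Weights

variable {A : Type*} [Fintype A] [MeasurableSpace A] [DiscreteMeasurableSpace A]

theorem weights_mem_stdSimplex (m : Measure A) [IsProbabilityMeasure m] :
    weights m ∈ stdSimplex ℝ A := by
  refine ⟨fun a => measureReal_nonneg, ?_⟩
  unfold weights
  rw [sum_measureReal_singleton]
  simp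

theorem measurable_weights {Y : Type*} [MeasurableSpace Y] (κ : Kernel Y A) (a : A) :
    Measurable fun y => weights (κ y) a :=
  (κ.measurable_coe (measurableSet_singleton a)).ennreal_toReal

/-- Links the rollout, which draws the two actions independently, to the bilinear payoffs in which
the min-max inequalities live. -/
theorem integral_prod_eq_payoff {B : Type*} [Fintype B] [MeasurableSpace B]
    [DiscreteMeasurableSpace B] (m : Measure A) (n : Measure B) [IsProbabilityMeasure m]
    [IsProbabilityMeasure n] (F : A → B → ℝ) :
    ∫ z, F z.1 z.2 ∂(m.prod n) = payoff (weights m) F (weights n) := by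
  rw [integral_fintype .of_finite, Fintype.sum_prod_type]
  unfold payoff weights
  refine Finset.sum_congr rfl fun a _ => Finset.sum_congr rfl fun b _ => ?_
  rw [← Set.singleton_prod_singleton, measureReal_prod_prod, smul_eq_mul]
  ring

end Weights

/-! ### One-step unfolding of the law of an episode. -/

section Rollout

variable {U X A B : Type*} [MeasurableSpace U] [MeasurableSpace X] [MeasurableSpace A]
  [MeasurableSpace B]

theorem measurable_finCons {Y Z : Type*} [MeasurableSpace Y] [MeasurableSpace Z] {H : ℕ}
    {f : Y → Z} {g : Y → Fin H → Z} (hf : Measurable f) (hg : Measurable g) :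
    Measurable fun y => (Fin.cons (f y) (g y) : Fin (H + 1) → Z) := by
  refine measurable_pi_lambda _ fun i => ?_
  refine Fin.cases ?_ (fun j => ?_) i
  · simpa using hf
  · simpa using! (measurable_pi_apply j).comp hg

theorem measurable_finSnoc {Y Z : Type*} [MeasurableSpace Y] [MeasurableSpace Z] {H : ℕ}
    {f : Y → Z} {g : Y → Fin H → Z} (hf : Measurable f) (hg : Measurable g) :
    Measurable fun y => (Fin.snoc (g y) (f y) : Fin (H + 1) → Z) := by
  refine measurable_pi_lambda _ fun i => ?_
  refine Fin.lastCases ?_ (fun j => ?_) i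
  · simpa using hf
  · simpa using! (measurable_pi_apply j).comp hg

theorem isMarkovKernel_rollout : ∀ (H : ℕ) (P : Fin H → Kernel (X × A × B) X)
    (μ : Fin H → Kernel (U × X) A) (ν : Fin H → Kernel (U × X) B),
    (∀ h, IsMarkovKernel (P h)) → (∀ h, IsMarkovKernel (μ h)) → (∀ h, IsMarkovKernel (ν h)) →
    IsMarkovKernel (rollout H P μ ν)
  | 0, _, _, _, _, _, _ => by unfold rollout; infer_instance
  | H + 1, P, μ, ν, hP, hμ, hν => by
    have := hP 0; have := hμ 0; have := hν 0
    have := isMarkovKernel_rollout H (fun h => P h.succ) (fun h => μ h.succ) (fun h => ν h.succ)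
      (fun h => hP h.succ) (fun h => hμ h.succ) (fun h => hν h.succ)
    unfold rollout
    refine Kernel.IsMarkovKernel.map _ ?_
    exact measurable_finCons (by fun_prop) (by fun_prop)

variable {H : ℕ} {P : Fin (H + 1) → Kernel (X × A × B) X}
    {μ : Fin (H + 1) → Kernel (U × X) A} {ν : Fin (H + 1) → Kernel (U × X) B}

theorem lintegral_rollout_succ (hP : ∀ h, IsMarkovKernel (P h)) (hμ : ∀ h, IsMarkovKernel (μ h))
    (hν : ∀ h, IsMarkovKernel (ν h)) (y : U × X) {f : Traj (H + 1) X A B → ENNReal}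
    (hf : Measurable f) :
    ∫⁻ ζ, f ζ ∂(rollout (H + 1) P μ ν y) =
      ∫⁻ ab, ∫⁻ x', ∫⁻ ζ', f (Fin.cons (y.2, ab.1, ab.2) ζ')
        ∂(rollout H (fun h => P h.succ) (fun h => μ h.succ) (fun h => ν h.succ) (y.1, x'))
        ∂(P 0 (y.2, ab.1, ab.2)) ∂((μ 0 y).prod (ν 0 y)) := by
  have := hP 0; have := hμ 0; have := hν 0
  have := isMarkovKernel_rollout H (fun h => P h.succ) (fun h => μ h.succ) (fun h => ν h.succ)
      (fun h => hP h.succ) (fun h => hμ h.succ) (fun h => hν h.succ)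
  have hc : Measurable fun w : (U × X) × ((A × B) × Traj H X A B) =>
        (Fin.cons (w.1.2, w.2.1.1, w.2.1.2) w.2.2 : Traj (H + 1) X A B) :=
    measurable_finCons (by fun_prop) (by fun_prop)
  rw [rollout, Kernel.lintegral_map _ hc _ hf]
  refine (Kernel.lintegral_id_prod (hf.comp hc) _ _).trans ?_
  have hfc := hf.comp hc
  refine (Kernel.lintegral_compProd _ _ _ (hfc.comp measurable_prodMk_left)).trans ?_
  rw [Kernel.prod_apply]
  simp only [Function.comp_apply]
  refine lintegral_congr fun ab => ?_
  have hm : Measurable fun ζ' : Traj H X A B =>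
      f (Fin.cons (y.2, ab.1, ab.2) ζ' : Traj (H + 1) X A B) :=
    hf.comp (measurable_finCons measurable_const measurable_id)
  rw [Kernel.lintegral_comp _ _ _ hm, Kernel.prod_apply, Kernel.deterministic_apply,
    Kernel.comap_apply, lintegral_prod _ hm.lintegral_kernel.aemeasurable,
    lintegral_dirac' _ (Measurable.lintegral_prod_right' hm.lintegral_kernel)]

/-- The formula for nonnegative functions identifies the law as the image of an explicit
composition-product; boundedness then provides the integrability that splitting a Bochner integral
requires. -/
theorem integral_rollout_succ (hP : ∀ h, IsMarkovKernel (P h)) (hμ : ∀ h, IsMarkovKernel (μ h))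
    (hν : ∀ h, IsMarkovKernel (ν h)) (y : U × X) {f : Traj (H + 1) X A B → ℝ}
    (hf : Measurable f) {C : ℝ} (hC : ∀ ζ, |f ζ| ≤ C) :
    ∫ ζ, f ζ ∂(rollout (H + 1) P μ ν y) =
      ∫ ab, ∫ x', ∫ ζ', f (Fin.cons (y.2, ab.1, ab.2) ζ')
        ∂(rollout H (fun h => P h.succ) (fun h => μ h.succ) (fun h => ν h.succ) (y.1, x'))
        ∂(P 0 (y.2, ab.1, ab.2)) ∂((μ 0 y).prod (ν 0 y)) := by
  have := hP 0; have := hμ 0; have := hν 0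
  have := isMarkovKernel_rollout H (fun h => P h.succ) (fun h => μ h.succ) (fun h => ν h.succ)
      (fun h => hP h.succ) (fun h => hμ h.succ) (fun h => hν h.succ)
  let κP : Kernel (A × B) X := (P 0).comap (fun ab => (y.2, ab.1, ab.2)) (by fun_prop)
  let κR : Kernel ((A × B) × X) (Traj H X A B) :=
    (rollout H (fun h => P h.succ) (fun h => μ h.succ) (fun h => ν h.succ)).comap
      (fun z => (y.1, z.2)) (by fun_prop)
  have hc : Measurable fun w : (A × B) × (X × Traj H X A B) =>
        (Fin.cons (y.2, w.1.1, w.1.2) w.2.2 : Traj (H + 1) X A B) :=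
    measurable_finCons (by fun_prop) (by fun_prop)
  have key : rollout (H + 1) P μ ν y = (((μ 0 y).prod (ν 0 y)) ⊗ₘ (κP ⊗ₖ κR)).map
      fun w : (A × B) × (X × Traj H X A B) =>
        (Fin.cons (y.2, w.1.1, w.1.2) w.2.2 : Traj (H + 1) X A B) := by
    refine Measure.ext_of_lintegral _ fun g hg => ?_
    rw [lintegral_rollout_succ hP hμ hν y hg, lintegral_map hg hc]
    refine Eq.trans ?_ (Measure.lintegral_compProd (hg.comp hc)).symm
    have hgc := hg.comp hc
    refine lintegral_congr fun ab => ?_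
    exact (Kernel.lintegral_compProd κP κR _ (hgc.comp measurable_prodMk_left)).symm
  have hi : Integrable (fun w : (A × B) × (X × Traj H X A B) =>
        f (Fin.cons (y.2, w.1.1, w.1.2) w.2.2 : Traj (H + 1) X A B))
        (((μ 0 y).prod (ν 0 y)) ⊗ₘ (κP ⊗ₖ κR)) :=
    .of_bound (hf.comp hc).aestronglyMeasurable C (.of_forall fun _ => hC _)
  rw [key, integral_map hc.aemeasurable hf.aestronglyMeasurable, Measure.integral_compProd hi]
  refine integral_congr_ae (.of_forall fun ab => ?_)
  beta_reduce
  rw [integral_compProd]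
  · rfl
  · exact .of_bound ((hf.comp (hc.comp (measurable_const.prodMk
      measurable_id))).aestronglyMeasurable) C (.of_forall fun _ => hC _)

end Rollout

/-! ### One-sided Bellman comparison along an episode. -/

section Start

variable {X A B : Type*}

/-- The value of a function of the next state of a trajectory, and `0` after the last step. -/
noncomputable def tdNext {H : ℕ} (V : Fin H → X → ℝ) (h : Fin H) (ζ : Traj H X A B) : ℝ :=
  if hh : (h : ℕ) + 1 < H then V ⟨h + 1, hh⟩ (ζ ⟨h + 1, hh⟩).1 else 0

/-- The value of a function of the state in the first step, and `0` if there is no step. -/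
noncomputable def startVal {H : ℕ} (V : Fin H → X → ℝ) (x : X) : ℝ :=
  if hh : 0 < H then V ⟨0, hh⟩ x else 0

theorem tdNext_succ {H : ℕ} (V : Fin (H + 1) → X → ℝ) (h : Fin H) (z : X × A × B)
    (ζ : Traj H X A B) : tdNext V h.succ (Fin.cons z ζ : Traj (H + 1) X A B) =
      tdNext (fun h => V h.succ) h ζ := by
  unfold tdNext
  by_cases hh : (h : ℕ) + 1 < H
  · rw [dif_pos hh, dif_pos (by simpa using hh)]
    rfl
  · rw [dif_neg hh, dif_neg (by simpa using hh)]

end Start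

section Comparison

variable {U X A B : Type*} [MeasurableSpace U] [MeasurableSpace X] [MeasurableSpace A]
  [MeasurableSpace B]

/-- The expectation of a function of the next state, and `0` after the last step. -/
noncomputable def nextMean {H : ℕ} (P : Fin H → Kernel (X × A × B) X) (V : Fin H → X → ℝ)
    (h : Fin H) (z : X × A × B) : ℝ :=
  if hh : (h : ℕ) + 1 < H then ∫ x', V ⟨h + 1, hh⟩ x' ∂(P h z) else 0

theorem nextMean_succ {H : ℕ} (P : Fin (H + 1) → Kernel (X × A × B) X) (V : Fin (H + 1) → X → ℝ)
    (h : Fin H) (z : X × A × B) :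
    nextMean P V h.succ z = nextMean (fun h => P h.succ) (fun h => V h.succ) h z := by
  unfold nextMean
  by_cases hh : (h : ℕ) + 1 < H
  · rw [dif_pos hh, dif_pos (by simpa using hh)]
    rfl
  · rw [dif_neg hh, dif_neg (by simpa using hh)]

theorem nextMean_zero {H : ℕ} (P : Fin (H + 1) → Kernel (X × A × B) X) [IsMarkovKernel (P 0)]
    (V : Fin (H + 1) → X → ℝ) (z : X × A × B) :
    nextMean P V 0 z = ∫ x', startVal (fun h => V h.succ) x' ∂(P 0 z) := by
  unfold nextMean startVal
  by_cases hh : 0 < H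
  · simp only [dif_pos hh]
    rw [dif_pos (by simpa using hh)]
    rfl
  · simp only [dif_neg hh]
    rw [dif_neg (by simpa using hh)]
    simp

/-- If `U_h(x)` is at most the expectation of `D_h + P_h U_{h+1}` under the policies, then
`U_0(x)` is at most the expected sum of the `D_h`. -/
theorem startVal_le_integral_rollout [Fintype A] [DiscreteMeasurableSpace A] [Fintype B]
    [DiscreteMeasurableSpace B] (u : U) (C K : ℝ) : ∀ (H : ℕ) (P : Fin H → Kernel (X × A × B) X)
    (μ : Fin H → Kernel (U × X) A) (ν : Fin H → Kernel (U × X) B)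
    (_ : ∀ h, IsMarkovKernel (P h)) (_ : ∀ h, IsMarkovKernel (μ h)) (_ : ∀ h, IsMarkovKernel (ν h))
    (D : Fin H → X × A × B → ℝ) (V : Fin H → X → ℝ) (_ : ∀ h, Measurable (D h))
    (_ : ∀ h z, |D h z| ≤ C) (_ : ∀ h, Measurable (V h)) (_ : ∀ h x, |V h x| ≤ K)
    (_ : ∀ h x, V h x ≤ payoff (weights (μ h (u, x)))
      (fun a b => D h (x, a, b) + nextMean P V h (x, a, b)) (weights (ν h (u, x)))) (x : X),
    startVal V x ≤ ∫ ζ, ∑ h, D h (ζ h) ∂(rollout H P μ ν (u, x))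
  | 0, _, _, _, _, _, _, _, _, _, _, _, _, _, _ => by simp [startVal]
  | H + 1, P, μ, ν, hP, hμ, hν, D, V, hD, hDC, hV, hVC, hle, x => by
    have := hP 0; have := hμ 0; have := hν 0
    have hMk := isMarkovKernel_rollout H (fun h => P h.succ) (fun h => μ h.succ)
      (fun h => ν h.succ) (fun h => hP h.succ) (fun h => hμ h.succ) (fun h => hν h.succ)
    have ih := startVal_le_integral_rollout u C K H (fun h => P h.succ) (fun h => μ h.succ)
      (fun h => ν h.succ) (fun h => hP h.succ) (fun h => hμ h.succ) (fun h => hν h.succ)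
      (fun h => D h.succ) (fun h => V h.succ) (fun h => hD h.succ) (fun h => hDC h.succ)
      (fun h => hV h.succ) (fun h => hVC h.succ)
      (fun h x => by simpa only [nextMean_succ] using hle h.succ x)
    have hS : ∀ (n : ℕ) (E : Fin n → X × A × B → ℝ), (∀ h, Measurable (E h)) →
        (∀ h z, |E h z| ≤ C) → Measurable (fun ζ : Traj n X A B => ∑ h, E h (ζ h)) ∧
        ∀ ζ : Traj n X A B, |∑ h, E h (ζ h)| ≤ n * C := by
      intro n E hE hEC
      refine ⟨Finset.measurable_sum _ fun h _ => (hE h).comp (measurable_pi_apply h), fun ζ => ?_⟩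
      refine (Finset.abs_sum_le_sum_abs _ _).trans ?_
      exact (Finset.sum_le_sum fun h _ => hEC h _).trans (by simp)
    obtain ⟨hm1, hb1⟩ := hS (H + 1) D hD hDC
    obtain ⟨hm2, hb2⟩ := hS H (fun h => D h.succ) (fun h => hD h.succ) (fun h => hDC h.succ)
    rw [integral_rollout_succ hP hμ hν (u, x) hm1 hb1]
    have hJ : Measurable fun x' => ∫ ζ', ∑ h : Fin H, D h.succ (ζ' h) ∂(rollout H
        (fun h => P h.succ) (fun h => μ h.succ) (fun h => ν h.succ) (u, x')) := by
      have h3 : StronglyMeasurable fun y : U × X => ∫ ζ', ∑ h : Fin H, D h.succ (ζ' h)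
          ∂(rollout H (fun h => P h.succ) (fun h => μ h.succ) (fun h => ν h.succ) y) :=
        (hm2.comp measurable_snd).stronglyMeasurable.integral_kernel_prod_right'
      exact h3.measurable.comp (measurable_const.prodMk measurable_id)
    have hJb : ∀ x', |∫ ζ', ∑ h : Fin H, D h.succ (ζ' h) ∂(rollout H
        (fun h => P h.succ) (fun h => μ h.succ) (fun h => ν h.succ) (u, x'))| ≤ H * C := by
      intro x'
      refine (norm_integral_le_of_norm_le_const
        (Filter.Eventually.of_forall fun ζ => (Real.norm_eq_abs _).trans_le (hb2 ζ))).trans ?_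
      simp
    have step : ∀ ab : A × B, D 0 (x, ab.1, ab.2) + nextMean P V 0 (x, ab.1, ab.2) ≤
        ∫ x', ∫ ζ', ∑ h, D h ((Fin.cons (x, ab.1, ab.2) ζ' : Traj (H + 1) X A B) h)
        ∂(rollout H (fun h => P h.succ) (fun h => μ h.succ) (fun h => ν h.succ) (u, x'))
        ∂(P 0 (x, ab.1, ab.2)) := by
      intro ab
      simp only [Fin.sum_univ_succ, Fin.cons_zero, Fin.cons_succ]
      have h1 : ∀ x', ∫ ζ', (D 0 (x, ab.1, ab.2) + ∑ h : Fin H, D h.succ (ζ' h))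
          ∂(rollout H (fun h => P h.succ) (fun h => μ h.succ) (fun h => ν h.succ) (u, x')) =
          D 0 (x, ab.1, ab.2) + ∫ ζ', ∑ h : Fin H, D h.succ (ζ' h)
          ∂(rollout H (fun h => P h.succ) (fun h => μ h.succ) (fun h => ν h.succ) (u, x')) := by
        intro x'
        rw [integral_add (integrable_const _)
          (.of_bound hm2.aestronglyMeasurable _ (.of_forall hb2))]
        simp
      simp only [h1]
      have hJi : Integrable (fun x' => ∫ ζ', ∑ h : Fin H, D h.succ (ζ' h) ∂(rollout H
          (fun h => P h.succ) (fun h => μ h.succ) (fun h => ν h.succ) (u, x')))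
          (P 0 (x, ab.1, ab.2)) :=
        .of_bound hJ.aestronglyMeasurable _ (.of_forall hJb)
      rw [integral_add (integrable_const _) hJi, nextMean_zero]
      simp only [integral_const, probReal_univ, one_smul]
      refine add_le_add le_rfl (integral_mono ?_ hJi ih)
      -- `K` is not assumed nonnegative, and with no step left `startVal` is `0` whatever `K` is.
      refine .of_bound (C := max K 0) ?_ (.of_forall fun x' => ?_)
      · unfold startVal
        split_ifs
        · exact (hV _).aestronglyMeasurable
        · exact aestronglyMeasurable_const
      · unfold startVal
        split_ifs
        · exact (hVC _ _).trans (le_max_left _ _)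
        · simp
    calc startVal V x = V 0 x := by simp [startVal]
      _ ≤ _ := hle 0 x
      _ = ∫ ab, (D 0 (x, ab.1, ab.2) + nextMean P V 0 (x, ab.1, ab.2))
          ∂((μ 0 (u, x)).prod (ν 0 (u, x))) := by rw [← integral_prod_eq_payoff]
      _ ≤ _ := integral_mono .of_finite .of_finite step

end Comparison

/-! ### Exponential moments along one episode. -/

section ExpMoment

variable {U X A B : Type*} [MeasurableSpace U] [MeasurableSpace X] [MeasurableSpace A]
  [MeasurableSpace B]

/-- The first state of a rollout is its starting state, so a factor reading that state off the
trajectory may be treated as a constant. -/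
theorem lintegral_rollout_start {H : ℕ} {P : Fin (H + 1) → Kernel (X × A × B) X}
    {μ : Fin (H + 1) → Kernel (U × X) A} {ν : Fin (H + 1) → Kernel (U × X) B}
    (hP : ∀ h, IsMarkovKernel (P h)) (hμ : ∀ h, IsMarkovKernel (μ h))
    (hν : ∀ h, IsMarkovKernel (ν h)) (y : U × X) {F : X × Traj (H + 1) X A B → ENNReal}
    (hF : Measurable F) :
    ∫⁻ ζ, F ((ζ 0).1, ζ) ∂(rollout (H + 1) P μ ν y) =
      ∫⁻ ζ, F (y.2, ζ) ∂(rollout (H + 1) P μ ν y) := by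
  rw [lintegral_rollout_succ hP hμ hν y (by fun_prop),
    lintegral_rollout_succ hP hμ hν y (by fun_prop)]
  rfl

theorem measurable_tdNext {H : ℕ} {V : Fin H → X → ℝ} (hV : ∀ h, Measurable (V h)) (h : Fin H) :
    Measurable (tdNext (A := A) (B := B) V h) := by
  unfold tdNext
  split_ifs with hh
  · exact (hV _).comp (by fun_prop)
  · exact measurable_const

/-- The one-episode form of a supermartingale. Peel off the first step: from every next state the
remaining product integrates to at most one, after which the first factor does so by hypothesis,
uniformly in the actions. -/
theorem lintegral_rollout_prod_le (u : U) : ∀ (H : ℕ) (P : Fin H → Kernel (X × A × B) X)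
    (μ : Fin H → Kernel (U × X) A) (ν : Fin H → Kernel (U × X) B)
    (_ : ∀ h, IsMarkovKernel (P h)) (_ : ∀ h, IsMarkovKernel (μ h)) (_ : ∀ h, IsMarkovKernel (ν h))
    (V : Fin H → X → ℝ) (_ : ∀ h, Measurable (V h)) (k : Fin H → X × A × B → ℝ → ENNReal)
    (_ : ∀ h, Measurable (Function.uncurry (k h)))
    (_ : ∀ (h : Fin H) z, (if hh : (h : ℕ) + 1 < H then ∫⁻ x', k h z (V ⟨h + 1, hh⟩ x') ∂(P h z)
      else k h z 0) ≤ 1) (x : X),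
    ∫⁻ ζ, ∏ h, k h (ζ h) (tdNext V h ζ) ∂(rollout H P μ ν (u, x)) ≤ 1
  | 0, _, _, _, _, _, _, _, _, _, _, _, _ => by simp [rollout]
  | H + 1, P, μ, ν, hP, hμ, hν, V, hV, k, hk, hle, x => by
    have := hP 0; have := hμ 0; have := hν 0
    have hMk := isMarkovKernel_rollout H (fun h => P h.succ) (fun h => μ h.succ)
      (fun h => ν h.succ) (fun h => hP h.succ) (fun h => hμ h.succ) (fun h => hν h.succ)
    have ih := lintegral_rollout_prod_le u H (fun h => P h.succ) (fun h => μ h.succ)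
      (fun h => ν h.succ) (fun h => hP h.succ) (fun h => hμ h.succ) (fun h => hν h.succ)
      (fun h => V h.succ) (fun h => hV h.succ) (fun h => k h.succ) (fun h => hk h.succ)
      (fun h z => by
        have := hle h.succ z
        by_cases hh : (h : ℕ) + 1 < H
        · rw [dif_pos hh]; rwa [dif_pos (by simpa using hh)] at this
        · rw [dif_neg hh]; rwa [dif_neg (by simpa using hh)] at this)
    have hm : ∀ (n : ℕ) (W : Fin n → X → ℝ) (l : Fin n → X × A × B → ℝ → ENNReal),
        (∀ h, Measurable (W h)) → (∀ h, Measurable (Function.uncurry (l h))) →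
        Measurable fun ζ : Traj n X A B => ∏ h, l h (ζ h) (tdNext W h ζ) := fun n W l hW hl =>
      Finset.measurable_prod _ fun h _ =>
        (hl h).comp ((measurable_pi_apply h).prodMk (measurable_tdNext hW h))
    have hm' := hm H (fun h => V h.succ) (fun h => k h.succ) (fun h => hV h.succ)
      (fun h => hk h.succ)
    rw [lintegral_rollout_succ hP hμ hν (u, x) (hm _ V k hV hk)]
    have step : ∀ (ab : A × B) (x' : X), ∫⁻ ζ', ∏ h,
        k h ((Fin.cons (x, ab.1, ab.2) ζ' : Traj (H + 1) X A B) h)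
          (tdNext V h (Fin.cons (x, ab.1, ab.2) ζ' : Traj (H + 1) X A B))
        ∂(rollout H (fun h => P h.succ) (fun h => μ h.succ) (fun h => ν h.succ) (u, x')) ≤
        k 0 (x, ab.1, ab.2) (startVal (fun h => V h.succ) x') := by
      intro ab x'
      simp only [Fin.prod_univ_succ, Fin.cons_zero, Fin.cons_succ, tdNext_succ]
      -- The first factor looks at the second state of the trajectory. That state is `x'`, so the
      -- factor leaves the integral over the remaining trajectory.
      have hpull : ∫⁻ ζ', k 0 (x, ab.1, ab.2)
          (tdNext V 0 (Fin.cons (x, ab.1, ab.2) ζ' : Traj (H + 1) X A B)) *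
          ∏ h : Fin H, k h.succ (ζ' h) (tdNext (fun h => V h.succ) h ζ')
          ∂(rollout H (fun h => P h.succ) (fun h => μ h.succ) (fun h => ν h.succ) (u, x')) =
          ∫⁻ ζ', k 0 (x, ab.1, ab.2) (startVal (fun h => V h.succ) x') *
          ∏ h : Fin H, k h.succ (ζ' h) (tdNext (fun h => V h.succ) h ζ')
          ∂(rollout H (fun h => P h.succ) (fun h => μ h.succ) (fun h => ν h.succ) (u, x')) := by
        clear ih
        cases H with
        | zero => rfl
        | succ n =>
          have hk0 : Measurable fun v => k 0 (x, ab.1, ab.2) v :=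
            (hk 0).comp measurable_prodMk_left
          have hV1 := hV 1
          exact lintegral_rollout_start (fun h => hP h.succ) (fun h => hμ h.succ)
            (fun h => hν h.succ) (u, x') (F := fun w => k 0 (x, ab.1, ab.2) (V 1 w.1) *
            ∏ h : Fin (n + 1), k h.succ (w.2 h) (tdNext (fun h => V h.succ) h w.2))
            ((hk0.comp (hV1.comp measurable_fst)).mul (hm'.comp measurable_snd))
      rw [hpull, lintegral_const_mul _ hm']
      exact mul_le_of_le_one_right' (ih x')
    have step2 : ∀ ab : A × B, ∫⁻ x', k 0 (x, ab.1, ab.2) (startVal (fun h => V h.succ) x')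
        ∂(P 0 (x, ab.1, ab.2)) ≤ 1 := by
      intro ab
      refine le_trans (le_of_eq ?_) (hle 0 (x, ab.1, ab.2))
      unfold startVal
      by_cases hh : 0 < H
      · simp only [dif_pos hh]
        rw [dif_pos (by simpa using hh)]
        rfl
      · simp only [dif_neg hh]
        rw [dif_neg (by simpa using hh)]
        simp
    calc _ ≤ ∫⁻ ab, ∫⁻ x', k 0 (x, ab.1, ab.2) (startVal (fun h => V h.succ) x')
          ∂(P 0 (x, ab.1, ab.2)) ∂((μ 0 (u, x)).prod (ν 0 (u, x))) :=
          lintegral_mono fun ab => lintegral_mono fun x' => step ab x'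
      _ ≤ ∫⁻ _, 1 ∂((μ 0 (u, x)).prod (ν 0 (u, x))) := lintegral_mono step2
      _ = 1 := by simp

/-- Hoeffding's lemma for the excess squared loss of a prediction with bias `e`. -/
theorem lintegral_exp_excess_le (m : Measure X) [IsProbabilityMeasure m] {V : X → ℝ}
    (hV : Measurable V) {R a : ℝ} (hVR : ∀ x, V x ∈ Set.Icc 0 R) (ha : 0 ≤ a)
    (haR : a * R ^ 2 ≤ 1.6) (e : ℝ) :
    ∫⁻ x, ENNReal.ofReal (Real.exp (-a * ((e + ∫ y, V y ∂m - V x) ^ 2 -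
      (∫ y, V y ∂m - V x) ^ 2) + 0.2 * a * e ^ 2)) ∂m ≤ 1 := by
  have hs := hasSubgaussianMGF_of_mem_Icc (μ := m) hV.aemeasurable (.of_forall hVR)
  have hmgf := hs.mgf_le (2 * a * e)
  have hint := hs.integrable_exp_mul (2 * a * e)
  rw [mgf] at hmgf
  set b := ∫ y, V y ∂m
  have hrew : ∀ x, Real.exp (-a * ((e + b - V x) ^ 2 - (b - V x) ^ 2) + 0.2 * a * e ^ 2) =
      Real.exp (2 * a * e * (V x - b)) * Real.exp (-0.8 * a * e ^ 2) := by
    intro x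
    rw [← Real.exp_add]
    ring_nf
  simp only [hrew]
  rw [← ofReal_integral_eq_lintegral_ofReal (hint.mul_const _)
    (.of_forall fun x => by positivity), integral_mul_const]
  rw [show (1 : ENNReal) = ENNReal.ofReal 1 by simp]
  refine ENNReal.ofReal_le_ofReal ?_
  refine (mul_le_mul_of_nonneg_right hmgf (Real.exp_nonneg _)).trans ?_
  rw [← Real.exp_add, Real.exp_le_one_iff]
  have hc : ((((‖R - 0‖₊ / 2) ^ 2 : NNReal)) : ℝ) = R ^ 2 / 4 := by
    simp [div_pow]
    norm_num
  rw [hc]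
  -- The moment generating function at `2 a e` with variance proxy `R² / 4` costs `a² e² R² / 2`.
  -- The excess loss leaves `-a e² + 0.2 a e² = -0.8 a e²`, so `a R² ≤ 1.6` is exactly what is
  -- needed.
  have : a * R ^ 2 * (a * e ^ 2) ≤ 1.6 * (a * e ^ 2) :=
    mul_le_mul_of_nonneg_right haR (by positivity)
  nlinarith

end ExpMoment

/-! ### Excess temporal-difference loss and Bellman residuals. -/

section Excess

variable {H : ℕ} {X A B : Type*} [MeasurableSpace X] [MeasurableSpace A] [MeasurableSpace B]

/-- The Bellman residual `q_h - r_h - P_h V_{h+1}`. -/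
noncomputable def resid (G : Game H X A B) (q : Fin H → X × A × B → ℝ) (V : Fin H → X → ℝ)
    (h : Fin H) (z : X × A × B) : ℝ :=
  q h z - G.r h z - nextMean G.P V h z

/-- The squared temporal-difference loss of `q_h` in excess of that of `r_h + P_h V_{h+1}`. -/
noncomputable def excess (G : Game H X A B) (q : Fin H → X × A × B → ℝ) (V : Fin H → X → ℝ)
    (h : Fin H) (ζ : Traj H X A B) : ℝ :=
  (q h (ζ h) - G.r h (ζ h) - tdNext V h ζ) ^ 2 - (nextMean G.P V h (ζ h) - tdNext V h ζ) ^ 2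

/-- Difference of squares: the excess is the squared residual plus the residual times noise of
conditional mean zero. In particular a small residual forces a small excess. -/
theorem excess_eq (G : Game H X A B) (q : Fin H → X × A × B → ℝ) (V : Fin H → X → ℝ)
    (h : Fin H) (ζ : Traj H X A B) :
    excess G q V h ζ = resid G q V h (ζ h) *
      (resid G q V h (ζ h) + 2 * (nextMean G.P V h (ζ h) - tdNext V h ζ)) := by
  unfold excess resid
  ring

theorem measurable_nextMean {P : Fin H → Kernel (X × A × B) X} (hP : ∀ h, IsMarkovKernel (P h))
    {Y : Type*} [MeasurableSpace Y] {V : Y → Fin H → X → ℝ}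
    (hV : ∀ h, Measurable fun y : Y × X => V y.1 h y.2) (h : Fin H) :
    Measurable fun y : Y × (X × A × B) => nextMean P (V y.1) h y.2 := by
  unfold nextMean
  split_ifs with hh
  · have := hP h
    let Q : Kernel (Y × (X × A × B)) X := (P h).comap Prod.snd measurable_snd
    have h2 : StronglyMeasurable fun y : Y × (X × A × B) =>
        ∫ x', V y.1 ⟨h + 1, hh⟩ x' ∂(Q y) := by
      refine StronglyMeasurable.integral_kernel_prod_right'
        (f := fun w : (Y × (X × A × B)) × X => V w.1.1 ⟨h + 1, hh⟩ w.2) ?_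
      exact ((hV _).comp (by fun_prop : Measurable fun w : (Y × (X × A × B)) × X =>
        (w.1.1, w.2))).stronglyMeasurable
    exact h2.measurable
  · exact measurable_const

theorem measurable_resid (G : Game H X A B) {Y : Type*} [MeasurableSpace Y]
    {q : Y → Fin H → X × A × B → ℝ} (hq : ∀ h, Measurable fun y : Y × (X × A × B) => q y.1 h y.2)
    {V : Y → Fin H → X → ℝ} (hV : ∀ h, Measurable fun y : Y × X => V y.1 h y.2) (h : Fin H) :
    Measurable fun y : Y × (X × A × B) => resid G (q y.1) (V y.1) h y.2 :=
  ((hq h).sub ((G.measurable_r h).comp measurable_snd)).sub (measurable_nextMean G.markov hV h)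

theorem measurable_excess (G : Game H X A B) {Y : Type*} [MeasurableSpace Y]
    {q : Y → Fin H → X × A × B → ℝ} (hq : ∀ h, Measurable fun y : Y × (X × A × B) => q y.1 h y.2)
    {V : Y → Fin H → X → ℝ} (hV : ∀ h, Measurable fun y : Y × X => V y.1 h y.2) (h : Fin H) :
    Measurable fun y : Y × Traj H X A B => excess G (q y.1) (V y.1) h y.2 := by
  have hz : Measurable fun y : Y × Traj H X A B => (y.1, y.2 h) := by fun_prop
  have ht : Measurable fun y : Y × Traj H X A B => tdNext (V y.1) h y.2 := by
    unfold tdNext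
    split_ifs with hh
    · exact (hV _).comp (by fun_prop : Measurable fun y : Y × Traj H X A B =>
        (y.1, (y.2 ⟨h + 1, hh⟩).1))
    · exact measurable_const
  exact (((((hq h).comp hz).sub ((G.measurable_r h).comp (measurable_snd.comp hz))).sub
    ht).pow_const 2).sub ((((measurable_nextMean G.markov hV h).comp hz).sub ht).pow_const 2)

/-- Given the state and the actions of a step, the only noise in its loss is the next state, so
Hoeffding's bound applies step by step whatever the policies. The last step has no noise at all. -/
theorem lintegral_rollout_exp_excess_le {U : Type*} [MeasurableSpace U] (G : Game H X A B)
    {μ : Fin H → Kernel (U × X) A} {ν : Fin H → Kernel (U × X) B}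
    (hμ : ∀ h, IsMarkovKernel (μ h)) (hν : ∀ h, IsMarkovKernel (ν h))
    {q : Fin H → X × A × B → ℝ} (hq : ∀ h, Measurable (q h)) {V : Fin H → X → ℝ}
    (hV : ∀ h, Measurable (V h)) {R a : ℝ} (hVR : ∀ h x, V h x ∈ Set.Icc 0 R) (ha : 0 ≤ a)
    (haR : a * R ^ 2 ≤ 1.6) (y : U × X) :
    ∫⁻ ζ, ENNReal.ofReal (Real.exp (∑ h, (-a * excess G q V h ζ +
      0.2 * a * resid G q V h (ζ h) ^ 2))) ∂(rollout H G.P μ ν y) ≤ 1 := by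
  have hn : ∀ h, Measurable (nextMean G.P V h) := fun h =>
    (measurable_nextMean (Y := Unit) G.markov (V := fun _ => V)
      (fun h => (hV h).comp measurable_snd) h).comp (measurable_prodMk_left (x := ()))
  have hr : ∀ h, Measurable (resid G q V h) := fun h =>
    ((hq h).sub (G.measurable_r h)).sub (hn h)
  have := lintegral_rollout_prod_le y.1 H G.P μ ν G.markov hμ hν V hV
    (fun h z v => ENNReal.ofReal (Real.exp (-a * ((q h z - G.r h z - v) ^ 2 -
      (nextMean G.P V h z - v) ^ 2) + 0.2 * a * resid G q V h z ^ 2))) ?_ ?_ y.2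
  · refine le_trans (le_of_eq (lintegral_congr fun ζ => ?_)) this
    rw [Real.exp_sum, ENNReal.ofReal_prod_of_nonneg fun _ _ => (Real.exp_pos _).le]
    rfl
  · intro h
    have := hq h; have := hn h; have := hr h; have := G.measurable_r h
    unfold Function.uncurry
    fun_prop
  · intro h z
    have := G.markov h
    split_ifs with hh
    · have key := lintegral_exp_excess_le (G.P h z) (hV ⟨h + 1, hh⟩) (hVR _) ha haR
        (resid G q V h z)
      have e : ∫ y, V ⟨h + 1, hh⟩ y ∂(G.P h z) = nextMean G.P V h z := by
        unfold nextMean; rw [dif_pos hh]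
      rw [e] at key
      have e2 : resid G q V h z + nextMean G.P V h z = q h z - G.r h z := by unfold resid; ring
      rwa [e2] at key
    · have e : nextMean G.P V h z = 0 := by unfold nextMean; rw [dif_neg hh]
      have e2 : resid G q V h z = q h z - G.r h z := by unfold resid; rw [e]; ring
      rw [e, e2, ENNReal.ofReal_le_one, Real.exp_le_one_iff]
      nlinarith [mul_nonneg ha (sq_nonneg (q h z - G.r h z))]

end Excess

/-! ### Bellman backups are linear in the features, with measurable parameters. -/

section Representation

variable {H d : ℕ} {X A B : Type*} [MeasurableSpace X] [MeasurableSpace A] [MeasurableSpace B]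

theorem natFloor_eq_sum {y : ℝ} (hy : 0 ≤ y) {N : ℕ} (hN : ⌊y⌋₊ ≤ N) :
    (⌊y⌋₊ : ℝ) = ∑ k ∈ Finset.Icc 1 N, if (k : ℝ) ≤ y then 1 else 0 := by
  rw [Finset.sum_ite, Finset.sum_const_zero, add_zero, Finset.sum_const, nsmul_eq_mul, mul_one]
  congr 1
  have : Finset.filter (fun k : ℕ => (k : ℝ) ≤ y) (Finset.Icc 1 N) = Finset.Icc 1 ⌊y⌋₊ := by
    ext k
    simp only [Finset.mem_filter, Finset.mem_Icc, ← Nat.le_floor_iff hy]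
    omega
  rw [this]
  simp

/-- The expectation of a bounded function of the next state is linear in the features. -/
theorem IsLinear.exists_representer {G : Game H X A B} {φ : Fin H → X × A × B → Vec d}
    (hl : IsLinear G φ) (h : Fin H) {R : ℝ} {V : X → ℝ} (hV : Measurable V)
    (hVR : ∀ x, V x ∈ Set.Icc 0 R) :
    ∃ w : Vec d, ‖w‖ ≤ R * √(d : ℝ) ∧ ∀ z, inner ℝ (φ h z) w = ∫ x, V x ∂(G.P h z) := by
  obtain ⟨m, hm, hmP⟩ := hl.transition h
  have hR : 0 ≤ R := (hVR G.x₁).1.trans (hVR G.x₁).2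
  -- Layer cake. The vector measure is bounded only on sets, so `V` is rounded down to multiples of
  -- `1 / (n + 1)` and written as an average of indicators of superlevel sets. About `(n + 1) R`
  -- sets of norm at most `√d` give `R √d` with no further constant.
  let S : ℕ → ℕ → Set X := fun n k => {x | (k : ℝ) ≤ (n + 1) * V x}
  have hS : ∀ n k, MeasurableSet (S n k) := fun n k =>
    measurableSet_le measurable_const (hV.const_mul _)
  let w : ℕ → Vec d := fun n =>
    ((n : ℝ) + 1)⁻¹ • ∑ k ∈ Finset.Icc 1 ⌊((n : ℝ) + 1) * R⌋₊, m (S n k)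
  have hw : ∀ n, w n ∈ Metric.closedBall (0 : Vec d) (R * √(d : ℝ)) := by
    intro n
    rw [mem_closedBall_zero_iff, norm_smul, Real.norm_of_nonneg (by positivity)]
    have h1 : ‖∑ k ∈ Finset.Icc 1 ⌊((n : ℝ) + 1) * R⌋₊, m (S n k)‖ ≤
        ⌊((n : ℝ) + 1) * R⌋₊ * √(d : ℝ) := by
      refine (norm_sum_le _ _).trans ((Finset.sum_le_sum fun k _ => hm _ (hS n k)).trans ?_)
      simp
    have h2 : (⌊((n : ℝ) + 1) * R⌋₊ : ℝ) ≤ (n + 1) * R := Nat.floor_le (by positivity)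
    calc _ ≤ ((n : ℝ) + 1)⁻¹ * (((n : ℝ) + 1) * R * √(d : ℝ)) := by gcongr; exact h1.trans (by gcongr)
      _ = R * √(d : ℝ) := by field_simp
  have hwz : ∀ n z, |inner ℝ (φ h z) (w n) - ∫ x, V x ∂(G.P h z)| ≤ ((n : ℝ) + 1)⁻¹ := by
    intro n z
    have := G.markov h
    have hpos : (0 : ℝ) < n + 1 := by positivity
    have hint : ∀ k : ℕ, Integrable (fun x => if (k : ℝ) ≤ (n + 1) * V x then (1 : ℝ) else 0)
        (G.P h z) := fun k => .of_bound (Measurable.ite (hS n k) measurable_const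
          measurable_const).aestronglyMeasurable 1 (.of_forall fun x => by split_ifs <;> simp)
    have h1 : inner ℝ (φ h z) (w n) =
        ∫ x, ((n : ℝ) + 1)⁻¹ * (⌊((n : ℝ) + 1) * V x⌋₊ : ℝ) ∂(G.P h z) := by
      rw [inner_smul_right, inner_sum, integral_const_mul]
      congr 1
      have h2 : ∀ x, (⌊((n : ℝ) + 1) * V x⌋₊ : ℝ) = ∑ k ∈ Finset.Icc 1 ⌊((n : ℝ) + 1) * R⌋₊,
          if (k : ℝ) ≤ (n + 1) * V x then (1 : ℝ) else 0 := fun x =>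
        natFloor_eq_sum (mul_nonneg hpos.le (hVR x).1)
          (Nat.floor_le_floor (mul_le_mul_of_nonneg_left (hVR x).2 hpos.le))
      simp only [h2]
      rw [integral_finsetSum _ fun k _ => hint k]
      refine Finset.sum_congr rfl fun k _ => ?_
      rw [← hmP z _ (hS n k), ← integral_indicator_one (hS n k)]
      refine integral_congr_ae (.of_forall fun x => ?_)
      simp [S, Set.indicator_apply]
    have hb : ∀ x, |((n : ℝ) + 1)⁻¹ * (⌊((n : ℝ) + 1) * V x⌋₊ : ℝ) - V x| ≤ ((n : ℝ) + 1)⁻¹ := by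
      intro x
      have h3 := Nat.floor_le (mul_nonneg hpos.le (hVR x).1)
      have h4 := Nat.lt_floor_add_one (((n : ℝ) + 1) * V x)
      have h5 : ((n : ℝ) + 1)⁻¹ * (⌊((n : ℝ) + 1) * V x⌋₊ : ℝ) - V x =
          ((n : ℝ) + 1)⁻¹ * ((⌊((n : ℝ) + 1) * V x⌋₊ : ℝ) - ((n : ℝ) + 1) * V x) := by
        field_simp
      rw [h5, abs_mul, abs_of_pos (inv_pos.2 hpos)]
      refine mul_le_of_le_one_right (by positivity) (abs_le.2 ⟨by linarith, by linarith⟩)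
    have hVi : Integrable V (G.P h z) := .of_bound hV.aestronglyMeasurable R
      (.of_forall fun x => by rw [Real.norm_of_nonneg (hVR x).1]; exact (hVR x).2)
    have hfm : Measurable fun x => ((n : ℝ) + 1)⁻¹ * (⌊((n : ℝ) + 1) * V x⌋₊ : ℝ) :=
      ((measurable_from_top (f := fun n : ℕ => (n : ℝ))).comp
        (Nat.measurable_floor.comp (hV.const_mul _))).const_mul _
    have hfi : Integrable (fun x => ((n : ℝ) + 1)⁻¹ * (⌊((n : ℝ) + 1) * V x⌋₊ : ℝ)) (G.P h z) := by
      refine .of_bound hfm.aestronglyMeasurable R (.of_forall fun x => ?_)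
      rw [Real.norm_of_nonneg (by positivity)]
      calc _ ≤ ((n : ℝ) + 1)⁻¹ * (((n : ℝ) + 1) * V x) := by
            gcongr; exact Nat.floor_le (mul_nonneg hpos.le (hVR x).1)
        _ = V x := by field_simp
        _ ≤ R := (hVR x).2
    rw [h1, ← integral_sub hfi hVi]
    refine (norm_integral_le_of_norm_le_const
      (Filter.Eventually.of_forall fun x => (Real.norm_eq_abs _).trans_le (hb x))).trans ?_
    simp
  -- The approximate representers stay in a compact ball and their pairings with every feature
  -- converge, so any limit point is an exact representer.
  obtain ⟨w₀, hw₀, ψ, hψ, hlim⟩ := (isCompact_closedBall (0 : Vec d) (R * √(d : ℝ))).tendsto_subseq hw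
  refine ⟨w₀, by simpa using hw₀, fun z => ?_⟩
  have l1 : Filter.Tendsto (fun n => inner ℝ (φ h z) (w (ψ n))) Filter.atTop
      (nhds (inner ℝ (φ h z) w₀)) := (tendsto_const_nhds (x := φ h z)).inner hlim
  have l2 : Filter.Tendsto (fun n => inner ℝ (φ h z) (w (ψ n))) Filter.atTop
      (nhds (∫ x, V x ∂(G.P h z))) := by
    rw [tendsto_iff_dist_tendsto_zero]
    refine squeeze_zero (fun _ => dist_nonneg) (fun n => (Real.dist_eq _ _).trans_le (hwz (ψ n) z)) ?_
    exact (tendsto_one_div_add_atTop_nhds_zero_nat.comp hψ.tendsto_atTop).congr fun n => by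
      simp
  exact tendsto_nhds_unique l1 l2

/-- A parameter matters only modulo the orthogonal complement of the features. Its projection onto
their span does not increase the norm and is a linear function of its pairings with a finite basis
of the span chosen among the features. -/
theorem exists_reconstruction {Z : Type*} (f : Z → Vec d) : ∃ (ι : Type) (_ : Fintype ι) (z : ι → Z)
    (L : (ι → ℝ) →ₗ[ℝ] Vec d), ∀ v : Vec d,
      ‖L fun i => inner ℝ (f (z i)) v‖ ≤ ‖v‖ ∧
      ∀ y, inner ℝ (f y) (L fun i => inner ℝ (f (z i)) v) = inner ℝ (f y) v := by
  obtain ⟨t, hts, htspan, hti⟩ := exists_linearIndependent ℝ (Set.range f)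
  have hfin : t.Finite := hti.setFinite
  have : Fintype t := hfin.fintype
  choose z hz using fun i : t => hts i.2
  let S := Submodule.span ℝ (Set.range f)
  let Γ : S →ₗ[ℝ] (t → ℝ) :=
    LinearMap.pi fun i => (innerₛₗ ℝ (i : Vec d)).comp S.subtype
  -- A vector of the span that is orthogonal to a spanning set is orthogonal to itself.
  have hker : LinearMap.ker Γ = ⊥ := by
    rw [LinearMap.ker_eq_bot']
    intro v hv
    have h1 : ∀ i ∈ t, inner ℝ i (v : Vec d) = 0 := fun i hi => congrFun hv ⟨i, hi⟩
    have h2 : (v : Vec d) ∈ Submodule.span ℝ t := by rw [htspan]; exact v.2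
    have h3 : (v : Vec d) ∈ (Submodule.span ℝ t)ᗮ := by
      rw [Submodule.mem_orthogonal]
      intro u hu
      induction hu using Submodule.span_induction with
      | mem x hx => exact h1 x hx
      | zero => simp
      | add x y _ _ hx hy => rw [inner_add_left, hx, hy, add_zero]
      | smul a x _ hx => rw [inner_smul_left, hx, mul_zero]
    have := (Submodule.mem_orthogonal _ _).1 h3 _ h2
    exact Subtype.ext (inner_self_eq_zero.1 this)
  obtain ⟨L, hL⟩ := Γ.exists_leftInverse_of_injective hker
  refine ⟨t, this, z, S.subtype.comp L, fun v => ?_⟩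
  have hproj : ∀ y ∈ S, inner ℝ y ((S.orthogonalProjectionOnto v : S) : Vec d) = inner ℝ y v := by
    intro y hy
    exact Submodule.inner_orthogonalProjectionOnto_eq_of_mem_left (⟨y, hy⟩ : S) v
  have key : L (fun i => inner ℝ (f (z i)) v) = S.orthogonalProjectionOnto v := by
    have h1 : (fun i => inner ℝ (f (z i)) v) = Γ (S.orthogonalProjectionOnto v) := by
      funext i
      change _ = inner ℝ (i : Vec d) ((S.orthogonalProjectionOnto v : S) : Vec d)
      rw [hproj _ (Submodule.subset_span (hts i.2)), hz]
    rw [h1]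
    exact LinearMap.congr_fun hL _
  constructor
  · change ‖((L fun i => inner ℝ (f (z i)) v : S) : Vec d)‖ ≤ _
    rw [key]
    exact Submodule.norm_orthogonalProjectionOnto_apply_le S v
  · intro y
    change inner ℝ (f y) ((L fun i => inner ℝ (f (z i)) v : S) : Vec d) = _
    rw [key, hproj _ (Submodule.subset_span ⟨y, rfl⟩)]

/-- Compactness gives only existence. Feeding finitely many means of `V` into the linear
reconstruction map yields a representer that is measurable in any parameter on which `V` depends
measurably. -/
theorem IsLinear.exists_measurable_representer {G : Game H X A B} {φ : Fin H → X × A × B → Vec d}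
    (hl : IsLinear G φ) (h : Fin H) : ∃ W : (X → ℝ) → Vec d,
      (∀ (R : ℝ) (V : X → ℝ), Measurable V → (∀ x, V x ∈ Set.Icc 0 R) →
        ‖W V‖ ≤ R * √(d : ℝ) ∧ ∀ z, inner ℝ (φ h z) (W V) = ∫ x, V x ∂(G.P h z)) ∧
      ∀ (Y : Type) [MeasurableSpace Y] (V : Y → X → ℝ), Measurable (Function.uncurry V) →
        Measurable fun y => W (V y) := by
  obtain ⟨ι, hι, z, L, hL⟩ := exists_reconstruction (φ h)
  refine ⟨fun V => L fun i => ∫ x, V x ∂(G.P h (z i)), fun R V hV hVR => ?_, fun Y _ V hV => ?_⟩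
  · obtain ⟨w, hw, hwz⟩ := hl.exists_representer h hV hVR
    have : (fun i => ∫ x, V x ∂(G.P h (z i))) = fun i => inner ℝ (φ h (z i)) w := by
      funext i; rw [hwz]
    beta_reduce
    rw [this]
    exact ⟨(hL w).1.trans hw, fun y => by rw [(hL w).2, hwz]⟩
  · have := G.markov h
    have hc : Continuous L := L.continuous_of_finiteDimensional
    refine hc.measurable.comp (measurable_pi_lambda _ fun i => ?_)
    exact (hV.stronglyMeasurable.integral_prod_right (ν := G.P h (z i))).measurable

theorem nextMean_mem_Icc {G : Game H X A B} {V : Fin H → X → ℝ}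
    (hVR : ∀ (h : Fin H) x, V h x ∈ Set.Icc (0 : ℝ) (H - (h : ℕ))) (h : Fin H) (z : X × A × B) :
    nextMean G.P V h z ∈ Set.Icc (0 : ℝ) (H - (h : ℕ) - 1) := by
  unfold nextMean
  split_ifs with hh
  · have := G.markov h
    have hb := hVR ⟨h + 1, hh⟩
    refine ⟨integral_nonneg fun x => (hb x).1, ?_⟩
    calc _ ≤ ∫ _, ((H : ℝ) - (h : ℕ) - 1) ∂(G.P h z) := by
          refine integral_mono_of_nonneg (.of_forall fun x => (hb x).1) (integrable_const _)
            (.of_forall fun x => (hb x).2.trans (by push_cast; linarith))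
      _ = _ := by simp
  · have : ((h : ℕ) : ℝ) + 1 ≤ H := by exact_mod_cast h.2
    exact ⟨le_rfl, by linarith⟩

/-- Parameters of the backup `r_h + P_h V`, which depend measurably on `V`. -/
theorem IsLinear.exists_backup {G : Game H X A B} {φ : Fin H → X × A × B → Vec d}
    (hl : IsLinear G φ) : ∃ W : Fin H → (Fin H → X → ℝ) → Vec d,
      (∀ (h : Fin H) V, (∀ h, Measurable (V h)) → (∀ h' : Fin H, (h : ℕ) + 1 = h' → ∀ x,
        V h' x ∈ Set.Icc (0 : ℝ) (H - (h' : ℕ))) →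
        W h V ∈ paramSet φ h ∧ ∀ z, inner ℝ (φ h z) (W h V) = G.r h z + nextMean G.P V h z) ∧
      (∀ (h : Fin H) V V', (∀ h' : Fin H, (h : ℕ) + 1 = h' → V h' = V' h') → W h V = W h V') ∧
      ∀ (Y : Type) [MeasurableSpace Y] (V : Y → Fin H → X → ℝ),
        (∀ h, Measurable fun y : Y × X => V y.1 h y.2) → ∀ h, Measurable fun y => W h (V y) := by
  choose W hW1 hW2 using fun h => hl.exists_measurable_representer h
  choose θ hθ1 hθ2 using hl.reward
  let nx : Fin H → (Fin H → X → ℝ) → X → ℝ := fun h V =>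
    if hh : (h : ℕ) + 1 < H then V ⟨h + 1, hh⟩ else fun _ => 0
  refine ⟨fun h V => θ h + W h (nx h V), fun h V hV hVR => ?_, fun h V V' hVV' => ?_,
    fun Y _ V hV h => ?_⟩
  · have hH : ((h : ℕ) : ℝ) + 1 ≤ H := by exact_mod_cast h.2
    have hm : Measurable (nx h V) := by
      unfold nx; split_ifs; exacts [hV _, measurable_const]
    have hb : ∀ x, nx h V x ∈ Set.Icc (0 : ℝ) (H - (h : ℕ) - 1) := by
      intro x
      unfold nx; split_ifs with hh
      · have := hVR ⟨h + 1, hh⟩ rfl x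
        exact ⟨this.1, this.2.trans (by push_cast; linarith)⟩
      · exact ⟨le_rfl, by linarith⟩
    obtain ⟨h1, h2⟩ := hW1 h _ _ hm hb
    have h3 : ∀ z, inner ℝ (φ h z) (θ h + W h (nx h V)) = G.r h z + nextMean G.P V h z := by
      intro z
      rw [inner_add_right, ← hθ2, h2]
      unfold nextMean nx
      split_ifs <;> simp
    refine ⟨⟨?_, fun z => ?_⟩, h3⟩
    · refine (norm_add_le _ _).trans ((add_le_add (hθ1 h) h1).trans (le_of_eq ?_))
      ring
    · have := G.markov h
      rw [inner_add_right, ← hθ2, h2]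
      have hr := G.r_mem h z
      have h4 : ∫ x, nx h V x ∂(G.P h z) ≤ H - (h : ℕ) - 1 := by
        calc _ ≤ ∫ _, ((H : ℝ) - (h : ℕ) - 1) ∂(G.P h z) :=
              integral_mono_of_nonneg (.of_forall fun x => (hb x).1) (integrable_const _)
                (.of_forall fun x => (hb x).2)
          _ = _ := by simp
      have h5 : 0 ≤ ∫ x, nx h V x ∂(G.P h z) := integral_nonneg fun x => (hb x).1
      exact ⟨by linarith [hr.1], by linarith [hr.2]⟩
  · have : nx h V = nx h V' := by
      unfold nx
      split_ifs with hh
      · exact hVV' ⟨h + 1, hh⟩ rfl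
      · rfl
    simp only [this]
  · refine (hW2 h Y (fun y => nx h (V y)) ?_).const_add _
    unfold nx Function.uncurry
    split_ifs
    · exact hV _
    · exact measurable_const

theorem IsLinear.exists_mem_paramSet {G : Game H X A B} {φ : Fin H → X × A × B → Vec d}
    (hl : IsLinear G φ) {V : Fin H → X → ℝ} (hV : ∀ h, Measurable (V h))
    (hVR : ∀ (h : Fin H) x, V h x ∈ Set.Icc (0 : ℝ) (H - (h : ℕ))) (h : Fin H) :
    ∃ w ∈ paramSet φ h, ∀ z, inner ℝ (φ h z) w = G.r h z + nextMean G.P V h z := by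
  obtain ⟨W, hW, -⟩ := hl.exists_backup
  exact ⟨W h V, hW h V hV fun h' _ => hVR h'⟩

/-- Bellman equations of the class have solutions in the class. -/
theorem IsLinear.exists_fixedPoint {G : Game H X A B} {φ : Fin H → X × A × B → Vec d}
    (hl : IsLinear G φ) {Y : Type} [MeasurableSpace Y] (v : Y → Fin H → Vec d → X → ℝ)
    (hv : ∀ h, Measurable fun w : (Y × Vec d) × X => v w.1.1 h w.1.2 w.2)
    (hvb : ∀ y (h : Fin H), ∀ ϑ ∈ paramSet φ h, ∀ x, v y h ϑ x ∈ Set.Icc (0 : ℝ) (H - (h : ℕ))) :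
    ∃ g : Y → Param H d, Measurable g ∧ ∀ y, g y ∈ classSet φ ∧
      ∀ h z, inner ℝ (φ h z) (g y h) =
        G.r h z + nextMean G.P (fun h => v y h (g y h)) h z := by
  obtain ⟨W, hW1, hW2, hW3⟩ := hl.exists_backup
  -- Backward induction in which the last `n` steps are already solved. The backup at step `k` sees
  -- only the value function of step `k + 1`, so the equation at `k` is an explicit formula and is
  -- solved by a single update.
  have main : ∀ n ≤ H, ∃ g : Y → Param H d, Measurable g ∧ ∀ y (h : Fin H), H ≤ h + n →
      g y h ∈ paramSet φ h ∧ g y h = W h (fun h => v y h (g y h)) := by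
    intro n
    induction n with
    | zero => exact fun _ => ⟨fun _ _ => 0, measurable_const, fun y h hh => by omega⟩
    | succ n ih =>
      intro hn
      obtain ⟨g, hg, hgp⟩ := ih (by omega)
      let k : Fin H := ⟨H - (n + 1), by omega⟩
      have hvm : ∀ h, Measurable fun y : Y × X => v y.1 h (g y.1 h) y.2 := fun h =>
        (hv h).comp (by fun_prop : Measurable fun y : Y × X => ((y.1, g y.1 h), y.2))
      refine ⟨fun y => Function.update (g y) k (W k (fun h => v y h (g y h))), ?_, fun y h hh => ?_⟩
      · refine measurable_pi_lambda _ fun h => ?_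
        by_cases hk : h = k
        · rw [hk]
          simpa using hW3 Y (fun y h => v y h (g y h)) hvm k
        · simpa [Function.update_of_ne hk] using! (measurable_pi_apply h).comp hg
      -- The equations at `k` and later involve only steps after `k`, so the update leaves their
      -- right-hand sides unchanged.
      · have hcongr : ∀ h : Fin H, (k : ℕ) ≤ h →
            W h (fun h => v y h (Function.update (g y) k (W k (fun h => v y h (g y h))) h)) =
            W h (fun h => v y h (g y h)) := by
          intro h hkh
          refine hW2 h _ _ fun h' hh' => ?_
          have : h' ≠ k := by rintro rfl; omega
          rw [Function.update_of_ne this]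
        have hkh : (k : ℕ) ≤ h := by simp only [k]; omega
        beta_reduce
        rw [hcongr h hkh]
        by_cases hk : h = k
        · subst hk
          rw [Function.update_self]
          refine ⟨(hW1 _ _ (fun h => (hvm h).comp measurable_prodMk_left) fun h' hh' x => ?_).1, rfl⟩
          exact hvb y h' _ (hgp y h' (by simp only [k] at hh'; omega)).1 x
        · rw [Function.update_of_ne hk]
          refine hgp y h ?_
          have : (h : ℕ) ≠ k := fun e => hk (Fin.ext e)
          simp only [k] at this hkh
          omega
  obtain ⟨g, hg, hgp⟩ := main H le_rfl
  have hmem : ∀ y h, g y h ∈ paramSet φ h := fun y h => (hgp y h (by omega)).1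
  refine ⟨g, hg, fun y => ⟨hmem y, fun h z => ?_⟩⟩
  conv_lhs => rw [(hgp y h (by omega)).2]
  refine (hW1 h _ (fun h => ?_) fun h' _ x => hvb y h' _ (hmem y h') x).2 z
  exact (hv h).comp (measurable_prodMk_left (x := (y, g y h)))

end Representation

/-! ### Geometry of the parameter sets and of the uniform prior. -/

section ParamSet

variable {H d : ℕ} {X A B : Type*} [MeasurableSpace X] [MeasurableSpace A] [MeasurableSpace B]

theorem one_le_horizon_sub (h : Fin H) : (1 : ℝ) ≤ (H : ℝ) - (h : ℕ) := by
  have : ((h : ℕ) : ℝ) + 1 ≤ H := by exact_mod_cast h.2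
  linarith

theorem horizon_sub_le (h : Fin H) : (H : ℝ) - (h : ℕ) ≤ H := by
  linarith [Nat.cast_nonneg (α := ℝ) (h : ℕ)]

variable {φ : Fin H → X × A × B → Vec d} {h : Fin H}

theorem isClosed_paramSet : IsClosed (paramSet φ h) := by
  unfold paramSet
  simp only [Set.ofPred_and, Set.ofPred_forall]
  refine (isClosed_le continuous_norm continuous_const).inter (isClosed_iInter fun z => ?_)
  exact isClosed_Icc.preimage (continuous_const.inner continuous_id)

theorem measurableSet_paramSet : MeasurableSet (paramSet φ h) := isClosed_paramSet.measurableSet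

theorem measurableSet_classSet : MeasurableSet (classSet φ) := by
  have : classSet φ = Set.univ.pi fun h => paramSet φ h := by ext; simp [classSet]
  rw [this]
  exact MeasurableSet.univ_pi fun h => measurableSet_paramSet

theorem convex_paramSet : Convex ℝ (paramSet φ h) := by
  have e : paramSet φ h = Metric.closedBall 0 (((H : ℝ) - (h : ℕ)) * √(d : ℝ)) ∩
      ⋂ z, (innerₛₗ ℝ (φ h z)) ⁻¹' Set.Icc (0 : ℝ) ((H : ℝ) - (h : ℕ)) := by
    ext θ; simp [paramSet]
  rw [e]
  exact (convex_closedBall _ _).inter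
    (convex_iInter fun z => (convex_Icc _ _).linear_preimage _)

theorem volume_paramSet_ne_top : volume (paramSet φ h) ≠ ⊤ := by
  refine ne_top_of_le_ne_top (measure_closedBall_lt_top (x := (0 : Vec d))
    (r := ((H : ℝ) - (h : ℕ)) * √(d : ℝ))).ne (measure_mono fun θ hθ => ?_)
  simpa using hθ.1

variable {G : Game H X A B}

/-- Transition kernels have total mass one, so the constant function `1` is linear in the features.
Its multiples put the constants of the admissible range into the class. -/
theorem IsLinear.exists_unit (hl : IsLinear G φ) (h : Fin H) :
    ∃ u : Vec d, ‖u‖ ≤ √(d : ℝ) ∧ ∀ z, inner ℝ (φ h z) u = 1 := by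
  obtain ⟨u, hu, hz⟩ := hl.exists_representer h (R := 1) (V := fun _ => 1) measurable_const
    (fun _ => by simp)
  refine ⟨u, by simpa using hu, fun z => ?_⟩
  have := G.markov h
  simpa using hz z

variable [Nonempty A] [Nonempty B]

theorem IsLinear.one_le_sqrt_dim (hl : IsLinear G φ) (h : Fin H) : 1 ≤ √(d : ℝ) := by
  obtain ⟨u, hu, hz⟩ := hl.exists_unit h
  let z : X × A × B := (G.x₁, Classical.arbitrary A, Classical.arbitrary B)
  calc (1 : ℝ) = inner ℝ (φ h z) u := (hz z).symm
    _ ≤ ‖φ h z‖ * ‖u‖ := real_inner_le_norm _ _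
    _ ≤ 1 * ‖u‖ := by gcongr; exact hl.norm_feature_le h z
    _ ≤ √(d : ℝ) := by rwa [one_mul]

theorem IsLinear.one_le_dim (hl : IsLinear G φ) (h : Fin H) : (1 : ℝ) ≤ d := by
  have := hl.one_le_sqrt_dim h
  rwa [Real.one_le_sqrt] at this

theorem smul_unit_mem {h : Fin H} {u : Vec d} (hu : ‖u‖ ≤ √(d : ℝ))
    (hz : ∀ z, inner ℝ (φ h z) u = 1) {c : ℝ} (hc : c ∈ Set.Icc (0 : ℝ) ((H : ℝ) - (h : ℕ))) :
    c • u ∈ paramSet φ h := by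
  refine ⟨?_, fun z => by rw [inner_smul_right, hz, mul_one]; exact hc⟩
  rw [norm_smul, Real.norm_of_nonneg hc.1]
  exact mul_le_mul hc.2 hu (norm_nonneg _) (hc.1.trans hc.2)

/-- The set contains a ball around the parameter of the constant `R / 2`: features of norm at most
one let the values move by less than `R / 2`, and `1 ≤ √d` leaves room in the norm constraint. -/
theorem IsLinear.volume_paramSet_ne_zero (hl : IsLinear G φ) (h : Fin H) :
    volume (paramSet φ h) ≠ 0 := by
  obtain ⟨u, hu, hz⟩ := hl.exists_unit h
  have hR := one_le_horizon_sub h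
  set R := (H : ℝ) - (h : ℕ)
  have hsub : Metric.ball ((R / 2) • u) (R / 2) ⊆ paramSet φ h := by
    intro v hv
    rw [mem_ball_iff_norm] at hv
    have e : v = (R / 2) • u + (v - (R / 2) • u) := by abel
    set w := v - (R / 2) • u
    refine ⟨?_, fun z => ?_⟩
    · rw [e]
      refine (norm_add_le _ _).trans ?_
      rw [norm_smul, Real.norm_of_nonneg (by linarith)]
      have h1 := hl.one_le_sqrt_dim h
      nlinarith
    · rw [e, inner_add_right, inner_smul_right, hz]
      have h2 := abs_real_inner_le_norm (φ h z) w
      have h3 : ‖φ h z‖ * ‖w‖ ≤ 1 * ‖w‖ := by gcongr; exact hl.norm_feature_le h z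
      have h4 := abs_le.1 (h2.trans h3)
      constructor <;> linarith
  exact (lt_of_lt_of_le (Metric.measure_ball_pos volume _ (by linarith))
    (measure_mono hsub)).ne'

theorem IsLinear.isProbabilityMeasure_prior (hl : IsLinear G φ) (h : Fin H) :
    IsProbabilityMeasure (prior φ h) :=
  cond_isProbabilityMeasure_of_finite (hl.volume_paramSet_ne_zero h) volume_paramSet_ne_top

theorem ae_prior_mem : ∀ᵐ w ∂(prior φ h), w ∈ paramSet φ h :=
  ae_cond_mem measurableSet_paramSet

/-- A homothety centred in a convex set maps the set into itself and scales Lebesgue measure by `δ ^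
d`. -/
theorem IsLinear.prior_ge_of_homothety (hl : IsLinear G φ) {h : Fin H} {w : Vec d}
    (hw : w ∈ paramSet φ h) {δ : ℝ} (hδ : 0 ≤ δ) (hδ1 : δ ≤ 1) {S : Set (Vec d)}
    (hS : ∀ v ∈ paramSet φ h, w + δ • (v - w) ∈ S) :
    ENNReal.ofReal (δ ^ d) ≤ prior φ h S := by
  have h1 : AffineMap.homothety w δ '' paramSet φ h ⊆ paramSet φ h ∩ S := by
    rintro _ ⟨v, hv, rfl⟩
    have e : AffineMap.homothety w δ v = w + δ • (v - w) := by
      simp [AffineMap.homothety_apply, add_comm]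
    rw [e]
    exact ⟨convex_paramSet.add_smul_sub_mem hw hv ⟨hδ, hδ1⟩, hS v hv⟩
  have h2 := measure_mono (μ := volume) h1
  rw [Measure.addHaar_image_homothety, finrank_euclideanSpace, Fintype.card_fin,
    abs_of_nonneg (by positivity)] at h2
  rw [prior, cond_apply measurableSet_paramSet]
  calc ENNReal.ofReal (δ ^ d) = (volume (paramSet φ h))⁻¹ *
        (ENNReal.ofReal (δ ^ d) * volume (paramSet φ h)) := by
        rw [mul_comm (ENNReal.ofReal _), ← mul_assoc,
          ENNReal.inv_mul_cancel (hl.volume_paramSet_ne_zero h) volume_paramSet_ne_top, one_mul]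
    _ ≤ _ := by gcongr

/-- A thin slab has prior probability at most `2/3`. -/
theorem IsLinear.prior_slab_le (hl : IsLinear G φ) (h : Fin H) (z : X × A × B) (c : ℝ) {ε : ℝ}
    (hε : ε * (16 * d) ≤ (H : ℝ) - (h : ℕ)) {S : Set (Vec d)} (hSm : MeasurableSet S)
    (hS : ∀ v ∈ S, v ∈ paramSet φ h ∧ |inner ℝ (φ h z) v - c| ≤ ε) :
    prior φ h S ≤ ENNReal.ofReal (2 / 3) := by
  obtain ⟨u, hu, hz⟩ := hl.exists_unit h
  have hR := one_le_horizon_sub h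
  have hd := hl.one_le_dim h
  set R := (H : ℝ) - (h : ℕ) with hRdef
  -- Contracting by `1 - 1 / (2d)` keeps at least half of the volume by Bernoulli's inequality, yet
  -- shifts the values at `z` by more than the width of the slab.
  obtain ⟨δ, hδ⟩ : ∃ δ : ℝ, δ = 1 / (2 * d) := ⟨_, rfl⟩
  have hδd : δ * d = 1 / 2 := by rw [hδ]; field_simp
  have hδ0 : 0 < δ := by rw [hδ]; positivity
  have hδ1 : δ ≤ 1 / 2 := by nlinarith
  have hεR : ε ≤ R / 16 := by nlinarith
  have hεδ : 2 * ε < δ * (R / 2 - ε) := by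
    have : ε ≤ δ * R / 8 := by
      have e : ε * (16 * d) * δ = 8 * ε := by linear_combination 16 * ε * hδd
      nlinarith [mul_le_mul_of_nonneg_right hε hδ0.le]
    nlinarith [mul_pos hδ0 (by linarith : 0 < R)]
  -- The centre is the constant function `R` or `0`, whichever is farther from `c`. Values in the
  -- slab then move by at least `δ (R / 2 - ε) > 2 ε`, out of the slab.
  obtain ⟨w, hw, hdisj⟩ : ∃ w ∈ paramSet φ h, ∀ v ∈ S,
      ε < |inner ℝ (φ h z) (w + (1 - δ) • (v - w)) - c| := by
    rcases le_total c (R / 2) with hc | hc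
    · refine ⟨R • u, smul_unit_mem hu hz ⟨by linarith, le_rfl⟩, fun v hv => ?_⟩
      have h1 := (abs_le.1 (hS v hv).2)
      rw [inner_add_right, inner_smul_right, inner_smul_right, inner_sub_right, inner_smul_right,
        hz]
      refine lt_of_lt_of_le ?_ (le_abs_self _)
      nlinarith
    · refine ⟨0, by simpa using smul_unit_mem hu hz (c := 0) ⟨le_rfl, by linarith⟩,
        fun v hv => ?_⟩
      have h1 := (abs_le.1 (hS v hv).2)
      rw [zero_add, sub_zero, inner_smul_right]
      refine lt_of_lt_of_le ?_ (neg_le_abs _)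
      nlinarith
  have hpow : (1 : ℝ) / 2 ≤ (1 - δ) ^ d := by
    have := one_add_mul_le_pow (a := -δ) (by linarith) d
    rw [← sub_eq_add_neg] at this
    nlinarith
  set K := paramSet φ h
  have hSK : S ⊆ K := fun v hv => (hS v hv).1
  have himg : AffineMap.homothety w (1 - δ) '' S ⊆ K \ S := by
    rintro _ ⟨v, hv, rfl⟩
    have e : AffineMap.homothety w (1 - δ) v = w + (1 - δ) • (v - w) := by
      simp [AffineMap.homothety_apply, add_comm]
    rw [e]
    refine ⟨convex_paramSet.add_smul_sub_mem hw (hSK hv) ⟨by linarith, by linarith⟩, fun hin => ?_⟩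
    exact absurd (hS _ hin).2 (not_le.2 (hdisj v hv))
  -- The slab and its disjoint contracted copy both lie in `K`, so `3 / 2` times the volume of the
  -- slab is at most that of `K`.
  have hvol : volume S + ENNReal.ofReal (1 / 2) * volume S ≤ volume K := by
    have h2 := measure_mono (μ := volume) himg
    rw [Measure.addHaar_image_homothety, finrank_euclideanSpace, Fintype.card_fin,
      abs_of_nonneg (by apply pow_nonneg; linarith)] at h2
    calc _ ≤ volume S + volume (K \ S) := by
          gcongr
          refine le_trans ?_ h2
          gcongr
      _ = volume K := by
          rw [← measure_union Set.disjoint_sdiff_right (measurableSet_paramSet.diff hSm),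
            Set.union_sdiff_cancel hSK]
  have hfin : volume S ≠ ⊤ := ne_top_of_le_ne_top volume_paramSet_ne_top (measure_mono hSK)
  rw [prior, cond_apply measurableSet_paramSet, Set.inter_eq_right.2 hSK]
  rw [← ENNReal.toReal_le_toReal (by
    exact ENNReal.mul_ne_top (ENNReal.inv_ne_top.2 (hl.volume_paramSet_ne_zero h)) hfin) (by simp)]
  rw [ENNReal.toReal_mul, ENNReal.toReal_inv, ENNReal.toReal_ofReal (by norm_num)]
  have hKpos : 0 < (volume K).toReal :=
    ENNReal.toReal_pos (hl.volume_paramSet_ne_zero h) volume_paramSet_ne_top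
  have h3 := ENNReal.toReal_mono volume_paramSet_ne_top hvol
  rw [ENNReal.toReal_add hfin (ENNReal.mul_ne_top (by simp) hfin), ENNReal.toReal_mul,
    ENNReal.toReal_ofReal (by norm_num)] at h3
  rw [inv_mul_le_iff₀ hKpos]
  linarith

end ParamSet

/-! ### Range and measurability of the two families of value functions. -/

section ValueFunctions

variable {H d : ℕ} {X A B : Type*} [MeasurableSpace X] [MeasurableSpace A] [MeasurableSpace B]
  [Fintype A] [Fintype B]

theorem measurable_qmat {φ : Fin H → X × A × B → Vec d} (hφ : ∀ h, Measurable (φ h)) (h : Fin H)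
    (a : A) (b : B) : Measurable fun y : Vec d × X => qmat φ h y.1 y.2 a b := by
  have := hφ h
  unfold qmat
  fun_prop

theorem measurable_mainVal [Nonempty A] [Nonempty B] {φ : Fin H → X × A × B → Vec d}
    (hφ : ∀ h, Measurable (φ h)) (h : Fin H) :
    Measurable fun y : Param H d × X => mainVal φ y.1 h y.2 :=
  measurable_gameValue (M := fun y : Param H d × X => qmat φ h (y.1 h) y.2) fun a b =>
    (measurable_qmat hφ h a b).comp (by fun_prop : Measurable fun y : Param H d × X => (y.1 h, y.2))

theorem mainVal_mem_Icc [Nonempty A] [Nonempty B] {φ : Fin H → X × A × B → Vec d} {θ : Param H d}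
    {h : Fin H} (hθ : θ h ∈ paramSet φ h) (x : X) :
    mainVal φ θ h x ∈ Set.Icc (0 : ℝ) (H - (h : ℕ)) :=
  gameValue_mem_Icc fun _ _ => hθ.2 _

variable [DiscreteMeasurableSpace A]

theorem measurable_boostVal [Nonempty B] {φ : Fin H → X × A × B → Vec d}
    (hφ : ∀ h, Measurable (φ h)) (πA : Fin H → Kernel (Vec d × X) A) (h : Fin H) :
    Measurable fun y : (Param H d × Param H d) × X => boostVal φ πA y.1.1 y.1.2 h y.2 :=
  measurable_respValue (p := fun y : (Param H d × Param H d) × X => weights (πA h (y.1.1 h, y.2)))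
    (M := fun y : (Param H d × Param H d) × X => qmat φ h (y.1.2 h) y.2)
    (fun a => (measurable_weights (πA h) a).comp
      (by fun_prop : Measurable fun y : (Param H d × Param H d) × X => (y.1.1 h, y.2)))
    fun a b => (measurable_qmat hφ h a b).comp
      (by fun_prop : Measurable fun y : (Param H d × Param H d) × X => (y.1.2 h, y.2))

theorem measurable_boostVal_right [Nonempty B] {φ : Fin H → X × A × B → Vec d}
    (hφ : ∀ h, Measurable (φ h)) (πA : Fin H → Kernel (Vec d × X) A) (θ ϑ : Param H d)
    (h : Fin H) : Measurable (boostVal φ πA θ ϑ h) := by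
  have h1 : Measurable fun x : X => (θ h, x) := measurable_prodMk_left
  have h2 : Measurable fun x : X => (ϑ h, x) := measurable_prodMk_left
  exact measurable_respValue (p := fun x : X => weights (πA h (θ h, x)))
    (M := fun x : X => qmat φ h (ϑ h) x) (fun a => (measurable_weights (πA h) a).comp h1)
    fun a b => (measurable_qmat hφ h a b).comp h2

theorem boostVal_mem_Icc [Nonempty B] {φ : Fin H → X × A × B → Vec d}
    {πA : Fin H → Kernel (Vec d × X) A} (hA : ∀ h, IsMarkovKernel (πA h)) (θ : Param H d)
    {ϑ : Param H d} {h : Fin H} (hϑ : ϑ h ∈ paramSet φ h) (x : X) :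
    boostVal φ πA θ ϑ h x ∈ Set.Icc (0 : ℝ) (H - (h : ℕ)) := by
  have := hA h
  exact respValue_mem_Icc (weights_mem_stdSimplex _) fun _ _ => hϑ.2 _

/-- The chosen policy attains the maximum. Thus the main agent's values are booster values with `g =
f`, and `κ`, which is stated for booster backups, covers both agents. -/
theorem IsMainRule.mainVal_eq [Nonempty A] [Nonempty B] {φ : Fin H → X × A × B → Vec d}
    {πA : Fin H → Kernel (Vec d × X) A} (hA : IsMainRule φ πA) {θ : Param H d} {h : Fin H}
    (hθ : θ h ∈ paramSet φ h) (x : X) : mainVal φ θ h x = boostVal φ πA θ θ h x := by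
  have := hA.markov h
  exact le_antisymm (gameValue_le_of_forall fun p hp => hA.argmax h _ hθ x p hp)
    (respValue_le_gameValue (weights_mem_stdSimplex _) _)

end ValueFunctions

/-! ### Upper and lower bounds for the complexity measure. -/

section Kappa

variable {H d : ℕ} {X A B : Type*} [MeasurableSpace X] [MeasurableSpace A] [MeasurableSpace B]
  [Fintype A] [Fintype B] [Nonempty A] [Nonempty B] [DiscreteMeasurableSpace A]
  {G : Game H X A B} {φ : Fin H → X × A × B → Vec d} {πA : Fin H → Kernel (Vec d × X) A}

theorem bellman_eq (θ ϑ : Param H d) (h : Fin H) (z : X × A × B) :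
    bellman G φ πA θ ϑ h z = G.r h z + nextMean G.P (boostVal φ πA θ ϑ) h z := rfl

theorem measurableSet_smallResidual (ε : ℝ) (θ ϑ : Param H d) (h : Fin H) :
    MeasurableSet (smallResidual G φ πA ε θ ϑ h) := by
  refine IsClosed.measurableSet ?_
  unfold smallResidual
  simp only [Set.ofPred_and, Set.ofPred_forall]
  refine isClosed_paramSet.inter (isClosed_iInter fun z => ?_)
  exact isClosed_le (((continuous_const.inner continuous_id).sub continuous_const).abs)
    continuous_const

/-- The backup has a parameter `w` in the class, and any two members differ by at most `H - h`
pointwise. Contracting the class towards `w` by `ε / (H - h)` therefore leaves residuals of at most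
`ε`. -/
theorem IsLinear.prior_smallResidual_ge (hl : IsLinear G φ) (hA : ∀ h, IsMarkovKernel (πA h))
    {ε : ℝ} (hε : 0 ≤ ε) (θ : Param H d) {ϑ : Param H d} (hϑ : ϑ ∈ classSet φ) (h : Fin H) :
    ENNReal.ofReal ((min 1 (ε / ((H : ℝ) - (h : ℕ)))) ^ d) ≤
      prior φ h (smallResidual G φ πA ε θ ϑ h) := by
  have hR := one_le_horizon_sub h
  obtain ⟨w, hw, hwz⟩ := hl.exists_mem_paramSet
    (measurable_boostVal_right hl.measurable_feature πA θ ϑ)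
    (fun h x => boostVal_mem_Icc hA θ (hϑ h) x) h
  have h0 : 0 ≤ min 1 (ε / ((H : ℝ) - (h : ℕ))) :=
    le_min zero_le_one (div_nonneg hε (by linarith))
  have h1 : min 1 (ε / ((H : ℝ) - (h : ℕ))) * ((H : ℝ) - (h : ℕ)) ≤ ε :=
    (mul_le_mul_of_nonneg_right (min_le_right _ _) (by linarith)).trans
      (div_mul_cancel₀ _ (by linarith)).le
  have h2 := min_le_left 1 (ε / ((H : ℝ) - (h : ℕ)))
  generalize min 1 (ε / ((H : ℝ) - (h : ℕ))) = δ at *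
  refine hl.prior_ge_of_homothety hw h0 h2 fun v hv => ?_
  have hmem := convex_paramSet.add_smul_sub_mem hw hv ⟨h0, h2⟩
  refine ⟨hmem, fun z => ?_⟩
  rw [bellman_eq, ← hwz, inner_add_right, inner_smul_right, inner_sub_right, add_sub_cancel_left,
    abs_mul, abs_of_nonneg h0]
  have h4 := hv.2 z
  have h5 := hw.2 z
  have h3 : |inner ℝ (φ h z) v - inner ℝ (φ h z) w| ≤ (H : ℝ) - (h : ℕ) :=
    abs_le.2 ⟨by linarith [h4.1, h5.2], by linarith [h4.2, h5.1]⟩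
  exact (mul_le_mul_of_nonneg_left h3 h0).trans h1

theorem sum_coe_ereal {ι : Type*} (s : Finset ι) (f : ι → ℝ) :
    ∑ i ∈ s, (f i : EReal) = ((∑ i ∈ s, f i : ℝ) : EReal) := by
  classical
  induction s using Finset.induction_on with
  | empty => simp
  | insert a s ha ih => rw [Finset.sum_insert ha, Finset.sum_insert ha, ih, EReal.coe_add]

/-- Each step costs `d` times the logarithm of `(H - h) / ε`, which is at most `1 / ε²` because `H ≤
1 / ε`; hence the factor `2`. -/
theorem IsLinear.kappa_le (hl : IsLinear G φ) (hA : ∀ h, IsMarkovKernel (πA h)) {ε : ℝ}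
    (hε : 0 < ε) (hε1 : ε ≤ 1 / (H : ℝ)) :
    kappa G φ πA ε ≤ ((2 * ((H : ℝ) * (d : ℝ) * Real.log (1 / ε)) : ℝ) : EReal) := by
  refine iSup₂_le fun θ _ => iSup₂_le fun ϑ hϑ => ?_
  have hterm : ∀ h : Fin H, ENNReal.log ((prior φ h (smallResidual G φ πA ε θ ϑ h))⁻¹) ≤
      ((2 * ((d : ℝ) * Real.log (1 / ε)) : ℝ) : EReal) := by
    intro h
    have hR := one_le_horizon_sub h
    have hR' := horizon_sub_le h
    have hH : (1 : ℝ) ≤ H := hR.trans hR'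
    set δ := min 1 (ε / ((H : ℝ) - (h : ℕ))) with hδ
    have hδ0 : 0 < δ := lt_min zero_lt_one (div_pos hε (by linarith))
    have hlogε : 0 ≤ Real.log (1 / ε) := Real.log_nonneg (by
      rw [le_div_iff₀ hε, one_mul]; exact hε1.trans ((div_le_one (by linarith)).2 hH))
    have h1 : (prior φ h (smallResidual G φ πA ε θ ϑ h))⁻¹ ≤ ENNReal.ofReal ((δ ^ d)⁻¹) := by
      rw [ENNReal.ofReal_inv_of_pos (by positivity), ENNReal.inv_le_inv]
      exact hl.prior_smallResidual_ge hA hε.le θ hϑ h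
    refine (ENNReal.log_le_log h1).trans ?_
    rw [ENNReal.log_ofReal_of_pos (by positivity), EReal.coe_le_coe_iff, Real.log_inv,
      Real.log_pow, ← mul_neg, ← Real.log_inv, mul_left_comm]
    gcongr
    rcases min_choice 1 (ε / ((H : ℝ) - (h : ℕ))) with hm | hm
    · rw [hδ, hm, inv_one, Real.log_one]; linarith
    · rw [hδ, hm, inv_div]
      have h2 : ((H : ℝ) - (h : ℕ)) / ε ≤ (1 / ε) ^ 2 := by
        rw [div_pow, one_pow, div_le_div_iff₀ hε (by positivity)]
        have h3 : ε * H ≤ 1 := by rwa [le_div_iff₀ (by linarith)] at hε1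
        nlinarith [mul_le_mul_of_nonneg_left h3 hε.le, mul_pos hε hε]
      calc _ ≤ Real.log ((1 / ε) ^ 2) := Real.log_le_log (by positivity) h2
        _ = _ := by rw [Real.log_pow]; norm_num
  refine (Finset.sum_le_sum fun h _ => hterm h).trans ?_
  rw [sum_coe_ereal, EReal.coe_le_coe_iff]
  simp
  apply le_of_eq
  ring

theorem log_inv_prior_nonneg {ε : ℝ} (θ ϑ : Param H d) (h : Fin H) :
    0 ≤ ENNReal.log ((prior φ h (smallResidual G φ πA ε θ ϑ h))⁻¹) := by
  have : IsZeroOrProbabilityMeasure (prior φ h) := by unfold prior; infer_instance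
  rw [ENNReal.zero_le_log_iff, ENNReal.one_le_inv]
  exact prob_le_one

/-- Already at one point of the state-action space, a small residual confines the parameter to a
thin slab, which has prior mass at most `2 / 3`. The other steps contribute nonnegative terms, so
the first one suffices. -/
theorem IsLinear.le_kappa (hl : IsLinear G φ) [NeZero H] {ε : ℝ} (hε : ε * (16 * d) ≤ H) :
    ((2 / 5 : ℝ) : EReal) ≤ kappa G φ πA ε := by
  choose u hu hz using fun h => hl.exists_unit h
  have hcl : (fun h => (0 : ℝ) • u h) ∈ classSet φ := fun h =>
    smul_unit_mem (hu h) (hz h) ⟨le_rfl, by linarith [one_le_horizon_sub h]⟩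
  set θ : Param H d := fun h => (0 : ℝ) • u h
  refine le_trans ?_ (le_iSup₂_of_le θ hcl (le_iSup₂_of_le θ hcl le_rfl))
  refine le_trans ?_ (Finset.single_le_sum (f := fun h =>
    ENNReal.log ((prior φ h (smallResidual G φ πA ε θ θ h))⁻¹))
    (fun h _ => log_inv_prior_nonneg θ θ h) (Finset.mem_univ 0))
  let z : X × A × B := (G.x₁, Classical.arbitrary A, Classical.arbitrary B)
  have h1 := hl.prior_slab_le 0 z (bellman G φ πA θ θ 0 z) (ε := ε) (by simpa using hε)
    (measurableSet_smallResidual (G := G) (πA := πA) ε θ θ 0) fun v hv => ⟨hv.1, hv.2 z⟩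
  have h2 : ENNReal.ofReal (3 / 2) ≤ (prior φ 0 (smallResidual G φ πA ε θ θ 0))⁻¹ := by
    rw [show (3 / 2 : ℝ) = (2 / 3)⁻¹ by norm_num, ENNReal.ofReal_inv_of_pos (by norm_num),
      ENNReal.inv_le_inv]
    exact h1
  refine le_trans ?_ (ENNReal.log_le_log h2)
  rw [ENNReal.log_ofReal_of_pos (by norm_num), EReal.coe_le_coe_iff]
  rw [Real.le_log_iff_exp_le (by norm_num)]
  -- `2 / 5 ≤ log (3 / 2)` amounts to `e² ≤ (3 / 2)⁵`.
  have h3 : Real.exp (2 / 5) ^ 5 ≤ (3 / 2 : ℝ) ^ 5 := by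
    rw [← Real.exp_nat_mul]
    norm_num
    have h4 : Real.exp 2 = Real.exp 1 ^ 2 := by rw [← Real.exp_nat_mul]; norm_num
    rw [h4]
    have := Real.exp_one_lt_d9
    have := Real.exp_pos 1
    nlinarith
  exact le_of_pow_le_pow_left₀ (by norm_num) (by norm_num) h3

/-- The prior probabilities of the sets of small residuals, in terms of a bound on `κ`. -/
theorem IsLinear.exp_neg_kappa_le (hl : IsLinear G φ) (hA : ∀ h, IsMarkovKernel (πA h)) {ε : ℝ}
    (hε : 0 < ε) {K : ℝ} (hK : kappa G φ πA ε ≤ K) {θ ϑ : Param H d}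
    (hθ : θ ∈ classSet φ) (hϑ : ϑ ∈ classSet φ) :
    Real.exp (-K) ≤ ∏ h, (prior φ h).real (smallResidual G φ πA ε θ ϑ h) ∧
      ∀ h, 0 < (prior φ h).real (smallResidual G φ πA ε θ ϑ h) := by
  have hpos : ∀ h, 0 < (prior φ h).real (smallResidual G φ πA ε θ ϑ h) := by
    intro h
    have := hl.isProbabilityMeasure_prior h
    have hR := one_le_horizon_sub h
    refine ENNReal.toReal_pos (lt_of_lt_of_le ?_
      (hl.prior_smallResidual_ge hA hε.le θ hϑ h)).ne' (measure_ne_top _ _)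
    rw [ENNReal.ofReal_pos]
    exact pow_pos (lt_min zero_lt_one (div_pos hε (by linarith))) _
  refine ⟨?_, hpos⟩
  have h1 : ∑ h, ENNReal.log ((prior φ h (smallResidual G φ πA ε θ ϑ h))⁻¹) ≤ (K : EReal) :=
    (le_iSup₂ (f := fun ϑ (_ : ϑ ∈ classSet φ) =>
      ∑ h, ENNReal.log ((prior φ h (smallResidual G φ πA ε θ ϑ h))⁻¹)) ϑ hϑ).trans
      ((le_iSup₂ (f := fun θ (_ : θ ∈ classSet φ) => ⨆ ϑ ∈ classSet φ,
        ∑ h, ENNReal.log ((prior φ h (smallResidual G φ πA ε θ ϑ h))⁻¹)) θ hθ).trans hK)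
  have h2 : ∀ h, ENNReal.log ((prior φ h (smallResidual G φ πA ε θ ϑ h))⁻¹) =
      ((-Real.log ((prior φ h).real (smallResidual G φ πA ε θ ϑ h)) : ℝ) : EReal) := by
    intro h
    have := hl.isProbabilityMeasure_prior h
    rw [← ENNReal.ofReal_toReal (measure_ne_top (prior φ h) (smallResidual G φ πA ε θ ϑ h)),
      ← measureReal_def, ← ENNReal.ofReal_inv_of_pos (hpos h),
      ENNReal.log_ofReal_of_pos (inv_pos.2 (hpos h)),
      Real.log_inv]
  simp only [h2] at h1
  rw [sum_coe_ereal, EReal.coe_le_coe_iff, Finset.sum_neg_distrib, neg_le] at h1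
  rw [← Real.log_prod fun h _ => (hpos h).ne'] at h1
  rwa [Real.le_log_iff_exp_le (Finset.prod_pos fun h _ => hpos h)] at h1

end Kappa

/-! ### Best responses, and bounds on values of policies by Bellman inequalities. -/

section Policies

variable {H d : ℕ} {X A B : Type*} [MeasurableSpace X] [MeasurableSpace A] [MeasurableSpace B]
  [Fintype A] [Fintype B] [Nonempty A] [Nonempty B] [DiscreteMeasurableSpace A]
  [DiscreteMeasurableSpace B]

/-- Add the actions one at a time, switching to the new one on the measurable set where it is no
worse than the current choice. -/
theorem exists_measurable_argmin {F : X → B → ℝ} (hF : ∀ b, Measurable fun x => F x b) :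
    ∃ β : X → B, Measurable β ∧ ∀ x c, F x (β x) ≤ F x c := by
  classical
  have main : ∀ s : Finset B, s.Nonempty → ∃ β : X → B, Measurable β ∧
      Measurable (fun x => F x (β x)) ∧ ∀ x, ∀ c ∈ s, F x (β x) ≤ F x c := by
    intro s hs
    induction hs using Finset.Nonempty.cons_induction with
    | singleton a => exact ⟨fun _ => a, measurable_const, hF a, by simp⟩
    | cons a s ha hs ih =>
      obtain ⟨β, hβ, hFβ, hle⟩ := ih
      have hset : MeasurableSet {x | F x a ≤ F x (β x)} := measurableSet_le (hF a) hFβ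
      refine ⟨fun x => if F x a ≤ F x (β x) then a else β x,
        Measurable.ite hset measurable_const hβ, ?_, fun x c hc => ?_⟩
      · have : (fun x => F x (if F x a ≤ F x (β x) then a else β x)) =
            fun x => if F x a ≤ F x (β x) then F x a else F x (β x) := by
          funext x; split_ifs <;> rfl
        rw [this]
        exact Measurable.ite hset (hF a) hFβ
      · rw [Finset.mem_cons] at hc
        beta_reduce
        rcases hc with rfl | hc
        · split_ifs with h
          · exact le_rfl
          · exact (not_le.1 h).le
        · split_ifs with h
          · exact h.trans (hle x c hc)
          · exact hle x c hc
  obtain ⟨β, hβ, -, hle⟩ := main Finset.univ Finset.univ_nonempty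
  exact ⟨β, hβ, fun x c => hle x c (Finset.mem_univ c)⟩

theorem weights_dirac [DecidableEq B] (b : B) : weights (Measure.dirac b) = Pi.single b 1 := by
  funext c
  simp only [weights, measureReal_def, Measure.dirac_apply, Pi.single_apply]
  by_cases h : c = b
  · simp [h]
  · simp [h, Ne.symm h]

/-- A best response of the second player to `μ` in the games with payoff matrices `M h x`. -/
theorem exists_bestResponse (μ : Fin H → Kernel X A) {M : Fin H → X → A → B → ℝ}
    (hM : ∀ h a b, Measurable fun x => M h x a b) : ∃ ν : Policy H X B,
      ∀ h x, payoff (weights (μ h x)) (M h x) (weights (ν.1 h x)) =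
        respValue (weights (μ h x)) (M h x) := by
  classical
  choose β hβ hmin using fun h => exists_measurable_argmin
    (F := fun x b => ∑ a, weights (μ h x) a * M h x a b) fun b =>
      Finset.measurable_sum _ fun a _ => (measurable_weights (μ h) a).mul (hM h a b)
  refine ⟨⟨fun h => Kernel.deterministic (β h) (hβ h), fun h => inferInstance⟩, fun h x => ?_⟩
  rw [Kernel.deterministic_apply, weights_dirac, payoff_single, respValue_eq_inf']
  exact le_antisymm (Finset.le_inf' _ _ fun c _ => hmin h x c)
    (Finset.inf'_le (fun b => ∑ a, weights (μ h x) a * M h x a b) (Finset.mem_univ (β h x)))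

instance instNonemptyPolicy : Nonempty (Policy H X B) :=
  ⟨⟨fun _ => Kernel.const X (Measure.dirac (Classical.arbitrary B)), fun _ => inferInstance⟩⟩

theorem startVal_eq [NeZero H] (V : Fin H → X → ℝ) (x : X) : startVal V x = V 0 x := by
  unfold startVal
  rw [dif_pos (NeZero.pos H)]
  rfl

theorem nextMean_neg (P : Fin H → Kernel (X × A × B) X) (V : Fin H → X → ℝ) (h : Fin H)
    (z : X × A × B) : nextMean P (fun h x => -V h x) h z = -nextMean P V h z := by
  unfold nextMean
  split_ifs
  · exact integral_neg _
  · simp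

variable {G : Game H X A B}

theorem return_mem_Icc (G : Game H X A B) (ζ : Traj H X A B) :
    ∑ h, G.r h (ζ h) ∈ Set.Icc (0 : ℝ) H :=
  ⟨Finset.sum_nonneg fun h _ => (G.r_mem h _).1,
    (Finset.sum_le_sum fun h _ => (G.r_mem h _).2).trans (by simp)⟩

theorem value_mem_Icc (G : Game H X A B) {μ : Fin H → Kernel X A} (hμ : ∀ h, IsMarkovKernel (μ h))
    {ν : Fin H → Kernel X B} (hν : ∀ h, IsMarkovKernel (ν h)) :
    value G μ ν ∈ Set.Icc (0 : ℝ) H := by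
  have := isMarkovKernel_rollout (U := Unit) H G.P (fun h => (μ h).comap Prod.snd measurable_snd)
    (fun h => (ν h).comap Prod.snd measurable_snd) G.markov (fun h => inferInstance)
    (fun h => inferInstance)
  refine ⟨integral_nonneg fun ζ => (return_mem_Icc G ζ).1, ?_⟩
  unfold value
  refine (integral_mono_of_nonneg (.of_forall fun ζ => (return_mem_Icc G ζ).1)
    (integrable_const (H : ℝ)) (.of_forall fun ζ => (return_mem_Icc G ζ).2)).trans ?_
  simp

theorem bddBelow_value (G : Game H X A B) {μ : Fin H → Kernel X A}
    (hμ : ∀ h, IsMarkovKernel (μ h)) :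
    BddBelow (Set.range fun ν : Policy H X B => value G μ ν.1) := by
  refine ⟨0, ?_⟩
  rintro _ ⟨ν, rfl⟩
  exact (value_mem_Icc G hμ ν.2).1

theorem bestRespValue_le (G : Game H X A B) {μ : Fin H → Kernel X A}
    (hμ : ∀ h, IsMarkovKernel (μ h)) (ν : Policy H X B) : bestRespValue G μ ≤ value G μ ν.1 :=
  ciInf_le (bddBelow_value G hμ) ν

theorem bestRespValue_mem_Icc (G : Game H X A B) {μ : Fin H → Kernel X A}
    (hμ : ∀ h, IsMarkovKernel (μ h)) : bestRespValue G μ ∈ Set.Icc (0 : ℝ) H :=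
  let ν₀ : Policy H X B := Classical.arbitrary _
  ⟨le_ciInf fun ν => (value_mem_Icc G hμ ν.2).1,
    (bestRespValue_le G hμ ν₀).trans (value_mem_Icc G hμ ν₀.2).2⟩

theorem nashValue_mem_Icc (G : Game H X A B) : nashValue G ∈ Set.Icc (0 : ℝ) H := by
  have hb : ∀ μ : Policy H X A, bestRespValue G μ.1 ∈ Set.Icc (0 : ℝ) H := fun μ =>
    bestRespValue_mem_Icc G μ.2
  refine ⟨?_, ciSup_le fun μ => (hb μ).2⟩
  refine (hb (Classical.arbitrary _)).1.trans (le_ciSup (f := fun μ : Policy H X A =>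
    bestRespValue G μ.1) ⟨H, ?_⟩ (Classical.arbitrary _))
  rintro _ ⟨μ, rfl⟩
  exact (hb μ).2

variable [NeZero H] {μ : Fin H → Kernel X A} {ν : Fin H → Kernel X B} {V : Fin H → X → ℝ}

theorem le_value (hμ : ∀ h, IsMarkovKernel (μ h)) (hν : ∀ h, IsMarkovKernel (ν h))
    (hV : ∀ h, Measurable (V h)) {K : ℝ} (hK : ∀ h x, |V h x| ≤ K)
    (hle : ∀ h x, V h x ≤ payoff (weights (μ h x))
      (fun a b => G.r h (x, a, b) + nextMean G.P V h (x, a, b)) (weights (ν h x))) :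
    V 0 G.x₁ ≤ value G μ ν := by
  rw [← startVal_eq V]
  exact startVal_le_integral_rollout () 1 K H G.P (fun h => (μ h).comap Prod.snd measurable_snd)
    (fun h => (ν h).comap Prod.snd measurable_snd) G.markov (fun h => inferInstance)
    (fun h => inferInstance) G.r V G.measurable_r
    (fun h z => abs_le.2 ⟨by linarith [(G.r_mem h z).1], (G.r_mem h z).2⟩) hV hK hle G.x₁

/-- The lower comparison, applied to negated rewards and negated value functions. -/
theorem value_le (hμ : ∀ h, IsMarkovKernel (μ h)) (hν : ∀ h, IsMarkovKernel (ν h))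
    (hV : ∀ h, Measurable (V h)) {K : ℝ} (hK : ∀ h x, |V h x| ≤ K)
    (hle : ∀ h x, payoff (weights (μ h x))
      (fun a b => G.r h (x, a, b) + nextMean G.P V h (x, a, b)) (weights (ν h x)) ≤ V h x) :
    value G μ ν ≤ V 0 G.x₁ := by
  have key := startVal_le_integral_rollout () 1 K H G.P
    (fun h => (μ h).comap Prod.snd measurable_snd)
    (fun h => (ν h).comap Prod.snd measurable_snd) G.markov (fun h => inferInstance)
    (fun h => inferInstance) (fun h z => -G.r h z) (fun h x => -V h x)
    (fun h => (G.measurable_r h).neg)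
    (fun h z => by
      rw [abs_neg]; exact abs_le.2 ⟨by linarith [(G.r_mem h z).1], (G.r_mem h z).2⟩)
    (fun h => (hV h).neg) (fun h x => by rw [abs_neg]; exact hK h x)
    (fun h x => by
      simp only [nextMean_neg, ← neg_add]
      rw [payoff_neg]
      exact neg_le_neg (hle h x)) G.x₁
  rw [startVal_eq] at key
  simp only [Finset.sum_neg_distrib, integral_neg] at key
  exact neg_le_neg_iff.1 key

end Policies

/-! ### The Nash and best-response values through solutions of Bellman equations. -/

section Comparison

variable {H d : ℕ} {X A B : Type*} [MeasurableSpace X] [MeasurableSpace A] [MeasurableSpace B]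
  [Fintype A] [Fintype B] [Nonempty A] [Nonempty B] [DiscreteMeasurableSpace A]
  [DiscreteMeasurableSpace B] [NeZero H] {G : Game H X A B} {φ : Fin H → X × A × B → Vec d}
  {πA : Fin H → Kernel (Vec d × X) A} {πB : Fin H → Kernel ((Vec d × Vec d) × X) B}

/-- The functions `f^h = φ_h^⊤ θ^h`. -/
noncomputable def linFun (φ : Fin H → X × A × B → Vec d) (θ : Param H d) (h : Fin H)
    (z : X × A × B) : ℝ :=
  inner ℝ (φ h z) (θ h)

theorem measurable_mainVal_right (hφ : ∀ h, Measurable (φ h)) (θ : Param H d) (h : Fin H) :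
    Measurable (mainVal φ θ h) := by
  have h2 : Measurable fun x : X => (θ h, x) := measurable_prodMk_left
  exact measurable_gameValue (M := fun x : X => qmat φ h (θ h) x)
    fun a b => (measurable_qmat hφ h a b).comp h2

theorem abs_le_horizon {V : Fin H → X → ℝ}
    (hV : ∀ (h : Fin H) x, V h x ∈ Set.Icc (0 : ℝ) (H - (h : ℕ))) (h : Fin H) (x : X) :
    |V h x| ≤ H :=
  abs_le.2 ⟨by linarith [(hV h x).1, Nat.cast_nonneg (α := ℝ) H],
    (hV h x).2.trans (horizon_sub_le h)⟩

/-- Against any `μ`, let the second player best-respond in the matrix games of `θ`. In every state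
this payoff is at most the game value, so `V_θ` dominates the resulting value. The converse
inequality is not needed to bound regret from above. -/
theorem nashValue_le (hφ : ∀ h, Measurable (φ h)) {θ : Param H d} (hθ : θ ∈ classSet φ)
    (hfix : ∀ h z, linFun φ θ h z = G.r h z + nextMean G.P (mainVal φ θ) h z) :
    nashValue G ≤ mainVal φ θ 0 G.x₁ := by
  refine ciSup_le fun μ => ?_
  obtain ⟨ν, hν⟩ := exists_bestResponse (B := B) μ.1 (M := fun h x => qmat φ h (θ h) x)
    fun h a b => (measurable_qmat hφ h a b).comp measurable_prodMk_left
  refine (bestRespValue_le G μ.2 ν).trans ?_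
  refine value_le μ.2 ν.2 (measurable_mainVal_right hφ θ)
    (abs_le_horizon fun h x => mainVal_mem_Icc (hθ h) x) fun h x => ?_
  have := μ.2 h
  have e : (fun a b => G.r h (x, a, b) + nextMean G.P (mainVal φ θ) h (x, a, b)) =
      qmat φ h (θ h) x := by
    funext a b; exact (hfix h (x, a, b)).symm
  rw [e, hν]
  exact respValue_le_gameValue (weights_mem_stdSimplex _) _

/-- With `μ_θ` fixed this is dynamic programming for the second player: no `ν` gets below the
solution, and the pointwise best response attains it. -/
theorem bestRespValue_eq (hφ : ∀ h, Measurable (φ h)) (hA : ∀ h, IsMarkovKernel (πA h))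
    (θ : Param H d) {ϑ : Param H d} (hϑ : ϑ ∈ classSet φ)
    (hfix : ∀ h z, linFun φ ϑ h z = G.r h z + nextMean G.P (boostVal φ πA θ ϑ) h z) :
    bestRespValue G (fun h => (πA h).comap (fun x => (θ h, x)) (by fun_prop)) =
      boostVal φ πA θ ϑ 0 G.x₁ := by
  have hM : ∀ h, IsMarkovKernel ((πA h).comap (fun x => (θ h, x)) (by fun_prop)) :=
    fun h => inferInstance
  have e : ∀ h x, (fun a b => G.r h (x, a, b) + nextMean G.P (boostVal φ πA θ ϑ) h (x, a, b)) =
      qmat φ h (ϑ h) x := by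
    intro h x; funext a b; exact (hfix h (x, a, b)).symm
  have hb := abs_le_horizon fun h x => boostVal_mem_Icc hA θ (hϑ h) x
  refine le_antisymm ?_ (le_ciInf fun ν => ?_)
  · obtain ⟨ν, hν⟩ := exists_bestResponse (B := B)
      (fun h => (πA h).comap (fun x => (θ h, x)) (by fun_prop))
      (M := fun h x => qmat φ h (ϑ h) x)
      fun h a b => (measurable_qmat hφ h a b).comp measurable_prodMk_left
    refine (bestRespValue_le G hM ν).trans ?_
    refine value_le hM ν.2 (measurable_boostVal_right hφ πA θ ϑ) hb fun h x => ?_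
    rw [e, hν]
    exact le_rfl
  · refine le_value hM ν.2 (measurable_boostVal_right hφ πA θ ϑ) hb fun h x => ?_
    have := ν.2 h
    rw [e]
    exact respValue_le_payoff _ _ (weights_mem_stdSimplex _)

theorem measurable_linFun_right (hφ : ∀ h, Measurable (φ h)) (θ : Param H d) (h : Fin H) :
    Measurable (linFun φ θ h) := by
  have := hφ h
  unfold linFun
  fun_prop

theorem measurable_nextMean_right (G : Game H X A B) {V : Fin H → X → ℝ}
    (hV : ∀ h, Measurable (V h)) (h : Fin H) : Measurable (nextMean G.P V h) := by
  have h1 : Measurable fun y : Unit × (X × A × B) => nextMean G.P V h y.2 :=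
    measurable_nextMean (Y := Unit) G.markov (V := fun _ => V)
      (fun h => (hV h).comp measurable_snd) h
  have h2 : Measurable fun z : X × A × B => ((), z) := measurable_prodMk_left
  exact h1.comp h2

theorem linFun_mem_Icc {θ : Param H d} {h : Fin H} (hθ : θ h ∈ paramSet φ h) (z : X × A × B) :
    linFun φ θ h z ∈ Set.Icc (0 : ℝ) ((H : ℝ) - (h : ℕ)) := hθ.2 z

theorem abs_linFun_sub_nextMean_le {θ : Param H d} {h : Fin H} (hθ : θ h ∈ paramSet φ h)
    {V : Fin H → X → ℝ} (hVR : ∀ (h : Fin H) x, V h x ∈ Set.Icc (0 : ℝ) (H - (h : ℕ)))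
    (z : X × A × B) :
    |linFun φ θ h z - nextMean G.P V h z| ≤ H := by
  have h1 := linFun_mem_Icc hθ z
  have h2 := nextMean_mem_Icc (G := G) hVR h z
  have h3 := horizon_sub_le h
  exact abs_le.2 ⟨by linarith [h1.1, h2.2], by linarith [h1.2, h2.1]⟩

theorem abs_resid_le {θ : Param H d} {h : Fin H} (hθ : θ h ∈ paramSet φ h)
    {V : Fin H → X → ℝ} (hVR : ∀ (h : Fin H) x, V h x ∈ Set.Icc (0 : ℝ) (H - (h : ℕ)))
    (z : X × A × B) :
    |resid G (linFun φ θ) V h z| ≤ H := by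
  have h1 := linFun_mem_Icc hθ z
  have h2 := nextMean_mem_Icc (G := G) hVR h z
  have h3 := horizon_sub_le h
  have h4 := G.r_mem h z
  unfold resid
  exact abs_le.2 ⟨by linarith [h1.1, h2.2, h4.2], by linarith [h1.2, h2.1, h4.1]⟩

theorem isMarkovKernel_episode (hA : ∀ h, IsMarkovKernel (πA h)) (hB : ∀ h, IsMarkovKernel (πB h)) :
    IsMarkovKernel (episode G πA πB) := by
  have := isMarkovKernel_rollout (U := Param H d × Param H d) H G.P
    (fun h => (πA h).comap (fun y => (y.1.1 h, y.2)) (by fun_prop))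
    (fun h => (πB h).comap (fun y => ((y.1.1 h, y.1.2 h), y.2)) (by fun_prop)) G.markov
    (fun h => inferInstance) (fun h => inferInstance)
  unfold episode
  infer_instance

/-- The gap between the two agents' value estimates is at most the expected sum of their Bellman
residuals along the episode. -/
theorem mainVal_sub_boostVal_le (hφ : ∀ h, Measurable (φ h)) (hA : IsMainRule φ πA)
    (hB : IsBoosterRule φ πA πB) {θ ϑ : Param H d} (hθ : θ ∈ classSet φ) (hϑ : ϑ ∈ classSet φ) :
    mainVal φ θ 0 G.x₁ - boostVal φ πA θ ϑ 0 G.x₁ ≤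
      ∫ ζ, ∑ h, (|resid G (linFun φ θ) (mainVal φ θ) h (ζ h)| +
        |resid G (linFun φ ϑ) (boostVal φ πA θ ϑ) h (ζ h)|) ∂(episode G πA πB (θ, ϑ)) := by
  have := hA.markov
  have := hB.markov
  have := isMarkovKernel_episode (G := G) hA.markov hB.markov
  have hVm := measurable_mainVal_right hφ θ
  have hVb := measurable_boostVal_right hφ πA θ ϑ
  have hbm : ∀ (h : Fin H) x, mainVal φ θ h x ∈ Set.Icc (0 : ℝ) (H - (h : ℕ)) := fun h x =>
    mainVal_mem_Icc (hθ h) x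
  have hbb : ∀ (h : Fin H) x, boostVal φ πA θ ϑ h x ∈ Set.Icc (0 : ℝ) (H - (h : ℕ)) := fun h x =>
    boostVal_mem_Icc hA.markov θ (hϑ h) x
  have hDm : ∀ h, Measurable fun z => linFun φ θ h z - nextMean G.P (mainVal φ θ) h z := fun h =>
    (measurable_linFun_right hφ θ h).sub (measurable_nextMean_right G hVm h)
  have hDb : ∀ h, Measurable fun z => linFun φ ϑ h z - nextMean G.P (boostVal φ πA θ ϑ) h z :=
    fun h => (measurable_linFun_right hφ ϑ h).sub (measurable_nextMean_right G hVb h)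
  -- For the main agent, `V_θ` is the minimum of the payoff over the opponent's mixtures, so the
  -- payoff against the booster's `ν` is no smaller.
  have k1 := startVal_le_integral_rollout (θ, ϑ) H H H G.P
    (fun h => (πA h).comap (fun y : (Param H d × Param H d) × X => (y.1.1 h, y.2)) (by fun_prop))
    (fun h => (πB h).comap (fun y : (Param H d × Param H d) × X => ((y.1.1 h, y.1.2 h), y.2))
      (by fun_prop)) G.markov (fun h => inferInstance) (fun h => inferInstance)
    (fun h z => linFun φ θ h z - nextMean G.P (mainVal φ θ) h z) (mainVal φ θ) hDm
    (fun h z => abs_linFun_sub_nextMean_le (hθ h) hbm z) hVm (abs_le_horizon hbm)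
    (fun h x => by
      simp only [sub_add_cancel]
      rw [hA.mainVal_eq (hθ h)]
      exact respValue_le_payoff _ _ (weights_mem_stdSimplex (πB h ((θ h, ϑ h), x)))) G.x₁
  -- For the booster, `ν` attains the minimum against `ϑ`, so the reverse inequality holds; it is
  -- used with negated functions.
  have k2 := startVal_le_integral_rollout (θ, ϑ) H H H G.P
    (fun h => (πA h).comap (fun y : (Param H d × Param H d) × X => (y.1.1 h, y.2)) (by fun_prop))
    (fun h => (πB h).comap (fun y : (Param H d × Param H d) × X => ((y.1.1 h, y.1.2 h), y.2))
      (by fun_prop)) G.markov (fun h => inferInstance) (fun h => inferInstance)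
    (fun h z => -(linFun φ ϑ h z - nextMean G.P (boostVal φ πA θ ϑ) h z))
    (fun h x => -boostVal φ πA θ ϑ h x) (fun h => (hDb h).neg)
    (fun h z => by rw [abs_neg]; exact abs_linFun_sub_nextMean_le (hϑ h) hbb z)
    (fun h => (hVb h).neg) (fun h x => by rw [abs_neg]; exact abs_le_horizon hbb h x)
    (fun h x => by
      simp only [nextMean_neg, ← neg_add, sub_add_cancel]
      rw [payoff_neg, neg_le_neg_iff]
      exact le_respValue fun q hq => hB.argmin h _ (hθ h) _ (hϑ h) x q hq) G.x₁
  rw [startVal_eq] at k1 k2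
  have hsum : ∀ (D : Fin H → X × A × B → ℝ), (∀ h, Measurable (D h)) → (∀ h z, |D h z| ≤ H) →
      Integrable (fun ζ : Traj H X A B => ∑ h, D h (ζ h)) (episode G πA πB (θ, ϑ)) := by
    intro D hD hDb
    refine integrable_finsetSum _ fun h _ => ?_
    exact .of_bound ((hD h).comp (measurable_pi_apply h)).aestronglyMeasurable H
      (.of_forall fun ζ => (Real.norm_eq_abs _).trans_le (hDb h _))
  have i1 := hsum _ hDm fun h z => abs_linFun_sub_nextMean_le (hθ h) hbm z
  have i2 := hsum (fun h z => -(linFun φ ϑ h z - nextMean G.P (boostVal φ πA θ ϑ) h z))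
    (fun h => (hDb h).neg)
    (fun h z => by rw [abs_neg]; exact abs_linFun_sub_nextMean_le (G := G) (hϑ h) hbb z)
  have hrm : ∀ h, Measurable (resid G (linFun φ θ) (mainVal φ θ) h) := fun h =>
    ((measurable_linFun_right hφ θ h).sub (G.measurable_r h)).sub
      (measurable_nextMean_right G hVm h)
  have hrb : ∀ h, Measurable (resid G (linFun φ ϑ) (boostVal φ πA θ ϑ) h) := fun h =>
    ((measurable_linFun_right hφ ϑ h).sub (G.measurable_r h)).sub
      (measurable_nextMean_right G hVb h)
  have i3 := hsum (fun h z => |resid G (linFun φ θ) (mainVal φ θ) h z|) (fun h => (hrm h).abs)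
    (fun h z => by rw [abs_abs]; exact abs_resid_le (hθ h) hbm z)
  have i4 := hsum (fun h z => |resid G (linFun φ ϑ) (boostVal φ πA θ ϑ) h z|)
    (fun h => (hrb h).abs) (fun h z => by rw [abs_abs]; exact abs_resid_le (hϑ h) hbb z)
  -- Both comparisons were made without the rewards. They cancel in the difference, so what remains
  -- is a difference of Bellman residuals.
  have hmono : ∫ ζ, (∑ h, (linFun φ θ h (ζ h) - nextMean G.P (mainVal φ θ) h (ζ h)) +
      ∑ h, -(linFun φ ϑ h (ζ h) - nextMean G.P (boostVal φ πA θ ϑ) h (ζ h)))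
      ∂(episode G πA πB (θ, ϑ)) ≤
      ∫ ζ, ∑ h, (|resid G (linFun φ θ) (mainVal φ θ) h (ζ h)| +
        |resid G (linFun φ ϑ) (boostVal φ πA θ ϑ) h (ζ h)|) ∂(episode G πA πB (θ, ϑ)) := by
    refine integral_mono (i1.add i2) ?_ fun ζ => ?_
    · simp only [Finset.sum_add_distrib]
      exact i3.add i4
    · simp only [← Finset.sum_add_distrib]
      refine Finset.sum_le_sum fun h _ => ?_
      have e1 := le_abs_self (resid G (linFun φ θ) (mainVal φ θ) h (ζ h))
      have e2 := neg_le_abs (resid G (linFun φ ϑ) (boostVal φ πA θ ϑ) h (ζ h))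
      unfold resid at *
      linarith
  refine le_trans ?_ hmono
  rw [integral_add i1 i2, sub_eq_add_neg]
  exact add_le_add k1 k2

end Comparison

/-! ### Conditional Gibbs weights: normalizers, densities and total mass. -/

section Gibbs

variable {ι E : Type*} [Fintype ι] [MeasurableSpace E]

/-- The normalizing constant of the `i`-th conditional factor of a conditional Gibbs weight. -/
noncomputable def partitionFun (p : ι → Measure E) (L : ι → E → (ι → E) → ℝ) (i : ι)
    (θ : ι → E) : ℝ :=
  ∫ w, Real.exp (-L i w θ) ∂(p i)

/-- The weight `exp (F θ) ∏ᵢ exp (-Lᵢ(θᵢ; θ)) / 𝔼_w exp (-Lᵢ(w; θ))`. -/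
noncomputable def gibbsWeight (p : ι → Measure E) (F : (ι → E) → ℝ) (L : ι → E → (ι → E) → ℝ)
    (θ : ι → E) : ℝ :=
  Real.exp (F θ) * ∏ i, (Real.exp (-L i (θ i) θ) / partitionFun p L i θ)

/-- The total mass of a conditional Gibbs weight under the product prior. -/
noncomputable def gibbsMass (p : ι → Measure E) (F : (ι → E) → ℝ) (L : ι → E → (ι → E) → ℝ) : ℝ :=
  ∫ θ, gibbsWeight p F L θ ∂(Measure.pi p)

/-- A term that does not depend on the variable `w` of its factor cancels against the normalizer.
This is what allows excess losses in place of squared losses. -/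
theorem gibbsWeight_sub (p : ι → Measure E) (F : (ι → E) → ℝ) (L : ι → E → (ι → E) → ℝ)
    (b : ι → (ι → E) → ℝ) :
    gibbsWeight p F (fun i w θ => L i w θ - b i θ) = gibbsWeight p F L := by
  funext θ
  unfold gibbsWeight partitionFun
  congr 1
  refine Finset.prod_congr rfl fun i _ => ?_
  have : ∀ w, Real.exp (-(L i w θ - b i θ)) = Real.exp (-L i w θ) * Real.exp (b i θ) := fun w => by
    rw [← Real.exp_add]; ring_nf
  simp only [this]
  rw [integral_mul_const, mul_div_mul_right _ _ (Real.exp_pos _).ne']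

section Measurability

variable {p : ι → Measure E} [∀ i, IsProbabilityMeasure (p i)] {Y : Type*} [MeasurableSpace Y]
  {F : Y → (ι → E) → ℝ} {L : Y → ι → E → (ι → E) → ℝ}

theorem measurable_partitionFun (hL : ∀ i, Measurable fun z : (Y × (ι → E)) × E =>
    L z.1.1 i z.2 z.1.2) (i : ι) :
    Measurable fun z : Y × (ι → E) => partitionFun p (L z.1) i z.2 := by
  have h : StronglyMeasurable fun z : (Y × (ι → E)) × E => Real.exp (-L z.1.1 i z.2 z.1.2) :=
    (hL i).neg.exp.stronglyMeasurable
  exact h.integral_prod_right'.measurable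

theorem measurable_gibbsWeight (hF : Measurable fun z : Y × (ι → E) => F z.1 z.2)
    (hL : ∀ i, Measurable fun z : (Y × (ι → E)) × E => L z.1.1 i z.2 z.1.2) :
    Measurable fun z : Y × (ι → E) => gibbsWeight p (F z.1) (L z.1) z.2 := by
  refine hF.exp.mul (Finset.measurable_prod _ fun i _ => ?_)
  refine Measurable.div ?_ (measurable_partitionFun hL i)
  have h : Measurable fun z : Y × (ι → E) => (z, z.2 i) := by fun_prop
  exact ((hL i).comp h).neg.exp

end Measurability

/-- Measurability and boundedness, on a product set of full prior measure, of the data of a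
conditional Gibbs weight. -/
structure GibbsBounded (p : ι → Measure E) (F : (ι → E) → ℝ) (L : ι → E → (ι → E) → ℝ)
    (k : ι → Set E) (R : ℝ) : Prop where
  measurable_F : Measurable F
  measurable_L : ∀ i, Measurable fun z : (ι → E) × E => L i z.2 z.1
  ae_mem : ∀ i, ∀ᵐ w ∂(p i), w ∈ k i
  abs_F_le : ∀ θ, (∀ i, θ i ∈ k i) → |F θ| ≤ R
  abs_L_le : ∀ θ, (∀ i, θ i ∈ k i) → ∀ i, ∀ w ∈ k i, |L i w θ| ≤ R

namespace GibbsBounded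

variable {p : ι → Measure E} [∀ i, IsProbabilityMeasure (p i)] {F : (ι → E) → ℝ}
  {L : ι → E → (ι → E) → ℝ} {k : ι → Set E} {R : ℝ}

theorem ae_pi_mem (hg : GibbsBounded p F L k R) : ∀ᵐ θ ∂(Measure.pi p), ∀ i, θ i ∈ k i :=
  ae_all_iff.2 fun i => (Measure.quasiMeasurePreserving_eval p i).ae (hg.ae_mem i)

theorem measurable_slice (hg : GibbsBounded p F L k R) (θ : ι → E) (i : ι) :
    Measurable fun w => L i w θ :=
  (hg.measurable_L i).comp measurable_prodMk_left

theorem integrable_exp (hg : GibbsBounded p F L k R) {θ : ι → E} (hθ : ∀ i, θ i ∈ k i) (i : ι)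
    {c : ℝ} (hc : 0 ≤ c) : Integrable (fun w => Real.exp (-(c * L i w θ))) (p i) := by
  refine .of_bound ((hg.measurable_slice θ i).const_mul c).neg.exp.aestronglyMeasurable
    (Real.exp (c * R)) ?_
  filter_upwards [hg.ae_mem i] with w hw
  rw [Real.norm_eq_abs, Real.abs_exp]
  refine Real.exp_le_exp.2 ?_
  have := (abs_le.1 (hg.abs_L_le θ hθ i w hw)).1
  nlinarith

theorem integrable_exp_one (hg : GibbsBounded p F L k R) {θ : ι → E} (hθ : ∀ i, θ i ∈ k i)
    (i : ι) : Integrable (fun w => Real.exp (-L i w θ)) (p i) := by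
  simpa using hg.integrable_exp hθ i zero_le_one

theorem exp_neg_le_partitionFun (hg : GibbsBounded p F L k R) {θ : ι → E} (hθ : ∀ i, θ i ∈ k i)
    (i : ι) : Real.exp (-R) ≤ partitionFun p L i θ := by
  have : ∫ _, Real.exp (-R) ∂(p i) ≤ partitionFun p L i θ := by
    refine integral_mono_ae (integrable_const _) (hg.integrable_exp_one hθ i) ?_
    filter_upwards [hg.ae_mem i] with w hw
    exact Real.exp_le_exp.2 (neg_le_neg (abs_le.1 (hg.abs_L_le θ hθ i w hw)).2)
  simpa using this

theorem partitionFun_pos (hg : GibbsBounded p F L k R) {θ : ι → E} (hθ : ∀ i, θ i ∈ k i)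
    (i : ι) : 0 < partitionFun p L i θ :=
  (Real.exp_pos _).trans_le (hg.exp_neg_le_partitionFun hθ i)

theorem partitionFun_le (hg : GibbsBounded p F L k R) {θ : ι → E} (hθ : ∀ i, θ i ∈ k i)
    (i : ι) : partitionFun p L i θ ≤ Real.exp R := by
  have : partitionFun p L i θ ≤ ∫ _, Real.exp R ∂(p i) := by
    refine integral_mono_ae (hg.integrable_exp_one hθ i) (integrable_const _) ?_
    filter_upwards [hg.ae_mem i] with w hw
    exact Real.exp_le_exp.2 (by linarith [(abs_le.1 (hg.abs_L_le θ hθ i w hw)).1])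
  simpa using this

theorem weight_pos (hg : GibbsBounded p F L k R) {θ : ι → E} (hθ : ∀ i, θ i ∈ k i) :
    0 < gibbsWeight p F L θ :=
  mul_pos (Real.exp_pos _) (Finset.prod_pos fun i _ =>
    div_pos (Real.exp_pos _) (hg.partitionFun_pos hθ i))

theorem measurable_partition (hg : GibbsBounded p F L k R) (i : ι) :
    Measurable (partitionFun p L i) := by
  have h : StronglyMeasurable fun z : (ι → E) × E => Real.exp (-L i z.2 z.1) :=
    (hg.measurable_L i).neg.exp.stronglyMeasurable
  exact h.integral_prod_right'.measurable

theorem measurable_weight (hg : GibbsBounded p F L k R) : Measurable (gibbsWeight p F L) := by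
  refine hg.measurable_F.exp.mul (Finset.measurable_prod _ fun i _ => ?_)
  refine Measurable.div ?_ (hg.measurable_partition i)
  have h : Measurable fun z : ι → E => (z, z i) := by fun_prop
  exact ((hg.measurable_L i).comp h).neg.exp

theorem integrable_weight (hg : GibbsBounded p F L k R) :
    Integrable (gibbsWeight p F L) (Measure.pi p) := by
  refine .of_bound hg.measurable_weight.aestronglyMeasurable
    (Real.exp R * ∏ _i : ι, (Real.exp R / Real.exp (-R))) ?_
  filter_upwards [hg.ae_pi_mem] with θ hθ
  rw [Real.norm_eq_abs, abs_of_pos (hg.weight_pos hθ)]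
  unfold gibbsWeight
  gcongr with i _
  · exact Finset.prod_nonneg fun i _ => div_nonneg (Real.exp_pos _).le (hg.partitionFun_pos hθ i).le
  · exact (abs_le.1 (hg.abs_F_le θ hθ)).2
  · exact fun i _ => div_nonneg (Real.exp_pos _).le (hg.partitionFun_pos hθ i).le
  · linarith [(abs_le.1 (hg.abs_L_le θ hθ i _ (hθ i))).1]
  · exact hg.exp_neg_le_partitionFun hθ i

theorem mass_pos (hg : GibbsBounded p F L k R) : 0 < gibbsMass p F L := by
  refine (integral_pos_iff_support_of_nonneg_ae ?_ hg.integrable_weight).2 ?_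
  · filter_upwards [hg.ae_pi_mem] with θ hθ using (hg.weight_pos hθ).le
  · have : ∀ᵐ θ ∂(Measure.pi p), θ ∈ Function.support (gibbsWeight p F L) := by
      filter_upwards [hg.ae_pi_mem] with θ hθ using (hg.weight_pos hθ).ne'
    have e : Measure.pi p (Function.support (gibbsWeight p F L)) = Measure.pi p Set.univ :=
      measure_congr (Filter.eventuallyEq_univ.2 this)
    rw [e]
    simp

theorem lintegral_density (hg : GibbsBounded p F L k R) :
    ∫⁻ θ, ENNReal.ofReal (gibbsWeight p F L θ / gibbsMass p F L) ∂(Measure.pi p) = 1 := by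
  rw [← ofReal_integral_eq_lintegral_ofReal (hg.integrable_weight.div_const _), integral_div]
  · change ENNReal.ofReal (gibbsMass p F L / gibbsMass p F L) = 1
    rw [div_self hg.mass_pos.ne', ENNReal.ofReal_one]
  · filter_upwards [hg.ae_pi_mem] with θ hθ using div_nonneg (hg.weight_pos hθ).le hg.mass_pos.le

theorem log_density (hg : GibbsBounded p F L k R) {θ : ι → E} (hθ : ∀ i, θ i ∈ k i) :
    Real.log (gibbsWeight p F L θ / gibbsMass p F L) = F θ - ∑ i, L i (θ i) θ -
      ∑ i, Real.log (partitionFun p L i θ) - Real.log (gibbsMass p F L) := by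
  have hZ := fun i => (hg.partitionFun_pos hθ i).ne'
  rw [Real.log_div (hg.weight_pos hθ).ne' hg.mass_pos.ne']
  unfold gibbsWeight
  rw [Real.log_mul (Real.exp_pos _).ne' (Finset.prod_ne_zero_iff.2 fun i _ =>
    div_ne_zero (Real.exp_pos _).ne' (hZ i)), Real.log_exp, Real.log_prod (fun i _ =>
    div_ne_zero (Real.exp_pos _).ne' (hZ i))]
  simp only [Real.log_div (Real.exp_pos _).ne' (hZ _), Real.log_exp, Finset.sum_sub_distrib,
    Finset.sum_neg_distrib]
  ring

/-- Restricted to `S i`, each normalizer is at least the prior mass of `S i` times `exp (-b)`. -/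
theorem neg_sum_log_partitionFun_le (hg : GibbsBounded p F L k R) {θ : ι → E}
    (hθ : ∀ i, θ i ∈ k i) {S : ι → Set E} (hS : ∀ i, MeasurableSet (S i)) {b K : ℝ}
    (hb : ∀ i, ∀ w ∈ S i, L i w θ ≤ b) (hpos : ∀ i, 0 < (p i).real (S i))
    (hK : Real.exp (-K) ≤ ∏ i, (p i).real (S i)) :
    -∑ i, Real.log (partitionFun p L i θ) ≤ K + Fintype.card ι * b := by
  have h1 : ∀ i, Real.log ((p i).real (S i)) - b ≤ Real.log (partitionFun p L i θ) := by
    intro i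
    rw [← Real.log_exp b, ← Real.log_div (hpos i).ne' (Real.exp_pos _).ne']
    refine Real.log_le_log (div_pos (hpos i) (Real.exp_pos _)) ?_
    have h2 : ∫ _ in S i, Real.exp (-b) ∂(p i) ≤ ∫ w in S i, Real.exp (-L i w θ) ∂(p i) := by
      refine setIntegral_mono_on (integrable_const _) (hg.integrable_exp_one hθ i).integrableOn
        (hS i) fun w hw => Real.exp_le_exp.2 (neg_le_neg (hb i w hw))
    have h3 : ∫ w in S i, Real.exp (-L i w θ) ∂(p i) ≤ partitionFun p L i θ :=
      setIntegral_le_integral (hg.integrable_exp_one hθ i) (.of_forall fun w => (Real.exp_pos _).le)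
    rw [setIntegral_const, smul_eq_mul, Real.exp_neg] at h2
    rw [div_eq_mul_inv]
    exact h2.trans h3
  have h4 := Finset.sum_le_sum fun i (_ : i ∈ Finset.univ) => h1 i
  have h5 := Real.log_le_log (Real.exp_pos _) hK
  rw [Real.log_exp, Real.log_prod fun i _ => (hpos i).ne'] at h5
  simp only [Finset.sum_sub_distrib, Finset.sum_const, Finset.card_univ, nsmul_eq_mul] at h4
  linarith

/-- Jensen for the fourth power. The resulting factor four in the exponent is absorbed by taking `η`
small enough for the supermartingale at rate `4 η`. -/
theorem partitionFun_pow_four_le (hg : GibbsBounded p F L k R) {θ : ι → E}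
    (hθ : ∀ i, θ i ∈ k i) (i : ι) :
    partitionFun p L i θ ^ 4 ≤ ∫ w, Real.exp (-(4 * L i w θ)) ∂(p i) := by
  have e : ∀ w, Real.exp (-(4 * L i w θ)) = Real.exp (-L i w θ) ^ 4 := fun w => by
    rw [← Real.exp_nat_mul]; push_cast; ring_nf
  have h4 := hg.integrable_exp hθ i (c := 4) (by norm_num)
  simp only [e] at h4 ⊢
  exact (Even.convexOn_pow (by decide : Even 4)).map_integral_le
    (continuous_pow 4).continuousOn isClosed_univ (.of_forall fun _ => Set.mem_univ _)
    (hg.integrable_exp_one hθ i) h4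

/-- Under the product prior the coordinates of `w` are independent, so the product of normalizers
becomes one average over `w`, with `θ` frozen in the value functions. -/
theorem ofReal_prod_partitionFun_pow_le (hg : GibbsBounded p F L k R) {θ : ι → E}
    (hθ : ∀ i, θ i ∈ k i) :
    ENNReal.ofReal ((∏ i, partitionFun p L i θ) ^ 4) ≤
      ∫⁻ w, ENNReal.ofReal (Real.exp (-(4 * ∑ i, L i (w i) θ))) ∂(Measure.pi p) := by
  have e : ∀ w : ι → E, Real.exp (-(4 * ∑ i, L i (w i) θ)) =
      ∏ i, Real.exp (-(4 * L i (w i) θ)) := fun w => by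
    rw [← Real.exp_sum, Finset.mul_sum, Finset.sum_neg_distrib]
  simp only [e]
  rw [← ofReal_integral_eq_lintegral_ofReal]
  · refine ENNReal.ofReal_le_ofReal ?_
    rw [integral_fintype_prod_eq_prod (fun i w => Real.exp (-(4 * L i w θ))), ← Finset.prod_pow]
    exact Finset.prod_le_prod (fun i _ => by positivity) fun i _ =>
      hg.partitionFun_pow_four_le hθ i
  · exact Integrable.fintype_prod fun i => hg.integrable_exp hθ i (by norm_num)
  · exact .of_forall fun w => Finset.prod_nonneg fun i _ => (Real.exp_pos _).le

/-- A reverse Markov bound for the total mass, in terms of an average of exponentiated losses over a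
set on which `F` is almost as large as `F₀` and the losses are small. -/
theorem exp_four_mul_le (hg : GibbsBounded p F L k R) {S : ι → Set E}
    (hS : ∀ i, MeasurableSet (S i)) (hSk : ∀ i, S i ⊆ k i) {b K δ F₀ : ℝ}
    (hb : ∀ θ, (∀ i, θ i ∈ S i) → ∀ i, L i (θ i) θ ≤ b) (hF : ∀ θ, (∀ i, θ i ∈ S i) → F₀ - δ ≤ F θ)
    (hK : Real.exp (-K) ≤ ∏ i, (p i).real (S i)) :
    ENNReal.ofReal (Real.exp (4 * (F₀ - δ - Fintype.card ι * b - K -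
      Real.log (gibbsMass p F L)))) ≤ ∫⁻ θ, ∫⁻ w, ENNReal.ofReal
        (Real.exp (-(4 * ∑ i, L i (w i) θ))) ∂(Measure.pi p)
          ∂(cond (Measure.pi p) (Set.univ.pi S)) := by
  set U : (ι → E) → ℝ := fun θ => ∏ i, partitionFun p L i θ with hU
  set Gs : Set (ι → E) := Set.univ.pi S
  have hGm : MeasurableSet Gs := MeasurableSet.univ_pi hS
  have hGk : ∀ θ ∈ Gs, ∀ i, θ i ∈ k i := fun θ hθ i => hSk i (hθ i (Set.mem_univ i))
  have hGS : ∀ θ ∈ Gs, ∀ i, θ i ∈ S i := fun θ hθ i => hθ i (Set.mem_univ i)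
  have hreal : (Measure.pi p).real Gs = ∏ i, (p i).real (S i) := by
    simp [measureReal_def, Gs, Measure.pi_pi, ENNReal.toReal_prod]
  have hG0 : Measure.pi p Gs ≠ 0 := by
    intro h0
    have : (Measure.pi p).real Gs = 0 := by rw [measureReal_def, h0]; rfl
    rw [hreal] at this
    linarith [Real.exp_pos (-K)]
  have hprob : IsProbabilityMeasure (cond (Measure.pi p) Gs) := cond_isProbabilityMeasure hG0
  have hae : ∀ᵐ θ ∂(cond (Measure.pi p) Gs), θ ∈ Gs := ae_cond_mem hGm
  have hUm : Measurable U := Finset.measurable_prod _ fun i _ => hg.measurable_partition i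
  have hUpos : ∀ θ ∈ Gs, 0 < U θ := fun θ hθ =>
    Finset.prod_pos fun i _ => hg.partitionFun_pos (hGk θ hθ) i
  have hUlow : ∀ θ ∈ Gs, ∏ _i : ι, Real.exp (-R) ≤ U θ := fun θ hθ =>
    Finset.prod_le_prod (fun i _ => (Real.exp_pos _).le)
      fun i _ => hg.exp_neg_le_partitionFun (hGk θ hθ) i
  have hUup : ∀ θ ∈ Gs, U θ ≤ ∏ _i : ι, Real.exp R := fun θ hθ =>
    Finset.prod_le_prod (fun i _ => (hg.partitionFun_pos (hGk θ hθ) i).le)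
      fun i _ => hg.partitionFun_le (hGk θ hθ) i
  have hc0 : 0 < ∏ _i : ι, Real.exp (-R) := Finset.prod_pos fun _ _ => Real.exp_pos _
  have hi1 : Integrable (fun θ => (U θ)⁻¹) (cond (Measure.pi p) Gs) := by
    refine .of_bound hUm.inv.aestronglyMeasurable (∏ _i : ι, Real.exp (-R))⁻¹ ?_
    filter_upwards [hae] with θ hθ
    rw [Real.norm_eq_abs, abs_of_pos (inv_pos.2 (hUpos θ hθ))]
    exact inv_anti₀ hc0 (hUlow θ hθ)
  have hi4 : Integrable (fun θ => U θ ^ 4) (cond (Measure.pi p) Gs) := by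
    refine .of_bound (hUm.pow_const 4).aestronglyMeasurable ((∏ _i : ι, Real.exp R) ^ 4) ?_
    filter_upwards [hae] with θ hθ
    rw [Real.norm_eq_abs, abs_of_pos (pow_pos (hUpos θ hθ) 4)]
    exact pow_le_pow_left₀ (hUpos θ hθ).le (hUup θ hθ) 4
  set r := ∫ θ, (U θ)⁻¹ ∂(cond (Measure.pi p) Gs) with hr
  have hrpos : 0 < r := by
    have : ∫ _, (∏ _i : ι, Real.exp R)⁻¹ ∂(cond (Measure.pi p) Gs) ≤ r := by
      refine integral_mono_ae (integrable_const _) hi1 ?_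
      filter_upwards [hae] with θ hθ
      exact inv_anti₀ (hUpos θ hθ) (hUup θ hθ)
    refine lt_of_lt_of_le ?_ this
    simp only [integral_const, probReal_univ, smul_eq_mul, one_mul]
    exact inv_pos.2 (Finset.prod_pos fun _ _ => Real.exp_pos _)
  have hjensen : (r⁻¹) ^ 4 ≤ ∫ θ, U θ ^ 4 ∂(cond (Measure.pi p) Gs) := by
    -- Jensen for `y ↦ y⁻⁴` at `y = 1 / U`, whose mean is `r`, through the tangent line at `r`; the
    -- factorization below shows the gap to be nonnegative.
    have key : ∫ θ, (5 * r⁻¹ ^ 4 - 4 * r⁻¹ ^ 5 * (U θ)⁻¹) ∂(cond (Measure.pi p) Gs) ≤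
        ∫ θ, U θ ^ 4 ∂(cond (Measure.pi p) Gs) := by
      refine integral_mono_ae ((integrable_const _).sub (hi1.const_mul _)) hi4 ?_
      filter_upwards [hae] with θ hθ
      have hu := hUpos θ hθ
      have : U θ ^ 4 - (5 * r⁻¹ ^ 4 - 4 * r⁻¹ ^ 5 * (U θ)⁻¹) =
          (U θ - r⁻¹) ^ 2 * (U θ ^ 3 + 2 * U θ ^ 2 * r⁻¹ + 3 * U θ * r⁻¹ ^ 2 + 4 * r⁻¹ ^ 3) *
            (U θ)⁻¹ := by
        field_simp
        ring
      have h2 : 0 ≤ (U θ - r⁻¹) ^ 2 * (U θ ^ 3 + 2 * U θ ^ 2 * r⁻¹ + 3 * U θ * r⁻¹ ^ 2 +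
          4 * r⁻¹ ^ 3) * (U θ)⁻¹ := by positivity
      linarith
    rw [integral_sub (integrable_const _) (hi1.const_mul _),
      integral_const_mul (4 * r⁻¹ ^ 5) fun θ => (U θ)⁻¹, ← hr] at key
    simp only [integral_const, probReal_univ, smul_eq_mul, one_mul] at key
    have : 5 * r⁻¹ ^ 4 - 4 * r⁻¹ ^ 5 * r = r⁻¹ ^ 4 := by field_simp; ring
    linarith
  -- Keep only `Gs` in the mass. There the tilt and the losses are controlled, so what is left is
  -- the prior mass of `Gs` times the conditional mean `r` of the inverse normalizers.
  have hmass : Real.exp (F₀ - δ - Fintype.card ι * b) * (Real.exp (-K) * r) ≤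
      gibbsMass p F L := by
    have h1 : ∫ θ in Gs, Real.exp (F₀ - δ - Fintype.card ι * b) * (U θ)⁻¹ ∂(Measure.pi p) ≤
        gibbsMass p F L := by
      refine le_trans ?_ (setIntegral_le_integral (s := Gs) hg.integrable_weight ?_)
      · refine setIntegral_mono_on ?_ hg.integrable_weight.integrableOn hGm fun θ hθ => ?_
        · refine Integrable.const_mul ?_ _
          refine .of_bound hUm.inv.aestronglyMeasurable (∏ _i : ι, Real.exp (-R))⁻¹ ?_
          refine (ae_restrict_iff' hGm).2 (.of_forall fun θ hθ => ?_)
          rw [Real.norm_eq_abs, abs_of_pos (inv_pos.2 (hUpos θ hθ))]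
          exact inv_anti₀ hc0 (hUlow θ hθ)
        · unfold gibbsWeight
          rw [Finset.prod_div_distrib, ← Real.exp_sum, mul_div_assoc', ← Real.exp_add,
            ← div_eq_mul_inv]
          refine div_le_div_of_nonneg_right (Real.exp_le_exp.2 ?_) (hUpos θ hθ).le
          have h2 : ∑ i, -L i (θ i) θ ≥ ∑ _i : ι, -b :=
            Finset.sum_le_sum fun i _ => neg_le_neg (hb θ (hGS θ hθ) i)
          simp only [Finset.sum_const, Finset.card_univ, nsmul_eq_mul] at h2
          have := hF θ (hGS θ hθ)
          linarith
      · filter_upwards [hg.ae_pi_mem] with θ hθ using (hg.weight_pos hθ).le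
    rw [integral_const_mul] at h1
    have h3 : ∫ θ in Gs, (U θ)⁻¹ ∂(Measure.pi p) = (Measure.pi p).real Gs * r := by
      rw [hr, ProbabilityTheory.cond, integral_smul_measure, smul_eq_mul, ENNReal.toReal_inv,
        ← measureReal_def, mul_inv_cancel_left₀]
      rw [hreal]; linarith [Real.exp_pos (-K)]
    rw [h3] at h1
    refine le_trans ?_ h1
    rw [hreal]
    gcongr
  have hY : Real.exp (4 * (F₀ - δ - Fintype.card ι * b - K - Real.log (gibbsMass p F L))) ≤
      (r⁻¹) ^ 4 := by
    have : Real.exp (F₀ - δ - Fintype.card ι * b - K - Real.log (gibbsMass p F L)) ≤ r⁻¹ := by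
      rw [Real.exp_sub, Real.exp_log hg.mass_pos, div_le_iff₀ hg.mass_pos,
        ← div_le_iff₀' (inv_pos.2 hrpos), div_inv_eq_mul, sub_eq_add_neg _ K, Real.exp_add,
        mul_assoc]
      exact hmass
    calc _ = Real.exp (F₀ - δ - Fintype.card ι * b - K - Real.log (gibbsMass p F L)) ^ 4 := by
          rw [← Real.exp_nat_mul]; norm_num
      _ ≤ _ := pow_le_pow_left₀ (Real.exp_pos _).le this 4
  refine (ENNReal.ofReal_le_ofReal (hY.trans hjensen)).trans ?_
  rw [ofReal_integral_eq_lintegral_ofReal hi4 (.of_forall fun θ => by positivity)]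
  refine lintegral_mono_ae ?_
  filter_upwards [hae] with θ hθ
  exact hg.ofReal_prod_partitionFun_pow_le (hGk θ hθ)

end GibbsBounded

end Gibbs

/-! ### Losses summed over the observed data, and the common features of the two value families. -/

section CumulativeExcess

variable {H d : ℕ} {X A B : Type*} [MeasurableSpace X] [MeasurableSpace A] [MeasurableSpace B]
  [Fintype A] [Fintype B] [Nonempty A] [Nonempty B] [DiscreteMeasurableSpace A]
  [DiscreteMeasurableSpace B] [NeZero H] {G : Game H X A B} {φ : Fin H → X × A × B → Vec d}
  {πA : Fin H → Kernel (Vec d × X) A} {t : ℕ}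

/-- The excess squared loss summed over the observed trajectories. -/
noncomputable def cumExcess (G : Game H X A B) (q : Fin H → X × A × B → ℝ) (V : Fin H → X → ℝ)
    (h : Fin H) (S : Fin t → Traj H X A B) : ℝ :=
  ∑ s, excess G q V h (S s)

theorem measurable_cumExcess (G : Game H X A B) {Y : Type*} [MeasurableSpace Y]
    {q : Y → Fin H → X × A × B → ℝ} (hq : ∀ h, Measurable fun y : Y × (X × A × B) => q y.1 h y.2)
    {V : Y → Fin H → X → ℝ} (hV : ∀ h, Measurable fun y : Y × X => V y.1 h y.2) (h : Fin H) :
    Measurable fun y : Y × (Fin t → Traj H X A B) => cumExcess G (q y.1) (V y.1) h y.2 := by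
  refine Finset.measurable_sum _ fun s _ => ?_
  have h1 : Measurable fun y : Y × (Fin t → Traj H X A B) => (y.1, y.2 s) := by fun_prop
  exact (measurable_excess G hq hV h).comp h1

theorem tdNext_mem_Icc {V : Fin H → X → ℝ}
    (hVR : ∀ (h : Fin H) x, V h x ∈ Set.Icc (0 : ℝ) (H - (h : ℕ))) (h : Fin H)
    (ζ : Traj H X A B) : tdNext V h ζ ∈ Set.Icc (0 : ℝ) H := by
  unfold tdNext
  split_ifs
  · exact ⟨(hVR _ _).1, (hVR _ _).2.trans (horizon_sub_le _)⟩
  · exact ⟨le_rfl, Nat.cast_nonneg H⟩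

/-- In `excess_eq` the first factor is the residual; the second is at most `3 H`, namely `H` from
the residual and `2 H` from the centred next value. -/
theorem abs_excess_le {θ : Param H d} {V : Fin H → X → ℝ} {h : Fin H} (hθ : θ h ∈ paramSet φ h)
    (hVR : ∀ (h : Fin H) x, V h x ∈ Set.Icc (0 : ℝ) (H - (h : ℕ))) {ρ : ℝ} {ζ : Traj H X A B}
    (hρ : |resid G (linFun φ θ) V h (ζ h)| ≤ ρ) :
    |excess G (linFun φ θ) V h ζ| ≤ ρ * (3 * H) := by
  rw [excess_eq, abs_mul]
  refine mul_le_mul hρ ?_ (abs_nonneg _) ((abs_nonneg _).trans hρ)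
  have h1 := abs_le.1 (abs_resid_le (G := G) hθ hVR (ζ h))
  have h2 := nextMean_mem_Icc (G := G) hVR h (ζ h)
  have h3 := tdNext_mem_Icc hVR h ζ
  have h4 := horizon_sub_le h
  exact abs_le.2 ⟨by linarith [h1.1, h2.1, h3.2], by linarith [h1.2, h2.2, h3.1]⟩

theorem abs_cumExcess_le {θ : Param H d} {V : Fin H → X → ℝ} {h : Fin H}
    (hθ : θ h ∈ paramSet φ h)
    (hVR : ∀ (h : Fin H) x, V h x ∈ Set.Icc (0 : ℝ) (H - (h : ℕ))) {ρ : ℝ}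
    (hρ : ∀ z, |resid G (linFun φ θ) V h z| ≤ ρ) (S : Fin t → Traj H X A B) :
    |cumExcess G (linFun φ θ) V h S| ≤ t * (ρ * (3 * H)) := by
  refine (Finset.abs_sum_le_sum_abs _ _).trans ?_
  refine (Finset.sum_le_sum fun s _ => abs_excess_le hθ hVR (hρ (S s h))).trans ?_
  simp

/-- A family of value functions, indexed by the parameters, to which the posterior analysis
applies. -/
structure ValueFamily (φ : Fin H → X × A × B → Vec d) (V : Param H d → Fin H → X → ℝ) : Prop where
  measurable : ∀ h, Measurable fun y : Param H d × X => V y.1 h y.2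
  mem_Icc : ∀ θ ∈ classSet φ, ∀ (h : Fin H) x, V θ h x ∈ Set.Icc (0 : ℝ) (H - (h : ℕ))
  le_add : ∀ (θ ϑ : Param H d) (h : Fin H) (ε : ℝ),
    (∀ z, |linFun φ θ h z - linFun φ ϑ h z| ≤ ε) → ∀ x, V θ h x ≤ V ϑ h x + ε

theorem valueFamily_mainVal (hφ : ∀ h, Measurable (φ h)) : ValueFamily φ (mainVal φ) where
  measurable := measurable_mainVal hφ
  mem_Icc _ hθ h x := mainVal_mem_Icc (hθ h) x
  le_add _ _ _ _ hc x := gameValue_le_add fun a b => by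
    have := (abs_le.1 (hc (x, a, b))).2
    unfold linFun at this
    unfold qmat
    linarith

theorem measurable_boostVal_comp (hφ : ∀ h, Measurable (φ h)) {Y : Type*} [MeasurableSpace Y]
    {f g : Y → Param H d} {x : Y → X} (hf : Measurable f) (hg : Measurable g) (hx : Measurable x)
    (h : Fin H) : Measurable fun y => boostVal φ πA (f y) (g y) h (x y) := by
  have h1 : Measurable fun y => (f y h, x y) := by fun_prop
  have h2 : Measurable fun y => (g y h, x y) := by fun_prop
  exact measurable_respValue (p := fun y => weights (πA h (f y h, x y)))
    (M := fun y => qmat φ h (g y h) (x y)) (fun a => (measurable_weights (πA h) a).comp h1)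
    fun a b => (measurable_qmat hφ h a b).comp h2

theorem valueFamily_boostVal (hφ : ∀ h, Measurable (φ h)) (hA : ∀ h, IsMarkovKernel (πA h))
    (θ : Param H d) : ValueFamily φ (boostVal φ πA θ) where
  measurable h := measurable_boostVal_comp hφ measurable_const measurable_fst measurable_snd h
  mem_Icc _ hϑ h x := boostVal_mem_Icc hA θ (hϑ h) x
  le_add _ _ h _ hc x := respValue_le_add (weights_mem_stdSimplex _) fun a b => by
    have := (abs_le.1 (hc (x, a, b))).2
    unfold linFun at this
    unfold qmat
    linarith

/-- The parameters of step `h` whose Bellman residual against the value functions `V` is at most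
`ε` everywhere. -/
def smallSet (G : Game H X A B) (φ : Fin H → X × A × B → Vec d) (V : Fin H → X → ℝ) (ε : ℝ)
    (h : Fin H) : Set (Vec d) :=
  {w | w ∈ paramSet φ h ∧ ∀ z, |inner ℝ (φ h z) w - (G.r h z + nextMean G.P V h z)| ≤ ε}

theorem measurableSet_smallSet (V : Fin H → X → ℝ) (ε : ℝ) (h : Fin H) :
    MeasurableSet (smallSet G φ V ε h) := by
  have : IsClosed {w : Vec d | ∀ z, |inner ℝ (φ h z) w - (G.r h z + nextMean G.P V h z)| ≤ ε} := by
    simp only [Set.ofPred_forall]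
    exact isClosed_iInter fun z => isClosed_le (by fun_prop) continuous_const
  exact measurableSet_paramSet.inter this.measurableSet

end CumulativeExcess

/-! ### The posterior as a conditional Gibbs weight; optimism and the mass deficit. -/

section Posterior

variable {H d : ℕ} {X A B : Type*} [MeasurableSpace X] [MeasurableSpace A] [MeasurableSpace B]
  [Fintype A] [Fintype B] [Nonempty A] [Nonempty B] [DiscreteMeasurableSpace A]
  [DiscreteMeasurableSpace B] [NeZero H] {G : Game H X A B} {φ : Fin H → X × A × B → Vec d}
  {πA : Fin H → Kernel (Vec d × X) A} {t : ℕ}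

/-- The losses `η Dₕ(w; θ)` that define the posterior. -/
noncomputable def postLoss (G : Game H X A B) (φ : Fin H → X × A × B → Vec d)
    (V : Param H d → Fin H → X → ℝ) (η : ℝ) (S : Fin t → Traj H X A B) (h : Fin H) (w : Vec d)
    (θ : Param H d) : ℝ :=
  η * cumExcess G (linFun φ fun _ => w) (V θ) h S

/-- The loss of the true backup depends on `θ` only through `V θ` and not on `w`, so subtracting it
leaves the posterior unchanged. -/
theorem postWeight_eq (G : Game H X A B) (φ : Fin H → X × A × B → Vec d)
    (V : Param H d → Fin H → X → ℝ) (η c : ℝ) (S : Fin t → Traj H X A B) :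
    postWeight G φ V η c S =
      gibbsWeight (prior φ) (fun θ => c * V θ 0 G.x₁) (postLoss G φ V η S) := by
  have e : postLoss G φ V η S = fun h w θ => η * tdLoss G φ (V θ) h w S -
      η * ∑ s, (nextMean G.P (V θ) h (S s h) - tdNext (V θ) h (S s)) ^ 2 := by
    funext h w θ
    unfold postLoss cumExcess excess tdLoss
    rw [← mul_sub, ← Finset.sum_sub_distrib]
    rfl
  rw [e, gibbsWeight_sub]
  funext θ
  simp only [postWeight, gibbsWeight, partitionFun, neg_mul]

theorem measurable_postLoss {Ω : Type*} [MeasurableSpace Ω] (hφ : ∀ h, Measurable (φ h))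
    {V : Ω → Param H d → Fin H → X → ℝ}
    (hV : ∀ h, Measurable fun y : (Ω × Param H d) × X => V y.1.1 y.1.2 h y.2) (η : ℝ) (h : Fin H) :
    Measurable fun z : ((Ω × (Fin t → Traj H X A B)) × Param H d) × Vec d =>
      postLoss G φ (V z.1.1.1) η z.1.1.2 h z.2 z.1.2 := by
  have hm := measurable_cumExcess (t := t) G (Y := (Ω × Param H d) × Vec d)
    (q := fun y => linFun φ fun _ => y.2) (fun h => by
      have := hφ h
      unfold linFun
      fun_prop) (V := fun y => V y.1.1 y.1.2) (fun h => by
      have h1 : Measurable fun y : ((Ω × Param H d) × Vec d) × X => (y.1.1, y.2) := by fun_prop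
      exact (hV h).comp h1) h
  have h2 : Measurable fun z : ((Ω × (Fin t → Traj H X A B)) × Param H d) × Vec d =>
      (((z.1.1.1, z.1.2), z.2), z.1.1.2) := by fun_prop
  exact (hm.comp h2).const_mul η

theorem IsLinear.measurable_postWeight (hl : IsLinear G φ) {Ω : Type*} [MeasurableSpace Ω]
    {V : Ω → Param H d → Fin H → X → ℝ}
    (hV : ∀ h, Measurable fun y : (Ω × Param H d) × X => V y.1.1 y.1.2 h y.2) (η c : ℝ) :
    Measurable fun z : (Ω × (Fin t → Traj H X A B)) × Param H d =>
      postWeight G φ (V z.1.1) η c z.1.2 z.2 := by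
  have := hl.isProbabilityMeasure_prior
  simp only [postWeight_eq]
  refine measurable_gibbsWeight (Y := Ω × (Fin t → Traj H X A B))
    (F := fun y θ => c * V y.1 θ 0 G.x₁) (L := fun y => postLoss G φ (V y.1) η y.2) ?_ ?_
  · have h1 : Measurable fun z : (Ω × (Fin t → Traj H X A B)) × Param H d =>
      ((z.1.1, z.2), G.x₁) := by fun_prop
    exact ((hV 0).comp h1).const_mul c
  · exact fun h => measurable_postLoss hl.measurable_feature hV η h

theorem IsLinear.measurable_postMass (hl : IsLinear G φ) {Ω : Type*} [MeasurableSpace Ω]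
    {V : Ω → Param H d → Fin H → X → ℝ}
    (hV : ∀ h, Measurable fun y : (Ω × Param H d) × X => V y.1.1 y.1.2 h y.2) (η c : ℝ) :
    Measurable fun z : Ω × (Fin t → Traj H X A B) =>
      ∫ θ, postWeight G φ (V z.1) η c z.2 θ ∂(Measure.pi (prior φ)) := by
  have := hl.isProbabilityMeasure_prior
  exact (hl.measurable_postWeight hV η c).stronglyMeasurable.integral_prod_right'.measurable

theorem measurable_value_start {V : Param H d → Fin H → X → ℝ} (hV : ValueFamily φ V) (x : X) :
    Measurable fun θ : Param H d => V θ 0 x := by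
  have h1 : Measurable fun θ : Param H d => (θ, x) := by fun_prop
  exact (hV.measurable 0).comp h1

theorem measurable_postLoss_right (hφ : ∀ h, Measurable (φ h)) {V : Param H d → Fin H → X → ℝ}
    (hV : ValueFamily φ V) (η : ℝ) (S : Fin t → Traj H X A B) (h : Fin H) :
    Measurable fun z : Param H d × Vec d => postLoss G φ V η S h z.2 z.1 := by
  have hm := measurable_cumExcess (t := t) G (Y := Param H d × Vec d)
    (q := fun y => linFun φ fun _ => y.2) (fun h => by
      have := hφ h
      unfold linFun
      fun_prop) (V := fun y => V y.1) (fun h => by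
      have h1 : Measurable fun y : (Param H d × Vec d) × X => (y.1.1, y.2) := by fun_prop
      exact (hV.measurable h).comp h1) h
  have h2 : Measurable fun z : Param H d × Vec d => (z, S) := by fun_prop
  exact (hm.comp h2).const_mul η

theorem abs_postLoss_le {V : Param H d → Fin H → X → ℝ} (hV : ValueFamily φ V) {η : ℝ}
    (hη : 0 ≤ η) (S : Fin t → Traj H X A B) {θ : Param H d} (hθ : θ ∈ classSet φ) {h : Fin H}
    {w : Vec d} (hw : w ∈ paramSet φ h) :
    |postLoss G φ V η S h w θ| ≤ η * (t * (H * (3 * H))) := by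
  unfold postLoss
  rw [abs_mul, abs_of_nonneg hη]
  have h1 := abs_cumExcess_le (G := G) (θ := fun _ => w) hw (hV.mem_Icc θ hθ)
    (fun z => abs_resid_le (G := G) (θ := fun _ => w) hw (hV.mem_Icc θ hθ) z) S
  exact mul_le_mul_of_nonneg_left h1 hη

theorem IsLinear.gibbsBounded (hl : IsLinear G φ) {V : Param H d → Fin H → X → ℝ}
    (hV : ValueFamily φ V) {η : ℝ} (hη : 0 ≤ η) (c : ℝ) (S : Fin t → Traj H X A B) :
    GibbsBounded (prior φ) (fun θ => c * V θ 0 G.x₁) (postLoss G φ V η S) (paramSet φ)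
      (|c| * H + η * (t * (H * (3 * H)))) where
  measurable_F := (measurable_value_start hV G.x₁).const_mul c
  measurable_L := measurable_postLoss_right hl.measurable_feature hV η S
  ae_mem _ := ae_prior_mem
  abs_F_le θ hθ := by
    rw [abs_mul]
    have h1 : |c| * |V θ 0 G.x₁| ≤ |c| * H :=
      mul_le_mul_of_nonneg_left (abs_le_horizon (hV.mem_Icc θ hθ) 0 _) (abs_nonneg c)
    have : 0 ≤ η * (t * (H * (3 * H))) := by positivity
    linarith
  abs_L_le θ hθ h w hw :=
    (abs_postLoss_le hV hη S hθ hw).trans (le_add_of_nonneg_left (by positivity))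

/-- The logarithm of the posterior density. -/
noncomputable def logDensity (G : Game H X A B) (φ : Fin H → X × A × B → Vec d)
    (V : Param H d → Fin H → X → ℝ) (η c : ℝ) (S : Fin t → Traj H X A B) (θ : Param H d) : ℝ :=
  Real.log (postWeight G φ V η c S θ / ∫ θ', postWeight G φ V η c S θ' ∂(Measure.pi (prior φ)))

theorem mass_eq (G : Game H X A B) (φ : Fin H → X × A × B → Vec d)
    (V : Param H d → Fin H → X → ℝ) (η c : ℝ) (S : Fin t → Traj H X A B) :
    ∫ θ, postWeight G φ V η c S θ ∂(Measure.pi (prior φ)) =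
      gibbsMass (prior φ) (fun θ => c * V θ 0 G.x₁) (postLoss G φ V η S) := by
  rw [postWeight_eq]
  rfl

theorem IsLinear.lintegral_postDensity (hl : IsLinear G φ) {V : Param H d → Fin H → X → ℝ}
    (hV : ValueFamily φ V) {η : ℝ} (hη : 0 ≤ η) (c : ℝ) (S : Fin t → Traj H X A B) :
    ∫⁻ θ, postDensity G φ V η c S θ ∂(Measure.pi (prior φ)) = 1 := by
  have := hl.isProbabilityMeasure_prior
  unfold postDensity
  rw [mass_eq, postWeight_eq]
  exact (hl.gibbsBounded hV hη c S).lintegral_density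

theorem IsLinear.postDensity_eq (hl : IsLinear G φ) {V : Param H d → Fin H → X → ℝ}
    (hV : ValueFamily φ V) {η : ℝ} (hη : 0 ≤ η) (c : ℝ) (S : Fin t → Traj H X A B)
    {θ : Param H d} (hθ : θ ∈ classSet φ) :
    postDensity G φ V η c S θ = ENNReal.ofReal (Real.exp (logDensity G φ V η c S θ)) := by
  have := hl.isProbabilityMeasure_prior
  have hg := hl.gibbsBounded hV hη c S
  unfold postDensity logDensity
  rw [mass_eq, postWeight_eq, Real.exp_log (div_pos (hg.weight_pos hθ) hg.mass_pos)]

theorem IsLinear.measurable_postDensity (hl : IsLinear G φ) {Ω : Type*} [MeasurableSpace Ω]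
    {V : Ω → Param H d → Fin H → X → ℝ}
    (hV : ∀ h, Measurable fun y : (Ω × Param H d) × X => V y.1.1 y.1.2 h y.2) (η c : ℝ) :
    Measurable fun z : (Ω × (Fin t → Traj H X A B)) × Param H d =>
      postDensity G φ (V z.1.1) η c z.1.2 z.2 :=
  ((hl.measurable_postWeight hV η c).div
    ((hl.measurable_postMass hV η c).comp measurable_fst)).ennreal_ofReal

/-- The loss allowance `∑ₕ sup ηDₕ` for parameters with Bellman residuals of at most `2ε`. -/
noncomputable def slack (H t : ℕ) (η ε : ℝ) : ℝ :=
  H * (η * (t * (2 * ε * (3 * H))))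

/-- A lower estimate for the log-mass deficit of the posterior relative to a reference
parameter. -/
noncomputable def massGap (G : Game H X A B) (φ : Fin H → X × A × B → Vec d)
    (V : Param H d → Fin H → X → ℝ) (η c ε K : ℝ) (θ₀ : Param H d)
    (S : Fin t → Traj H X A B) : ℝ :=
  c * V θ₀ 0 G.x₁ - |c| * ε - slack H t η ε - K -
    Real.log (∫ θ, postWeight G φ V η c S θ ∂(Measure.pi (prior φ)))

theorem resid_le_of_mem_smallSet {V : Fin H → X → ℝ} {ε : ℝ} {h : Fin H} {θ : Param H d}
    (hθ : θ h ∈ smallSet G φ V ε h) (z : X × A × B) : |resid G (linFun φ θ) V h z| ≤ ε := by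
  have := hθ.2 z
  unfold resid linFun
  rwa [sub_sub]

/-- Optimism: up to complexity terms, a posterior sample trades its loss and its log-density against
its value. -/
theorem IsLinear.optimism_le (hl : IsLinear G φ) {V : Param H d → Fin H → X → ℝ}
    (hV : ValueFamily φ V) {η : ℝ} (hη : 0 ≤ η) (c : ℝ) (S : Fin t → Traj H X A B) {ε K : ℝ}
    (hε : 0 ≤ ε) {θ : Param H d} (hθ : θ ∈ classSet φ)
    (hK : Real.exp (-K) ≤ ∏ h, (prior φ h).real (smallSet G φ (V θ) ε h))
    (hpos : ∀ h, 0 < (prior φ h).real (smallSet G φ (V θ) ε h)) (θ₀ : Param H d) :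
    c * (V θ₀ 0 G.x₁ - V θ 0 G.x₁) + η * ∑ h, cumExcess G (linFun φ θ) (V θ) h S +
      logDensity G φ V η c S θ ≤
      2 * K + 2 * slack H t η ε + |c| * ε + massGap G φ V η c ε K θ₀ S := by
  have := hl.isProbabilityMeasure_prior
  have hg := hl.gibbsBounded hV hη c S
  have h1 := hg.log_density hθ
  -- Residuals here are at most `ε`; the allowance for `2 ε` is taken so that the loss terms share
  -- one `slack` with the mass bound.
  have h2 := hg.neg_sum_log_partitionFun_le hθ (S := fun h => smallSet G φ (V θ) ε h)
    (fun h => measurableSet_smallSet _ _ _) (b := η * (t * (2 * ε * (3 * H)))) ?_ hpos hK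
  · rw [Fintype.card_fin] at h2
    have e : ∑ h, postLoss G φ V η S h (θ h) θ = η * ∑ h, cumExcess G (linFun φ θ) (V θ) h S := by
      rw [Finset.mul_sum]; rfl
    unfold logDensity massGap slack
    rw [mass_eq, postWeight_eq, h1, e]
    linarith
  · intro h w hw
    unfold postLoss
    refine mul_le_mul_of_nonneg_left ((le_abs_self _).trans ?_) hη
    refine abs_cumExcess_le (θ := fun _ => w) hw.1 (hV.mem_Icc θ hθ) (fun z => ?_) S
    exact (resid_le_of_mem_smallSet (θ := fun _ => w) hw z).trans (by linarith)

theorem nextMean_le_add {V W : Fin H → X → ℝ} (hV : ∀ h, Measurable (V h))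
    (hW : ∀ h, Measurable (W h)) {R : ℝ} (hVR : ∀ h x, |V h x| ≤ R) (hWR : ∀ h x, |W h x| ≤ R)
    {ε : ℝ} (hε : 0 ≤ ε) (hle : ∀ h x, V h x ≤ W h x + ε) (h : Fin H) (z : X × A × B) :
    nextMean G.P V h z ≤ nextMean G.P W h z + ε := by
  have := G.markov h
  unfold nextMean
  split_ifs with hh
  · have hi : ∀ {U : Fin H → X → ℝ}, (∀ h, Measurable (U h)) → (∀ h x, |U h x| ≤ R) →
        Integrable (U ⟨h + 1, hh⟩) (G.P h z) := fun hU hUR =>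
      .of_bound (hU _).aestronglyMeasurable R
        (.of_forall fun x => (Real.norm_eq_abs _).trans_le (hUR _ x))
    refine (integral_mono (hi hV hVR) ((hi hW hWR).add (integrable_const ε))
      fun x => hle _ x).trans ?_
    rw [integral_add' (hi hW hWR) (integrable_const ε)]
    simp
  · linarith

/-- As `θ₀` solves its equation, a parameter in the small sets around it has functions within `ε` of
those of `θ₀`. Its values are then also within `ε`, and its residuals against its own values are at
most `2 ε`. The reverse Markov bound applies, and its right side averages over laws that do not
involve the data. -/
theorem IsLinear.exp_massGap_le (hl : IsLinear G φ) {V : Param H d → Fin H → X → ℝ}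
    (hV : ValueFamily φ V) {η : ℝ} (hη : 0 ≤ η) (c : ℝ) (S : Fin t → Traj H X A B) {ε K : ℝ}
    (hε : 0 ≤ ε) {θ₀ : Param H d} (hθ₀ : θ₀ ∈ classSet φ)
    (hfix : ∀ h z, linFun φ θ₀ h z = G.r h z + nextMean G.P (V θ₀) h z)
    (hK : Real.exp (-K) ≤ ∏ h, (prior φ h).real (smallSet G φ (V θ₀) ε h)) :
    ENNReal.ofReal (Real.exp (4 * massGap G φ V η c ε K θ₀ S)) ≤
      ∫⁻ θ, ∫⁻ w, ENNReal.ofReal (Real.exp (-(4 * η) *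
        ∑ h, cumExcess G (linFun φ w) (V θ) h S)) ∂(Measure.pi (prior φ))
          ∂(cond (Measure.pi (prior φ)) (Set.univ.pi fun h => smallSet G φ (V θ₀) ε h)) := by
  have := hl.isProbabilityMeasure_prior
  have hg := hl.gibbsBounded hV hη c S
  have hm : ∀ θ h, Measurable (V θ h) := fun θ h => (hV.measurable h).comp measurable_prodMk_left
  have hclose : ∀ θ : Param H d, (∀ h, θ h ∈ smallSet G φ (V θ₀) ε h) → ∀ h z,
      |linFun φ θ h z - linFun φ θ₀ h z| ≤ ε := by
    intro θ hθ h z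
    rw [hfix]
    exact (hθ h).2 z
  have hVle : ∀ θ : Param H d, (∀ h, θ h ∈ smallSet G φ (V θ₀) ε h) → ∀ h x,
      V θ h x ≤ V θ₀ h x + ε := fun θ hθ h x => hV.le_add θ θ₀ h ε (hclose θ hθ h) x
  have hVge : ∀ θ : Param H d, (∀ h, θ h ∈ smallSet G φ (V θ₀) ε h) → ∀ h x,
      V θ₀ h x ≤ V θ h x + ε := fun θ hθ h x => hV.le_add θ₀ θ h ε
    (fun z => by rw [abs_sub_comm]; exact hclose θ hθ h z) x
  have key := hg.exp_four_mul_le (S := fun h => smallSet G φ (V θ₀) ε h)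
    (fun h => measurableSet_smallSet _ _ _) (fun h w hw => hw.1)
    (b := η * (t * (2 * ε * (3 * H)))) (δ := |c| * ε) (F₀ := c * V θ₀ 0 G.x₁) ?_ ?_ hK
  · have e : ∀ θ w : Param H d, -(4 * ∑ h, postLoss G φ V η S h (w h) θ) =
        -(4 * η) * ∑ h, cumExcess G (linFun φ w) (V θ) h S := by
      intro θ w
      have : ∑ h, postLoss G φ V η S h (w h) θ =
          η * ∑ h, cumExcess G (linFun φ w) (V θ) h S := by
        rw [Finset.mul_sum]; rfl
      rw [this]; ring
    simp only [e] at key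
    refine le_trans (le_of_eq ?_) key
    unfold massGap slack
    rw [mass_eq, Fintype.card_fin]
  · intro θ hθ h
    have hθc : θ ∈ classSet φ := fun h => (hθ h).1
    refine mul_le_mul_of_nonneg_left ((le_abs_self _).trans ?_) hη
    refine abs_cumExcess_le (θ := θ) (hθ h).1 (hV.mem_Icc θ hθc) (fun z => ?_) S
    have h1 := abs_le.1 (resid_le_of_mem_smallSet (hθ h) z)
    have h2 := nextMean_le_add (G := G) (hm θ) (hm θ₀) (abs_le_horizon (hV.mem_Icc θ hθc))
      (abs_le_horizon (hV.mem_Icc θ₀ hθ₀)) hε (hVle θ hθ) h z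
    have h3 := nextMean_le_add (G := G) (hm θ₀) (hm θ) (abs_le_horizon (hV.mem_Icc θ₀ hθ₀))
      (abs_le_horizon (hV.mem_Icc θ hθc)) hε (hVge θ hθ) h z
    unfold resid at h1 ⊢
    exact abs_le.2 ⟨by linarith [h1.1], by linarith [h1.2]⟩
  · intro θ hθ
    have h1 := hVle θ hθ 0 G.x₁
    have h2 := hVge θ hθ 0 G.x₁
    have h3 : |c * (V θ₀ 0 G.x₁ - V θ 0 G.x₁)| ≤ |c| * ε := by
      rw [abs_mul]
      exact mul_le_mul_of_nonneg_left (abs_le.2 ⟨by linarith, by linarith⟩) (abs_nonneg c)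
    have := (abs_le.1 h3).2
    rw [mul_sub] at this
    linarith

end Posterior

/-! ### The law of the algorithm and the supermartingale of excess losses. -/

section RunLaw

variable {H d : ℕ} {X A B : Type*} [MeasurableSpace X] [MeasurableSpace A] [MeasurableSpace B]
  [Fintype A] [Fintype B] [Nonempty A] [Nonempty B] [DiscreteMeasurableSpace A]
  [DiscreteMeasurableSpace B] [NeZero H] {G : Game H X A B} {φ : Fin H → X × A × B → Vec d}
  {πA : Fin H → Kernel (Vec d × X) A} {πB : Fin H → Kernel ((Vec d × Vec d) × X) B} {t : ℕ}
  {η lam : ℝ}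

theorem IsLinear.measurable_mainDensity (hl : IsLinear G φ) :
    Measurable fun z : (Fin t → Traj H X A B) × Param H d =>
      postDensity G φ (mainVal φ) η lam z.1 z.2 := by
  have h1 := hl.measurable_postDensity (t := t) (Ω := Unit) (V := fun _ => mainVal φ) (fun h => by
    have h2 : Measurable fun y : (Unit × Param H d) × X => (y.1.2, y.2) := by fun_prop
    have h3 := (measurable_mainVal hl.measurable_feature h).comp h2
    exact h3) η lam
  have h3 : Measurable fun z : (Fin t → Traj H X A B) × Param H d => (((), z.1), z.2) := by
    fun_prop
  have h4 := h1.comp h3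
  exact h4

theorem IsLinear.measurable_boosterDensity (hl : IsLinear G φ) :
    Measurable fun z : ((Fin t → Traj H X A B) × Param H d) × Param H d =>
      postDensity G φ (boostVal φ πA z.1.2) η (-lam) z.1.1 z.2 := by
  have h1 := hl.measurable_postDensity (t := t) (Ω := Param H d) (V := boostVal φ πA)
    (measurable_boostVal hl.measurable_feature πA) η (-lam)
  have h3 : Measurable fun z : ((Fin t → Traj H X A B) × Param H d) × Param H d =>
    ((z.1.2, z.1.1), z.2) := by fun_prop
  have h4 := h1.comp h3
  exact h4

theorem IsLinear.lintegral_mainPosterior (hl : IsLinear G φ) (S : Fin t → Traj H X A B)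
    {f : Param H d → ENNReal} (hf : Measurable f) :
    ∫⁻ θ, f θ ∂(mainPosterior G φ η lam t S) =
      ∫⁻ θ, postDensity G φ (mainVal φ) η lam S θ * f θ ∂(Measure.pi (prior φ)) := by
  unfold mainPosterior
  exact Kernel.lintegral_withDensity _ hl.measurable_mainDensity S hf

theorem IsLinear.lintegral_boosterPosterior (hl : IsLinear G φ)
    (y : (Fin t → Traj H X A B) × Param H d) {f : Param H d → ENNReal} (hf : Measurable f) :
    ∫⁻ ϑ, f ϑ ∂(boosterPosterior G φ πA η lam t y) =
      ∫⁻ ϑ, postDensity G φ (boostVal φ πA y.2) η (-lam) y.1 ϑ * f ϑ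
        ∂(Measure.pi (prior φ)) := by
  unfold boosterPosterior
  exact Kernel.lintegral_withDensity _ hl.measurable_boosterDensity y hf

theorem IsLinear.isMarkovKernel_mainPosterior (hl : IsLinear G φ) (hη : 0 ≤ η) :
    IsMarkovKernel (mainPosterior G φ η lam t) := by
  refine ⟨fun S => ⟨?_⟩⟩
  have := hl.lintegral_mainPosterior (η := η) (lam := lam) S (f := fun _ => 1) measurable_const
  simp only [lintegral_one, mul_one] at this
  rw [this]
  exact hl.lintegral_postDensity (valueFamily_mainVal hl.measurable_feature) hη lam S

theorem IsLinear.isMarkovKernel_boosterPosterior (hl : IsLinear G φ)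
    (hA : ∀ h, IsMarkovKernel (πA h)) (hη : 0 ≤ η) :
    IsMarkovKernel (boosterPosterior G φ πA η lam t) := by
  refine ⟨fun y => ⟨?_⟩⟩
  have := hl.lintegral_boosterPosterior (πA := πA) (η := η) (lam := lam) y (f := fun _ => 1)
    measurable_const
  simp only [lintegral_one, mul_one] at this
  rw [this]
  exact hl.lintegral_postDensity (valueFamily_boostVal hl.measurable_feature hA y.2) hη (-lam) y.1

theorem IsLinear.isMarkovKernel_stage (hl : IsLinear G φ) (hA : ∀ h, IsMarkovKernel (πA h))
    (hB : ∀ h, IsMarkovKernel (πB h)) (hη : 0 ≤ η) :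
    IsMarkovKernel (stage G φ πA πB η lam t) := by
  have := hl.isMarkovKernel_mainPosterior (lam := lam) (t := t) hη
  have := hl.isMarkovKernel_boosterPosterior (lam := lam) (t := t) hA hη
  have := isMarkovKernel_episode (G := G) (d := d) hA hB
  unfold stage
  infer_instance

theorem IsLinear.lintegral_stage (hl : IsLinear G φ) (hA : ∀ h, IsMarkovKernel (πA h))
    (hB : ∀ h, IsMarkovKernel (πB h)) (hη : 0 ≤ η) (S : Fin t → Traj H X A B)
    {f : Rec H d X A B → ENNReal} (hf : Measurable f) :
    ∫⁻ ρ, f ρ ∂(stage G φ πA πB η lam t S) =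
      ∫⁻ θ, ∫⁻ ϑ, ∫⁻ ζ, f (θ, ϑ, ζ) ∂(episode G πA πB (θ, ϑ))
        ∂(boosterPosterior G φ πA η lam t (S, θ)) ∂(mainPosterior G φ η lam t S) := by
  have := hl.isMarkovKernel_mainPosterior (lam := lam) (t := t) hη
  have := hl.isMarkovKernel_boosterPosterior (lam := lam) (t := t) hA hη
  have := isMarkovKernel_episode (G := G) (d := d) hA hB
  unfold stage
  rw [Kernel.lintegral_compProd _ _ _ hf]
  refine lintegral_congr fun θ => ?_
  exact Kernel.lintegral_compProd _ _ _ (hf.comp measurable_prodMk_left)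

/-- The observed trajectories. -/
def trajs (ω : Fin t → Rec H d X A B) : Fin t → Traj H X A B := fun s => (ω s).2.2

theorem measurable_trajs : Measurable (trajs : (Fin t → Rec H d X A B) → _) := by
  unfold trajs
  fun_prop

/-- The joint law of the first `t` records and the next one. -/
noncomputable def nextLaw (G : Game H X A B)
    (φ : Fin H → X × A × B → Vec d) (πA : Fin H → Kernel (Vec d × X) A)
    (πB : Fin H → Kernel ((Vec d × Vec d) × X) B) (η lam : ℝ) (t : ℕ) :
    Measure ((Fin t → Rec H d X A B) × Rec H d X A B) :=
  runLaw G φ πA πB η lam t ⊗ₘ (stage G φ πA πB η lam t).comap trajs measurable_trajs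

theorem runLaw_succ (G : Game H X A B) (φ : Fin H → X × A × B → Vec d)
    (πA : Fin H → Kernel (Vec d × X) A) (πB : Fin H → Kernel ((Vec d × Vec d) × X) B)
    (η lam : ℝ) (t : ℕ) : runLaw G φ πA πB η lam (t + 1) = (nextLaw G φ πA πB η lam t).map
      (fun y => (Fin.snoc y.1 y.2 : Fin (t + 1) → Rec H d X A B)) := rfl

theorem measurable_snoc {Z : Type*} [MeasurableSpace Z] :
    Measurable fun y : (Fin t → Z) × Z => (Fin.snoc y.1 y.2 : Fin (t + 1) → Z) :=
  measurable_finSnoc measurable_snd measurable_fst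

theorem IsLinear.isProbabilityMeasure_runLaw (hl : IsLinear G φ) (hA : ∀ h, IsMarkovKernel (πA h))
    (hB : ∀ h, IsMarkovKernel (πB h)) (hη : 0 ≤ η) :
    ∀ t, IsProbabilityMeasure (runLaw G φ πA πB η lam t)
  | 0 => by unfold runLaw; infer_instance
  | t + 1 => by
    have := hl.isProbabilityMeasure_runLaw hA hB hη t
    have := hl.isMarkovKernel_stage (lam := lam) (t := t) hA hB hη
    rw [runLaw_succ]
    unfold nextLaw
    exact Measure.isProbabilityMeasure_map measurable_snoc.aemeasurable

theorem IsLinear.isProbabilityMeasure_nextLaw (hl : IsLinear G φ)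
    (hA : ∀ h, IsMarkovKernel (πA h)) (hB : ∀ h, IsMarkovKernel (πB h)) (hη : 0 ≤ η) :
    IsProbabilityMeasure (nextLaw G φ πA πB η lam t) := by
  have := hl.isProbabilityMeasure_runLaw (lam := lam) hA hB hη t
  have := hl.isMarkovKernel_stage (lam := lam) (t := t) hA hB hη
  unfold nextLaw
  infer_instance

theorem IsLinear.lintegral_nextLaw (hl : IsLinear G φ)
    (hA : ∀ h, IsMarkovKernel (πA h)) (hB : ∀ h, IsMarkovKernel (πB h)) (hη : 0 ≤ η)
    {f : (Fin t → Rec H d X A B) × Rec H d X A B → ENNReal} (hf : Measurable f) :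
    ∫⁻ y, f y ∂(nextLaw G φ πA πB η lam t) =
      ∫⁻ ω, ∫⁻ θ, ∫⁻ ϑ, ∫⁻ ζ, f (ω, θ, ϑ, ζ) ∂(episode G πA πB (θ, ϑ))
        ∂(boosterPosterior G φ πA η lam t (trajs ω, θ)) ∂(mainPosterior G φ η lam t (trajs ω))
        ∂(runLaw G φ πA πB η lam t) := by
  have := hl.isProbabilityMeasure_runLaw (lam := lam) hA hB hη t
  have := hl.isMarkovKernel_stage (lam := lam) (t := t) hA hB hη
  unfold nextLaw
  rw [Measure.lintegral_compProd hf]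
  refine lintegral_congr fun ω => ?_
  rw [Kernel.comap_apply]
  exact hl.lintegral_stage hA hB hη (trajs ω) (hf.comp measurable_prodMk_left)

/-- The squared Bellman residuals summed over the observed trajectories. -/
noncomputable def cumResid (G : Game H X A B) (q : Fin H → X × A × B → ℝ) (V : Fin H → X → ℝ)
    (h : Fin H) (S : Fin t → Traj H X A B) : ℝ :=
  ∑ s, resid G q V h (S s h) ^ 2

theorem measurable_cumResid (G : Game H X A B) {Y : Type*} [MeasurableSpace Y]
    {q : Y → Fin H → X × A × B → ℝ} (hq : ∀ h, Measurable fun y : Y × (X × A × B) => q y.1 h y.2)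
    {V : Y → Fin H → X → ℝ} (hV : ∀ h, Measurable fun y : Y × X => V y.1 h y.2) (h : Fin H) :
    Measurable fun y : Y × (Fin t → Traj H X A B) => cumResid G (q y.1) (V y.1) h y.2 := by
  refine Finset.measurable_sum _ fun s _ => ?_
  have h1 : Measurable fun y : Y × (Fin t → Traj H X A B) => (y.1, y.2 s h) := by fun_prop
  exact ((measurable_resid G hq hV h).comp h1).pow_const 2

theorem measurable_cumResid_right (G : Game H X A B) {q : Fin H → X × A × B → ℝ}
    (hq : ∀ h, Measurable (q h)) {V : Fin H → X → ℝ} (hV : ∀ h, Measurable (V h)) (h : Fin H) :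
    Measurable fun S : Fin t → Traj H X A B => cumResid G q V h S :=
  Finset.measurable_sum _ fun s _ => ((((hq h).sub (G.measurable_r h)).sub
    (measurable_nextMean_right G hV h)).comp (by fun_prop :
      Measurable fun S : Fin t → Traj H X A B => S s h)).pow_const 2

theorem measurable_cumExcess_right (G : Game H X A B) {q : Fin H → X × A × B → ℝ}
    (hq : ∀ h, Measurable (q h)) {V : Fin H → X → ℝ} (hV : ∀ h, Measurable (V h)) (h : Fin H) :
    Measurable fun S : Fin t → Traj H X A B => cumExcess G q V h S := by
  have h1 := measurable_cumExcess (t := t) G (Y := Unit) (q := fun _ => q) (V := fun _ => V)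
    (fun h => (hq h).comp measurable_snd) (fun h => (hV h).comp measurable_snd) h
  have h2 : Measurable fun S : Fin t → Traj H X A B => ((), S) := measurable_prodMk_left
  have h3 := h1.comp h2
  exact h3

/-- The exponential supermartingale of the excess losses of a fixed predictor. -/
theorem IsLinear.lintegral_runLaw_exp_le (hl : IsLinear G φ) (hA : ∀ h, IsMarkovKernel (πA h))
    (hB : ∀ h, IsMarkovKernel (πB h)) (hη : 0 ≤ η) {q : Fin H → X × A × B → ℝ}
    (hq : ∀ h, Measurable (q h)) {V : Fin H → X → ℝ} (hV : ∀ h, Measurable (V h)) {R a : ℝ}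
    (hVR : ∀ h x, V h x ∈ Set.Icc 0 R) (ha : 0 ≤ a) (haR : a * R ^ 2 ≤ 1.6) : ∀ t,
    ∫⁻ ω, ENNReal.ofReal (Real.exp (-a * ∑ h, cumExcess G q V h (trajs ω) +
      0.2 * a * ∑ h, cumResid G q V h (trajs ω))) ∂(runLaw G φ πA πB η lam t) ≤ 1
  | 0 => by
    have := hl.isProbabilityMeasure_runLaw (lam := lam) hA hB hη 0
    simp [cumExcess, cumResid]
  | t + 1 => by
    have := hl.isProbabilityMeasure_runLaw (lam := lam) hA hB hη t
    have hM := hl.isMarkovKernel_mainPosterior (lam := lam) (t := t) hη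
    have hBm := hl.isMarkovKernel_boosterPosterior (lam := lam) (t := t) hA hη
    have ih := hl.lintegral_runLaw_exp_le hA hB hη hq hV hVR ha haR t
    have hmeas : ∀ n, Measurable fun ω : Fin n → Rec H d X A B => ENNReal.ofReal (Real.exp
        (-a * ∑ h, cumExcess G q V h (trajs ω) + 0.2 * a * ∑ h, cumResid G q V h (trajs ω))) := by
      intro n
      have h1 : Measurable fun S : Fin n → Traj H X A B => ∑ h, cumExcess G q V h S :=
        Finset.measurable_sum _ fun h _ => measurable_cumExcess_right G hq hV h
      have h2 : Measurable fun S : Fin n → Traj H X A B => ∑ h, cumResid G q V h S :=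
        Finset.measurable_sum _ fun h _ => measurable_cumResid_right G hq hV h
      exact ((((h1.comp measurable_trajs).const_mul (-a)).add
        ((h2.comp measurable_trajs).const_mul (0.2 * a))).exp).ennreal_ofReal
    rw [runLaw_succ, lintegral_map (hmeas (t + 1)) measurable_snoc]
    refine (hl.lintegral_nextLaw hA hB hη ((hmeas (t + 1)).comp measurable_snoc)).le.trans ?_
    refine le_trans (lintegral_mono fun ω => ?_) ih
    -- With `q` and `V` fixed in advance, a new episode contributes a factor that depends on its
    -- trajectory alone. Its mean is at most one for every pair of sampled parameters, so their
    -- posteriors play no role.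
    have hstep : ∀ (θ ϑ : Param H d) (ζ : Traj H X A B),
        ENNReal.ofReal (Real.exp (-a * ∑ h, cumExcess G q V h
          (trajs (Fin.snoc ω (θ, ϑ, ζ) : Fin (t + 1) → Rec H d X A B)) +
          0.2 * a * ∑ h, cumResid G q V h
            (trajs (Fin.snoc ω (θ, ϑ, ζ) : Fin (t + 1) → Rec H d X A B)))) =
        ENNReal.ofReal (Real.exp (-a * ∑ h, cumExcess G q V h (trajs ω) +
          0.2 * a * ∑ h, cumResid G q V h (trajs ω))) *
        ENNReal.ofReal (Real.exp (∑ h, (-a * excess G q V h ζ +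
          0.2 * a * resid G q V h (ζ h) ^ 2))) := by
      intro θ ϑ ζ
      rw [← ENNReal.ofReal_mul (Real.exp_pos _).le, ← Real.exp_add]
      congr 2
      simp only [cumExcess, cumResid, Fin.sum_univ_castSucc (n := t), trajs, Fin.snoc_castSucc,
        Fin.snoc_last, Finset.sum_add_distrib, ← Finset.mul_sum]
      ring
    simp only [Function.comp_apply, hstep]
    have hex : Measurable fun ζ : Traj H X A B => ENNReal.ofReal (Real.exp (∑ h,
        (-a * excess G q V h ζ + 0.2 * a * resid G q V h (ζ h) ^ 2))) := by
      have h1 : Measurable fun ζ : Traj H X A B => ∑ h,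
          (-a * excess G q V h ζ + 0.2 * a * resid G q V h (ζ h) ^ 2) := by
        refine Finset.measurable_sum _ fun h _ => ?_
        have e1 := measurable_cumExcess_right (t := 1) G hq hV h
        have e2 := measurable_cumResid_right (t := 1) G hq hV h
        have e3 : Measurable fun ζ : Traj H X A B => (fun _ : Fin 1 => ζ) := by fun_prop
        have e4 := e1.comp e3
        have e5 := e2.comp e3
        simp only [Function.comp_def, cumExcess, cumResid, Finset.univ_unique,
          Finset.sum_singleton] at e4 e5
        exact (e4.const_mul _).add (e5.const_mul _)
      exact h1.exp.ennreal_ofReal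
    simp only [lintegral_const_mul _ hex]
    have hep : ∀ θ ϑ : Param H d, ∫⁻ ζ, ENNReal.ofReal (Real.exp (∑ h,
        (-a * excess G q V h ζ + 0.2 * a * resid G q V h (ζ h) ^ 2)))
        ∂(episode G πA πB (θ, ϑ)) ≤ 1 := by
      intro θ ϑ
      unfold episode
      rw [Kernel.comap_apply]
      exact lintegral_rollout_exp_excess_le G (fun h => inferInstance) (fun h => inferInstance)
        hq hV hVR ha haR _
    refine (lintegral_mono fun θ => lintegral_mono fun ϑ =>
      mul_le_of_le_one_right' (hep θ ϑ)).trans ?_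
    simp

end RunLaw

/-! ### Change of measure from the two nested posteriors to independent priors. -/

section TwoLevel

theorem exp_weighted_le (p₁ p₂ p₃ p₄ p₅ p₆ : ℝ) :
    Real.exp (1 / 8 * (p₁ + p₂ + p₃ + p₄ + p₅) + 3 / 8 * p₆) ≤
      1 / 8 * Real.exp p₁ + 1 / 8 * Real.exp p₂ + 1 / 8 * Real.exp p₃ + 1 / 8 * Real.exp p₄ +
        1 / 8 * Real.exp p₅ + 3 / 8 * Real.exp p₆ := by
  set m := 1 / 8 * (p₁ + p₂ + p₃ + p₄ + p₅) + 3 / 8 * p₆ with hm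
  -- Tangent to `exp` at the weighted mean `m`; the weights `5 · 1/8 + 3/8` sum to one, so the
  -- linear terms cancel.
  have key : ∀ p, Real.exp m * (p - m + 1) ≤ Real.exp p := by
    intro p
    have h := mul_le_mul_of_nonneg_left (Real.add_one_le_exp (p - m)) (Real.exp_pos m).le
    rwa [← Real.exp_add, add_sub_cancel] at h
  have h1 := key p₁
  have h2 := key p₂
  have h3 := key p₃
  have h4 := key p₄
  have h5 := key p₅
  have h6 := key p₆
  have e : Real.exp m = 1 / 8 * (Real.exp m * (p₁ - m + 1) + Real.exp m * (p₂ - m + 1) +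
      Real.exp m * (p₃ - m + 1) + Real.exp m * (p₄ - m + 1) + Real.exp m * (p₅ - m + 1)) +
      3 / 8 * (Real.exp m * (p₆ - m + 1)) := by
    rw [hm]; ring
  rw [e]
  linarith

/-- `1 + f ≤ exp f`. -/
theorem integral_nonpos_of_lintegral_exp_le {Ω : Type*} [MeasurableSpace Ω] {μ : Measure Ω}
    [IsProbabilityMeasure μ] {f : Ω → ℝ} (hf : Integrable f μ)
    (h : ∫⁻ ω, ENNReal.ofReal (Real.exp (f ω)) ∂μ ≤ 1) : ∫ ω, f ω ∂μ ≤ 0 := by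
  have hm : AEStronglyMeasurable (fun ω => Real.exp (f ω)) μ :=
    Real.continuous_exp.comp_aestronglyMeasurable hf.aestronglyMeasurable
  have hi : Integrable (fun ω => Real.exp (f ω)) μ := by
    refine ⟨hm, ?_⟩
    rw [hasFiniteIntegral_iff_ofReal (.of_forall fun ω => (Real.exp_pos _).le)]
    exact h.trans_lt ENNReal.one_lt_top
  have h1 : ∫ ω, Real.exp (f ω) ∂μ ≤ 1 := by
    rw [integral_eq_lintegral_of_nonneg_ae (.of_forall fun ω => (Real.exp_pos _).le) hm]
    exact ENNReal.toReal_le_of_le_ofReal zero_le_one (by simpa using h)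
  have h2 : ∫ ω, (f ω + 1) ∂μ ≤ ∫ ω, Real.exp (f ω) ∂μ :=
    integral_mono (hf.add (integrable_const 1)) hi fun ω => Real.add_one_le_exp _
  rw [integral_add hf (integrable_const 1)] at h2
  simp only [integral_const, probReal_univ, smul_eq_mul, mul_one] at h2
  linarith

/-- After this rewriting the data and the two parameters are independent, and their dependence sits
in the two densities. Expectations over the data can then be taken with the parameters held fixed.
-/
theorem lintegral_density_density {Ω Θ : Type*} [MeasurableSpace Ω] [MeasurableSpace Θ]
    {ρ : Measure Ω} [SFinite ρ] {π : Measure Θ} [SFinite π] {κ : Ω → Measure Θ}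
    {κ' : Ω → Θ → Measure Θ} {a : Ω → Θ → ENNReal} {b : Ω → Θ → Θ → ENNReal}
    {f : Ω × Θ × Θ → ENNReal} (ha : Measurable fun z : Ω × Θ × Θ => a z.1 z.2.1)
    (hb : Measurable fun z : Ω × Θ × Θ => b z.1 z.2.1 z.2.2) (hf : Measurable f)
    (hκ : ∀ ω (g : Θ → ENNReal), Measurable g → ∫⁻ θ, g θ ∂(κ ω) = ∫⁻ θ, a ω θ * g θ ∂π)
    (hκ' : ∀ ω θ (g : Θ → ENNReal), Measurable g →
      ∫⁻ ϑ, g ϑ ∂(κ' ω θ) = ∫⁻ ϑ, b ω θ ϑ * g ϑ ∂π) :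
    ∫⁻ ω, ∫⁻ θ, ∫⁻ ϑ, f (ω, θ, ϑ) ∂(κ' ω θ) ∂(κ ω) ∂ρ =
      ∫⁻ z, a z.1 z.2.1 * (b z.1 z.2.1 z.2.2 * f z) ∂(ρ.prod (π.prod π)) := by
  have hm : Measurable fun z : Ω × Θ × Θ => a z.1 z.2.1 * (b z.1 z.2.1 z.2.2 * f z) :=
    ha.mul (hb.mul hf)
  rw [lintegral_prod _ hm.aemeasurable]
  refine lintegral_congr fun ω => ?_
  have hmω : Measurable fun y : Θ × Θ => a ω y.1 * (b ω y.1 y.2 * f (ω, y)) :=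
    hm.comp measurable_prodMk_left
  rw [lintegral_prod _ hmω.aemeasurable]
  have hbfω : Measurable fun y : Θ × Θ => b ω y.1 y.2 * f (ω, y) :=
    (hb.mul hf).comp measurable_prodMk_left
  have e : ∀ θ, ∫⁻ ϑ, f (ω, θ, ϑ) ∂(κ' ω θ) = ∫⁻ ϑ, b ω θ ϑ * f (ω, θ, ϑ) ∂π := fun θ =>
    hκ' ω θ _ (hf.comp (by fun_prop : Measurable fun ϑ : Θ => (ω, θ, ϑ)))
  simp only [e]
  rw [hκ ω _ hbfω.lintegral_prod_right']
  refine lintegral_congr fun θ => ?_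
  exact (lintegral_const_mul _ (hbfω.comp measurable_prodMk_left)).symm

theorem lintegral_mul_density {Ω Θ : Type*} [MeasurableSpace Ω] [MeasurableSpace Θ]
    {ρ : Measure Ω} [SFinite ρ] {π : Measure Θ} [SFinite π] {b : Ω → Θ → Θ → ENNReal}
    {f : Ω × Θ → ENNReal} (hb : Measurable fun z : Ω × Θ × Θ => b z.1 z.2.1 z.2.2)
    (hf : Measurable f) (hb1 : ∀ ω θ, ∫⁻ ϑ, b ω θ ϑ ∂π = 1) :
    ∫⁻ z, f (z.1, z.2.1) * b z.1 z.2.1 z.2.2 ∂(ρ.prod (π.prod π)) =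
      ∫⁻ ω, ∫⁻ θ, f (ω, θ) ∂π ∂ρ := by
  have hm : Measurable fun z : Ω × Θ × Θ => f (z.1, z.2.1) * b z.1 z.2.1 z.2.2 :=
    (hf.comp (by fun_prop : Measurable fun z : Ω × Θ × Θ => (z.1, z.2.1))).mul hb
  rw [lintegral_prod _ hm.aemeasurable]
  refine lintegral_congr fun ω => ?_
  have hmω : Measurable fun y : Θ × Θ => f (ω, y.1) * b ω y.1 y.2 := hm.comp measurable_prodMk_left
  rw [lintegral_prod _ hmω.aemeasurable]
  refine lintegral_congr fun θ => ?_
  have hs : Measurable fun ϑ => b ω θ ϑ :=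
    hb.comp (by fun_prop : Measurable fun ϑ : Θ => (ω, θ, ϑ))
  dsimp only
  rw [lintegral_const_mul _ hs, hb1, mul_one]

variable {H d : ℕ} {X A B : Type*} [MeasurableSpace X] [MeasurableSpace A] [MeasurableSpace B]
  [Fintype A] [Fintype B] [Nonempty A] [Nonempty B] [DiscreteMeasurableSpace A]
  [DiscreteMeasurableSpace B] [NeZero H] {G : Game H X A B} {φ : Fin H → X × A × B → Vec d}
  {πA : Fin H → Kernel (Vec d × X) A} {πB : Fin H → Kernel ((Vec d × Vec d) × X) B} {t : ℕ}
  {η lam : ℝ}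

/-- Reference measure for the records so far and the two parameters sampled next. -/
noncomputable def refLaw (G : Game H X A B) (φ : Fin H → X × A × B → Vec d)
    (πA : Fin H → Kernel (Vec d × X) A) (πB : Fin H → Kernel ((Vec d × Vec d) × X) B)
    (η lam : ℝ) (t : ℕ) : Measure ((Fin t → Rec H d X A B) × Param H d × Param H d) :=
  (runLaw G φ πA πB η lam t).prod ((Measure.pi (prior φ)).prod (Measure.pi (prior φ)))

theorem IsLinear.ae_pi_prior_mem (hl : IsLinear G φ) :
    ∀ᵐ θ ∂(Measure.pi (prior φ)), θ ∈ classSet φ := by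
  have := hl.isProbabilityMeasure_prior
  exact ae_all_iff.2 fun h => (Measure.quasiMeasurePreserving_eval (prior φ) h).ae ae_prior_mem

theorem IsLinear.ae_refLaw_mem (hl : IsLinear G φ) (hA : ∀ h, IsMarkovKernel (πA h))
    (hB : ∀ h, IsMarkovKernel (πB h)) (hη : 0 ≤ η) :
    ∀ᵐ z ∂(refLaw G φ πA πB η lam t), z.2.1 ∈ classSet φ ∧ z.2.2 ∈ classSet φ := by
  have := hl.isProbabilityMeasure_prior
  have := hl.isProbabilityMeasure_runLaw (lam := lam) hA hB hη t
  have h1 : ∀ᵐ z ∂((Measure.pi (prior φ)).prod (Measure.pi (prior φ))),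
      z.1 ∈ classSet φ ∧ z.2 ∈ classSet φ :=
    (Measure.quasiMeasurePreserving_fst.ae hl.ae_pi_prior_mem).and
      (Measure.quasiMeasurePreserving_snd.ae hl.ae_pi_prior_mem)
  exact Measure.quasiMeasurePreserving_snd.ae h1

theorem IsLinear.lintegral_refLaw (hl : IsLinear G φ) (hA : ∀ h, IsMarkovKernel (πA h))
    (hB : ∀ h, IsMarkovKernel (πB h)) (hη : 0 ≤ η)
    {f : (Fin t → Rec H d X A B) × Param H d × Param H d → ENNReal} (hf : Measurable f) :
    ∫⁻ z, f z ∂(refLaw G φ πA πB η lam t) =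
      ∫⁻ ω, ∫⁻ θ, ∫⁻ ϑ, f (ω, θ, ϑ) ∂(Measure.pi (prior φ)) ∂(Measure.pi (prior φ))
        ∂(runLaw G φ πA πB η lam t) := by
  have := hl.isProbabilityMeasure_prior
  have := hl.isProbabilityMeasure_runLaw (lam := lam) hA hB hη t
  unfold refLaw
  rw [lintegral_prod _ hf.aemeasurable]
  refine lintegral_congr fun ω => ?_
  exact lintegral_prod _ (hf.comp measurable_prodMk_left).aemeasurable

theorem IsLinear.lintegral_refLaw_symm (hl : IsLinear G φ) (hA : ∀ h, IsMarkovKernel (πA h))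
    (hB : ∀ h, IsMarkovKernel (πB h)) (hη : 0 ≤ η)
    {f : (Fin t → Rec H d X A B) × Param H d × Param H d → ENNReal} (hf : Measurable f) :
    ∫⁻ z, f z ∂(refLaw G φ πA πB η lam t) =
      ∫⁻ y, ∫⁻ ω, f (ω, y) ∂(runLaw G φ πA πB η lam t)
        ∂((Measure.pi (prior φ)).prod (Measure.pi (prior φ))) := by
  have := hl.isProbabilityMeasure_prior
  have := hl.isProbabilityMeasure_runLaw (lam := lam) hA hB hη t
  unfold refLaw
  exact lintegral_prod_symm _ hf.aemeasurable

theorem IsLinear.measurable_mainDensity_trajs (hl : IsLinear G φ) :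
    Measurable fun z : (Fin t → Rec H d X A B) × Param H d × Param H d =>
      postDensity G φ (mainVal φ) η lam (trajs z.1) z.2.1 := by
  have h1 : Measurable fun z : (Fin t → Rec H d X A B) × Param H d × Param H d =>
    (trajs z.1, z.2.1) := (measurable_trajs.comp measurable_fst).prodMk (by fun_prop)
  have h2 := (hl.measurable_mainDensity (η := η) (lam := lam)).comp h1
  exact h2

theorem IsLinear.measurable_boosterDensity_trajs (hl : IsLinear G φ) :
    Measurable fun z : (Fin t → Rec H d X A B) × Param H d × Param H d =>
      postDensity G φ (boostVal φ πA z.2.1) η (-lam) (trajs z.1) z.2.2 := by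
  have h1 : Measurable fun z : (Fin t → Rec H d X A B) × Param H d × Param H d =>
    ((trajs z.1, z.2.1), z.2.2) :=
    ((measurable_trajs.comp measurable_fst).prodMk (by fun_prop)).prodMk (by fun_prop)
  have h2 := (hl.measurable_boosterDensity (πA := πA) (η := η) (lam := lam)).comp h1
  exact h2

theorem IsLinear.lintegral_nextLaw_eq (hl : IsLinear G φ) (hA : ∀ h, IsMarkovKernel (πA h))
    (hB : ∀ h, IsMarkovKernel (πB h)) (hη : 0 ≤ η)
    {f : (Fin t → Rec H d X A B) × Param H d × Param H d → ENNReal} (hf : Measurable f) :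
    ∫⁻ y, f (y.1, y.2.1, y.2.2.1) ∂(nextLaw G φ πA πB η lam t) =
      ∫⁻ z, postDensity G φ (mainVal φ) η lam (trajs z.1) z.2.1 *
        (postDensity G φ (boostVal φ πA z.2.1) η (-lam) (trajs z.1) z.2.2 * f z)
        ∂(refLaw G φ πA πB η lam t) := by
  have := hl.isProbabilityMeasure_prior
  have := hl.isProbabilityMeasure_runLaw (lam := lam) hA hB hη t
  have := isMarkovKernel_episode (G := G) (d := d) hA hB
  have h0 : Measurable fun y : (Fin t → Rec H d X A B) × Rec H d X A B =>
    (y.1, y.2.1, y.2.2.1) := by fun_prop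
  refine (hl.lintegral_nextLaw hA hB hη (hf.comp h0)).trans ?_
  simp only [Function.comp_apply, lintegral_const, measure_univ, mul_one]
  exact lintegral_density_density
    (a := fun ω θ => postDensity G φ (mainVal φ) η lam (trajs ω) θ)
    (b := fun ω θ ϑ => postDensity G φ (boostVal φ πA θ) η (-lam) (trajs ω) ϑ)
    (κ := fun ω => mainPosterior G φ η lam t (trajs ω))
    (κ' := fun ω θ => boosterPosterior G φ πA η lam t (trajs ω, θ))
    hl.measurable_mainDensity_trajs hl.measurable_boosterDensity_trajs hf
    (fun ω g hg => hl.lintegral_mainPosterior (trajs ω) hg)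
    (fun ω θ g hg => hl.lintegral_boosterPosterior (trajs ω, θ) hg)

theorem IsLinear.lintegral_mainDensity_trajs (hl : IsLinear G φ) (hη : 0 ≤ η)
    (S : Fin t → Traj H X A B) :
    ∫⁻ θ, postDensity G φ (mainVal φ) η lam S θ ∂(Measure.pi (prior φ)) = 1 :=
  hl.lintegral_postDensity (valueFamily_mainVal hl.measurable_feature) hη lam S

theorem IsLinear.lintegral_boosterDensity_trajs (hl : IsLinear G φ)
    (hA : ∀ h, IsMarkovKernel (πA h)) (hη : 0 ≤ η) (θ : Param H d) (S : Fin t → Traj H X A B) :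
    ∫⁻ ϑ, postDensity G φ (boostVal φ πA θ) η (-lam) S ϑ ∂(Measure.pi (prior φ)) = 1 :=
  hl.lintegral_postDensity (valueFamily_boostVal hl.measurable_feature hA θ) hη (-lam) S

/-- Integrating out the booster's density. -/
theorem IsLinear.lintegral_mul_boosterDensity (hl : IsLinear G φ)
    (hA : ∀ h, IsMarkovKernel (πA h)) (hB : ∀ h, IsMarkovKernel (πB h)) (hη : 0 ≤ η)
    {f : (Fin t → Rec H d X A B) × Param H d → ENNReal} (hf : Measurable f) :
    ∫⁻ z, f (z.1, z.2.1) * postDensity G φ (boostVal φ πA z.2.1) η (-lam) (trajs z.1) z.2.2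
      ∂(refLaw G φ πA πB η lam t) =
      ∫⁻ ω, ∫⁻ θ, f (ω, θ) ∂(Measure.pi (prior φ)) ∂(runLaw G φ πA πB η lam t) := by
  have := hl.isProbabilityMeasure_prior
  have := hl.isProbabilityMeasure_runLaw (lam := lam) hA hB hη t
  exact lintegral_mul_density
    (b := fun ω θ ϑ => postDensity G φ (boostVal φ πA θ) η (-lam) (trajs ω) ϑ)
    hl.measurable_boosterDensity_trajs hf
    fun ω θ => hl.lintegral_boosterDensity_trajs hA hη θ (trajs ω)

/-- The two agents' value gaps and accumulated squared Bellman residuals. -/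
noncomputable def gain (G : Game H X A B) (φ : Fin H → X × A × B → Vec d)
    (πA : Fin H → Kernel (Vec d × X) A) (η lam : ℝ) (θ₀ : Param H d) (g₀ : Param H d → Param H d)
    (S : Fin t → Traj H X A B) (θ ϑ : Param H d) : ℝ :=
  lam * (mainVal φ θ₀ 0 G.x₁ - mainVal φ θ 0 G.x₁) +
    lam * (boostVal φ πA θ ϑ 0 G.x₁ - boostVal φ πA θ (g₀ θ) 0 G.x₁) +
    0.2 * η * (∑ h, cumResid G (linFun φ θ) (mainVal φ θ) h S +
      ∑ h, cumResid G (linFun φ ϑ) (boostVal φ πA θ ϑ) h S)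

section Measurability

variable {Y : Type*} [MeasurableSpace Y] {f g : Y → Param H d} {S : Y → Fin t → Traj H X A B}

theorem measurable_mainVal_comp (hφ : ∀ h, Measurable (φ h)) {x : Y → X} (hf : Measurable f)
    (hx : Measurable x) (h : Fin H) : Measurable fun y => mainVal φ (f y) h (x y) := by
  have h1 : Measurable fun y => (f y h, x y) := by fun_prop
  exact measurable_gameValue (M := fun y => qmat φ h (f y h) (x y))
    fun a b => (measurable_qmat hφ h a b).comp h1

theorem measurable_linFun_comp (hφ : ∀ h, Measurable (φ h)) {z : Y → X × A × B}
    (hf : Measurable f) (hz : Measurable z) (h : Fin H) :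
    Measurable fun y => linFun φ (f y) h (z y) := by
  have := hφ h
  unfold linFun
  fun_prop

theorem measurable_cumResid_main (hφ : ∀ h, Measurable (φ h)) (hf : Measurable f)
    (hS : Measurable S) (h : Fin H) :
    Measurable fun y => cumResid G (linFun φ (f y)) (mainVal φ (f y)) h (S y) := by
  have h1 := measurable_cumResid (t := t) G (q := fun y => linFun φ (f y))
    (fun h => measurable_linFun_comp hφ (hf.comp measurable_fst) measurable_snd h)
    (V := fun y => mainVal φ (f y))
    (fun h => measurable_mainVal_comp hφ (hf.comp measurable_fst) measurable_snd h) h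
  have h2 : Measurable fun y => (y, S y) := by fun_prop
  have h3 := h1.comp h2
  exact h3

theorem measurable_cumExcess_main (hφ : ∀ h, Measurable (φ h)) (hf : Measurable f)
    (hg : Measurable g) (hS : Measurable S) (h : Fin H) :
    Measurable fun y => cumExcess G (linFun φ (g y)) (mainVal φ (f y)) h (S y) := by
  have h1 := measurable_cumExcess (t := t) G (q := fun y => linFun φ (g y))
    (fun h => measurable_linFun_comp hφ (hg.comp measurable_fst) measurable_snd h)
    (V := fun y => mainVal φ (f y))
    (fun h => measurable_mainVal_comp hφ (hf.comp measurable_fst) measurable_snd h) h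
  have h2 : Measurable fun y => (y, S y) := by fun_prop
  have h3 := h1.comp h2
  exact h3

theorem measurable_cumResid_booster (hφ : ∀ h, Measurable (φ h)) (hf : Measurable f)
    (hg : Measurable g) (hS : Measurable S) (h : Fin H) :
    Measurable fun y => cumResid G (linFun φ (g y)) (boostVal φ πA (f y) (g y)) h (S y) := by
  have h1 := measurable_cumResid (t := t) G (q := fun y => linFun φ (g y))
    (fun h => measurable_linFun_comp hφ (hg.comp measurable_fst) measurable_snd h)
    (V := fun y => boostVal φ πA (f y) (g y))
    (fun h => measurable_boostVal_comp hφ (hf.comp measurable_fst) (hg.comp measurable_fst)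
      measurable_snd h) h
  have h2 : Measurable fun y => (y, S y) := by fun_prop
  have h3 := h1.comp h2
  exact h3

theorem measurable_cumExcess_booster (hφ : ∀ h, Measurable (φ h)) (hf : Measurable f)
    (hg : Measurable g) {w : Y → Param H d} (hw : Measurable w) (hS : Measurable S) (h : Fin H) :
    Measurable fun y => cumExcess G (linFun φ (w y)) (boostVal φ πA (f y) (g y)) h (S y) := by
  have h1 := measurable_cumExcess (t := t) G (q := fun y => linFun φ (w y))
    (fun h => measurable_linFun_comp hφ (hw.comp measurable_fst) measurable_snd h)
    (V := fun y => boostVal φ πA (f y) (g y))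
    (fun h => measurable_boostVal_comp hφ (hf.comp measurable_fst) (hg.comp measurable_fst)
      measurable_snd h) h
  have h2 : Measurable fun y => (y, S y) := by fun_prop
  have h3 := h1.comp h2
  exact h3

theorem measurable_gain (hφ : ∀ h, Measurable (φ h)) (θ₀ : Param H d)
    {g₀ : Param H d → Param H d} (hg₀ : Measurable g₀) (hf : Measurable f) (hg : Measurable g)
    (hS : Measurable S) : Measurable fun y => gain G φ πA η lam θ₀ g₀ (S y) (f y) (g y) := by
  have m1 := measurable_mainVal_comp hφ hf (measurable_const (a := G.x₁)) 0
  have m2 := measurable_boostVal_comp (πA := πA) hφ hf hg (measurable_const (a := G.x₁)) 0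
  have m3 := measurable_boostVal_comp (πA := πA) hφ hf (hg₀.comp hf)
    (measurable_const (a := G.x₁)) 0
  have m4 : Measurable fun y => ∑ h, cumResid G (linFun φ (f y)) (mainVal φ (f y)) h (S y) :=
    Finset.measurable_sum _ fun h _ => measurable_cumResid_main hφ hf hS h
  have m5 : Measurable fun y => ∑ h, cumResid G (linFun φ (g y))
      (boostVal φ πA (f y) (g y)) h (S y) :=
    Finset.measurable_sum _ fun h _ => measurable_cumResid_booster hφ hf hg hS h
  exact (((m1.const_sub _).const_mul lam).add ((m2.sub m3).const_mul lam)).add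
    ((m4.add m5).const_mul (0.2 * η))

theorem IsLinear.measurable_massGap_main (hl : IsLinear G φ) (c ε K : ℝ) (θ₀ : Param H d)
    (hS : Measurable S) : Measurable fun y => massGap G φ (mainVal φ) η c ε K θ₀ (S y) := by
  have h1 := hl.measurable_postMass (t := t) (Ω := Unit) (V := fun _ => mainVal φ)
    (fun h => measurable_mainVal_comp hl.measurable_feature (measurable_snd.comp measurable_fst)
      measurable_snd h) η c
  have h2 : Measurable fun y => ((), S y) := by fun_prop
  have h3 := h1.comp h2
  exact measurable_const.sub h3.log

theorem IsLinear.measurable_massGap_booster (hl : IsLinear G φ) (c ε K : ℝ)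
    {g₀ : Param H d → Param H d} (hg₀ : Measurable g₀) (hf : Measurable f)
    (hS : Measurable S) :
    Measurable fun y => massGap G φ (boostVal φ πA (f y)) η c ε K (g₀ (f y)) (S y) := by
  have h1 := hl.measurable_postMass (t := t) (Ω := Param H d) (V := boostVal φ πA)
    (fun h => measurable_boostVal_comp hl.measurable_feature (measurable_fst.comp measurable_fst)
      (measurable_snd.comp measurable_fst) measurable_snd h) η c
  have h2 : Measurable fun y => (f y, S y) := by fun_prop
  have h3 := h1.comp h2
  have m3 := measurable_boostVal_comp (πA := πA) hl.measurable_feature hf (hg₀.comp hf)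
    (measurable_const (a := G.x₁)) 0
  have h4 := ((((m3.const_mul c).sub_const (|c| * ε)).sub_const (slack H t η ε)).sub_const
    K).sub h3.log
  exact h4

end Measurability

end TwoLevel

/-! ### Exponential inequality for the outer value gaps and the past squared residuals. -/

section ExponentialBound

variable {H d : ℕ} {X A B : Type*} [MeasurableSpace X] [MeasurableSpace A] [MeasurableSpace B]
  [Fintype A] [Fintype B] [Nonempty A] [Nonempty B] [DiscreteMeasurableSpace A]
  [DiscreteMeasurableSpace B] [NeZero H] {G : Game H X A B} {φ : Fin H → X × A × B → Vec d}
  {πA : Fin H → Kernel (Vec d × X) A} {πB : Fin H → Kernel ((Vec d × Vec d) × X) B} {t : ℕ}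
  {η lam : ℝ}

theorem ValueFamily.measurable_right {V : Param H d → Fin H → X → ℝ} (hV : ValueFamily φ V)
    (θ : Param H d) (h : Fin H) : Measurable (V θ h) := by
  have h1 : Measurable fun x : X => (θ, x) := by fun_prop
  have h2 := (hV.measurable h).comp h1
  exact h2

theorem ValueFamily.mem_Icc_horizon {V : Param H d → Fin H → X → ℝ} (hV : ValueFamily φ V)
    {θ : Param H d} (hθ : θ ∈ classSet φ) (h : Fin H) (x : X) : V θ h x ∈ Set.Icc (0 : ℝ) H :=
  ⟨(hV.mem_Icc θ hθ h x).1, (hV.mem_Icc θ hθ h x).2.trans (horizon_sub_le h)⟩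

theorem IsLinear.lintegral_exp_cumExcess_le (hl : IsLinear G φ) (hA : ∀ h, IsMarkovKernel (πA h))
    (hB : ∀ h, IsMarkovKernel (πB h)) (hη : 0 ≤ η) (hηH : 4 * η * (H : ℝ) ^ 2 ≤ 1.6)
    {V : Param H d → Fin H → X → ℝ} (hV : ValueFamily φ V) {θ : Param H d} (hθ : θ ∈ classSet φ)
    (w : Param H d) :
    ∫⁻ ω, ENNReal.ofReal (Real.exp (-(4 * η) * ∑ h, cumExcess G (linFun φ w) (V θ) h (trajs ω) +
      0.2 * (4 * η) * ∑ h, cumResid G (linFun φ w) (V θ) h (trajs ω)))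
      ∂(runLaw G φ πA πB η lam t) ≤ 1 :=
  hl.lintegral_runLaw_exp_le hA hB hη (measurable_linFun_right hl.measurable_feature w)
    (hV.measurable_right θ) (hV.mem_Icc_horizon hθ) (by positivity) hηH t

/-- In the bound on the mass deficit, `θ` and `w` follow laws that ignore the data. Tonelli moves
the expectation over the data inside, where the supermartingale applies to the fixed pair; its
squared-residual term is nonnegative and is simply dropped. -/
theorem IsLinear.lintegral_exp_massGap_le (hl : IsLinear G φ) (hA : ∀ h, IsMarkovKernel (πA h))
    (hB : ∀ h, IsMarkovKernel (πB h)) (hη : 0 ≤ η) (hηH : 4 * η * (H : ℝ) ^ 2 ≤ 1.6)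
    {V : Param H d → Fin H → X → ℝ} (hV : ValueFamily φ V) (c : ℝ) {ε K : ℝ} (hε : 0 ≤ ε)
    {θ₀ : Param H d} (hθ₀ : θ₀ ∈ classSet φ)
    (hfix : ∀ h z, linFun φ θ₀ h z = G.r h z + nextMean G.P (V θ₀) h z)
    (hK : Real.exp (-K) ≤ ∏ h, (prior φ h).real (smallSet G φ (V θ₀) ε h)) :
    ∫⁻ ω, ENNReal.ofReal (Real.exp (4 * massGap G φ V η c ε K θ₀ (trajs ω)))
      ∂(runLaw G φ πA πB η lam t) ≤ 1 := by
  have := hl.isProbabilityMeasure_prior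
  have := hl.isProbabilityMeasure_runLaw (lam := lam) hA hB hη t
  set C := cond (Measure.pi (prior φ)) (Set.univ.pi fun h => smallSet G φ (V θ₀) ε h) with hC
  have hGm : MeasurableSet (Set.univ.pi fun h => smallSet G φ (V θ₀) ε h) :=
    MeasurableSet.univ_pi fun h => measurableSet_smallSet _ _ _
  have hC1 : C Set.univ ≤ 1 := by
    rw [hC, ProbabilityTheory.cond_apply hGm, Set.inter_univ]
    exact ENNReal.inv_mul_le_one _
  have hCmem : ∀ᵐ θ ∂C, θ ∈ classSet φ := by
    filter_upwards [ae_cond_mem hGm] with θ hθ h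
    exact (hθ h (Set.mem_univ h)).1
  have : IsFiniteMeasure C := ⟨hC1.trans_lt ENNReal.one_lt_top⟩
  have hF : Measurable fun z : ((Fin t → Rec H d X A B) × Param H d) × Param H d =>
      ENNReal.ofReal (Real.exp (-(4 * η) *
        ∑ h, cumExcess G (linFun φ z.2) (V z.1.2) h (trajs z.1.1))) := by
    have h1 : Measurable fun z : ((Fin t → Rec H d X A B) × Param H d) × Param H d =>
        ∑ h, cumExcess G (linFun φ z.2) (V z.1.2) h (trajs z.1.1) := by
      refine Finset.measurable_sum _ fun h _ => ?_
      have h2 := measurable_cumExcess (t := t) G (Y := Param H d × Param H d)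
        (q := fun y => linFun φ y.2)
        (fun h => measurable_linFun_comp hl.measurable_feature (measurable_snd.comp measurable_fst)
          measurable_snd h) (V := fun y => V y.1) (fun h => by
            have h3 : Measurable fun y : (Param H d × Param H d) × X => (y.1.1, y.2) := by fun_prop
            have h4 := (hV.measurable h).comp h3
            exact h4) h
      have h5 : Measurable fun z : ((Fin t → Rec H d X A B) × Param H d) × Param H d =>
        ((z.1.2, z.2), trajs z.1.1) := Measurable.prodMk (by fun_prop)
          (measurable_trajs.comp (by fun_prop))
      have h6 := h2.comp h5
      exact h6
    exact (h1.const_mul _).exp.ennreal_ofReal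
  have hFω : ∀ θ : Param H d, Measurable fun z : (Fin t → Rec H d X A B) × Param H d =>
      ENNReal.ofReal (Real.exp (-(4 * η) *
        ∑ h, cumExcess G (linFun φ z.2) (V θ) h (trajs z.1))) := by
    intro θ
    have h1 : Measurable fun z : (Fin t → Rec H d X A B) × Param H d => ((z.1, θ), z.2) := by
      fun_prop
    have h2 := hF.comp h1
    exact h2
  calc _ ≤ ∫⁻ ω, ∫⁻ θ, ∫⁻ w, ENNReal.ofReal (Real.exp (-(4 * η) *
        ∑ h, cumExcess G (linFun φ w) (V θ) h (trajs ω))) ∂(Measure.pi (prior φ)) ∂C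
          ∂(runLaw G φ πA πB η lam t) :=
        lintegral_mono fun ω => hl.exp_massGap_le hV hη c (trajs ω) hε hθ₀ hfix hK
    _ = ∫⁻ θ, ∫⁻ ω, ∫⁻ w, ENNReal.ofReal (Real.exp (-(4 * η) *
        ∑ h, cumExcess G (linFun φ w) (V θ) h (trajs ω))) ∂(Measure.pi (prior φ))
          ∂(runLaw G φ πA πB η lam t) ∂C :=
        lintegral_lintegral_swap hF.lintegral_prod_right'.aemeasurable
    _ = ∫⁻ θ, ∫⁻ w, ∫⁻ ω, ENNReal.ofReal (Real.exp (-(4 * η) *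
        ∑ h, cumExcess G (linFun φ w) (V θ) h (trajs ω))) ∂(runLaw G φ πA πB η lam t)
          ∂(Measure.pi (prior φ)) ∂C :=
        lintegral_congr fun θ => lintegral_lintegral_swap (hFω θ).aemeasurable
    _ ≤ ∫⁻ _, ∫⁻ _, 1 ∂(Measure.pi (prior φ)) ∂C := by
        refine lintegral_mono_ae ?_
        filter_upwards [hCmem] with θ hθ
        refine lintegral_mono fun w => ?_
        refine le_trans (lintegral_mono fun ω => ENNReal.ofReal_le_ofReal (Real.exp_le_exp.2 ?_))
          (hl.lintegral_exp_cumExcess_le hA hB hη hηH hV hθ w)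
        refine le_add_of_nonneg_right (mul_nonneg (by positivity) ?_)
        exact Finset.sum_nonneg fun h _ => Finset.sum_nonneg fun s _ => sq_nonneg _
    _ ≤ 1 := by simpa using hC1

set_option maxHeartbeats 400000 in
/-- The exponential form of the regret decomposition. -/
theorem IsLinear.lintegral_exp_gain_le (hl : IsLinear G φ) (hA : IsMainRule φ πA)
    (hB : ∀ h, IsMarkovKernel (πB h)) (hη : 0 ≤ η) (hηH : 4 * η * (H : ℝ) ^ 2 ≤ 1.6)
    (hlam : 0 ≤ lam) {ε K : ℝ} (hε : 0 < ε) (hK : kappa G φ πA ε ≤ K)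
    {θ₀ : Param H d} (hθ₀ : θ₀ ∈ classSet φ)
    (hfix : ∀ h z, linFun φ θ₀ h z = G.r h z + nextMean G.P (mainVal φ θ₀) h z)
    {g₀ : Param H d → Param H d} (hg₀ : Measurable g₀) (hg₀m : ∀ θ, g₀ θ ∈ classSet φ)
    (hgfix : ∀ θ h z, linFun φ (g₀ θ) h z =
      G.r h z + nextMean G.P (boostVal φ πA θ (g₀ θ)) h z) :
    ∫⁻ y, ENNReal.ofReal (Real.exp ((gain G φ πA η lam θ₀ g₀ (trajs y.1) y.2.1 y.2.2.1 -
      (4 * K + 4 * slack H t η ε + 2 * (lam * ε))) / 2)) ∂(nextLaw G φ πA πB η lam t) ≤ 1 := by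
  have hAm := hA.markov
  have hφ := hl.measurable_feature
  have := hl.isProbabilityMeasure_prior
  have := hl.isProbabilityMeasure_runLaw (lam := lam) hAm hB hη t
  have hVm := valueFamily_mainVal hφ
  have hVb := fun θ => valueFamily_boostVal hφ hAm θ
  -- Transfers the prior bound from booster backups, for which `κ` is defined, to the backups of the
  -- main agent.
  have hset : ∀ θ ∈ classSet φ, boostVal φ πA θ θ = mainVal φ θ := fun θ hθ => by
    funext h x
    exact (hA.mainVal_eq (hθ h) x).symm
  have hKb : ∀ θ ∈ classSet φ, ∀ ϑ ∈ classSet φ,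
      Real.exp (-K) ≤ ∏ h, (prior φ h).real (smallSet G φ (boostVal φ πA θ ϑ) ε h) ∧
      ∀ h, 0 < (prior φ h).real (smallSet G φ (boostVal φ πA θ ϑ) ε h) := fun θ hθ ϑ hϑ =>
    hl.exp_neg_kappa_le hAm hε hK hθ hϑ
  have hKm : ∀ θ ∈ classSet φ,
      Real.exp (-K) ≤ ∏ h, (prior φ h).real (smallSet G φ (mainVal φ θ) ε h) ∧
      ∀ h, 0 < (prior φ h).real (smallSet G φ (mainVal φ θ) ε h) := fun θ hθ => by
    rw [← hset θ hθ]
    exact hKb θ hθ θ hθ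
  have mT : Measurable fun z : (Fin t → Rec H d X A B) × Param H d × Param H d => trajs z.1 :=
    measurable_trajs.comp measurable_fst
  have mT' : Measurable fun z : (Fin t → Rec H d X A B) × Param H d => trajs z.1 :=
    measurable_trajs.comp measurable_fst
  have hgain : Measurable fun z : (Fin t → Rec H d X A B) × Param H d × Param H d =>
      ENNReal.ofReal (Real.exp ((gain G φ πA η lam θ₀ g₀ (trajs z.1) z.2.1 z.2.2 -
        (4 * K + 4 * slack H t η ε + 2 * (lam * ε))) / 2)) := by
    have h1 := measurable_gain (πA := πA) (η := η) (lam := lam) (G := G) hφ θ₀ hg₀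
      (measurable_fst.comp measurable_snd : Measurable fun z : (Fin t → Rec H d X A B) ×
        Param H d × Param H d => z.2.1) (measurable_snd.comp measurable_snd) mT
    exact ((h1.sub_const _).div_const 2).exp.ennreal_ofReal
  refine (hl.lintegral_nextLaw_eq hAm hB hη hgain).le.trans ?_
  let f₁ : (Fin t → Rec H d X A B) × Param H d → ENNReal := fun z => ENNReal.ofReal (Real.exp
    (-(4 * η) * ∑ h, cumExcess G (linFun φ z.2) (mainVal φ z.2) h (trajs z.1) +
      0.2 * (4 * η) * ∑ h, cumResid G (linFun φ z.2) (mainVal φ z.2) h (trajs z.1)))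
  let f₂ : (Fin t → Rec H d X A B) × Param H d × Param H d → ENNReal := fun z => ENNReal.ofReal
    (Real.exp (-(4 * η) * ∑ h, cumExcess G (linFun φ z.2.2) (boostVal φ πA z.2.1 z.2.2) h
      (trajs z.1) + 0.2 * (4 * η) * ∑ h, cumResid G (linFun φ z.2.2)
        (boostVal φ πA z.2.1 z.2.2) h (trajs z.1)))
  let f₃ : (Fin t → Rec H d X A B) → ENNReal := fun ω => ENNReal.ofReal (Real.exp
    (4 * massGap G φ (mainVal φ) η lam ε K θ₀ (trajs ω)))
  let f₄ : (Fin t → Rec H d X A B) × Param H d → ENNReal := fun z => ENNReal.ofReal (Real.exp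
    (4 * massGap G φ (boostVal φ πA z.2) η (-lam) ε K (g₀ z.2) (trajs z.1)))
  let pm : (Fin t → Rec H d X A B) × Param H d → ENNReal := fun z =>
    postDensity G φ (mainVal φ) η lam (trajs z.1) z.2
  let pb : (Fin t → Rec H d X A B) × Param H d × Param H d → ENNReal := fun z =>
    postDensity G φ (boostVal φ πA z.2.1) η (-lam) (trajs z.1) z.2.2
  have hf₁ : Measurable f₁ := by
    have e1 : Measurable fun z : (Fin t → Rec H d X A B) × Param H d =>
        ∑ h, cumExcess G (linFun φ z.2) (mainVal φ z.2) h (trajs z.1) :=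
      Finset.measurable_sum _ fun h _ =>
        measurable_cumExcess_main hφ measurable_snd measurable_snd mT' h
    have e2 : Measurable fun z : (Fin t → Rec H d X A B) × Param H d =>
        ∑ h, cumResid G (linFun φ z.2) (mainVal φ z.2) h (trajs z.1) :=
      Finset.measurable_sum _ fun h _ => measurable_cumResid_main hφ measurable_snd mT' h
    exact ((e1.const_mul _).add (e2.const_mul _)).exp.ennreal_ofReal
  have hf₂ : Measurable f₂ := by
    have e1 : Measurable fun z : (Fin t → Rec H d X A B) × Param H d × Param H d =>
        ∑ h, cumExcess G (linFun φ z.2.2) (boostVal φ πA z.2.1 z.2.2) h (trajs z.1) :=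
      Finset.measurable_sum _ fun h _ =>
        measurable_cumExcess_booster hφ (measurable_fst.comp measurable_snd)
          (measurable_snd.comp measurable_snd) (measurable_snd.comp measurable_snd) mT h
    have e2 : Measurable fun z : (Fin t → Rec H d X A B) × Param H d × Param H d =>
        ∑ h, cumResid G (linFun φ z.2.2) (boostVal φ πA z.2.1 z.2.2) h (trajs z.1) :=
      Finset.measurable_sum _ fun h _ =>
        measurable_cumResid_booster hφ (measurable_fst.comp measurable_snd)
          (measurable_snd.comp measurable_snd) mT h
    exact ((e1.const_mul _).add (e2.const_mul _)).exp.ennreal_ofReal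
  have hf₃ : Measurable f₃ :=
    ((hl.measurable_massGap_main lam ε K θ₀ measurable_trajs).const_mul 4).exp.ennreal_ofReal
  have hf₄ : Measurable f₄ :=
    ((hl.measurable_massGap_booster (πA := πA) (-lam) ε K hg₀ measurable_snd
      mT').const_mul 4).exp.ennreal_ofReal
  have hpm : Measurable pm := by
    have h1 : Measurable fun z : (Fin t → Rec H d X A B) × Param H d => (trajs z.1, z.2) :=
      mT'.prodMk measurable_snd
    have h2 := (hl.measurable_mainDensity (η := η) (lam := lam)).comp h1
    exact h2
  have hpb : Measurable pb := hl.measurable_boosterDensity_trajs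
  have mP : Measurable fun z : (Fin t → Rec H d X A B) × Param H d × Param H d => (z.1, z.2.1) := by
    fun_prop
  have c8 : ENNReal.ofReal (1 / 8) + ENNReal.ofReal (1 / 8) + ENNReal.ofReal (1 / 8) +
      ENNReal.ofReal (1 / 8) + ENNReal.ofReal (1 / 8) + ENNReal.ofReal (3 / 8) = 1 := by
    rw [← ENNReal.ofReal_add, ← ENNReal.ofReal_add, ← ENNReal.ofReal_add, ← ENNReal.ofReal_add,
      ← ENNReal.ofReal_add, ← ENNReal.ofReal_one] <;> norm_num
  -- Adding the two optimism bounds turns the exponent into a convex combination. Each log-density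
  -- needs total coefficient `1 / 2`: the booster's occurs in the first, third, fourth and fifth
  -- terms with weight `1 / 8`, and the main one in the third with `1 / 8` and in the last with `3 /
  -- 8`. Losses and mass deficits appear with a factor four, so that `1 / 8` becomes the required `1
  -- / 2`.
  have hpoint : ∀ z : (Fin t → Rec H d X A B) × Param H d × Param H d, z.2.1 ∈ classSet φ →
      z.2.2 ∈ classSet φ → pm (z.1, z.2.1) * (pb z * ENNReal.ofReal (Real.exp
        ((gain G φ πA η lam θ₀ g₀ (trajs z.1) z.2.1 z.2.2 -
          (4 * K + 4 * slack H t η ε + 2 * (lam * ε))) / 2))) ≤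
      ENNReal.ofReal (1 / 8) * (f₁ (z.1, z.2.1) * pb z) + ENNReal.ofReal (1 / 8) * f₂ z +
        ENNReal.ofReal (1 / 8) * ((f₃ z.1 * pm (z.1, z.2.1)) * pb z) +
        ENNReal.ofReal (1 / 8) * (f₄ (z.1, z.2.1) * pb z) +
        ENNReal.ofReal (1 / 8) * (1 * pb z) + ENNReal.ofReal (3 / 8) * pm (z.1, z.2.1) := by
    rintro ⟨ω, θ, ϑ⟩ hθ hϑ
    have o1 := hl.optimism_le hVm hη lam (trajs ω) hε.le hθ (hKm θ hθ).1 (hKm θ hθ).2 θ₀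
    have o2 := hl.optimism_le (hVb θ) hη (-lam) (trajs ω) hε.le hϑ (hKb θ hθ ϑ hϑ).1
      (hKb θ hθ ϑ hϑ).2 (g₀ θ)
    have d1 := hl.postDensity_eq hVm hη lam (trajs ω) hθ
    have d2 := hl.postDensity_eq (hVb θ) hη (-lam) (trajs ω) hϑ
    simp only [pm, pb, f₁, f₂, f₃, f₄, d1, d2, one_mul]
    rw [abs_neg] at o2
    rw [abs_of_nonneg hlam] at o1 o2
    simp only [← ENNReal.ofReal_mul (Real.exp_pos _).le, ← Real.exp_add]
    simp only [← ENNReal.ofReal_mul (show (0 : ℝ) ≤ 1 / 8 by norm_num),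
      ← ENNReal.ofReal_mul (show (0 : ℝ) ≤ 3 / 8 by norm_num)]
    rw [← ENNReal.ofReal_add, ← ENNReal.ofReal_add, ← ENNReal.ofReal_add, ← ENNReal.ofReal_add,
      ← ENNReal.ofReal_add]
    · refine ENNReal.ofReal_le_ofReal ?_
      refine (exp_weighted_le _ _ _ _ _ _).trans' (Real.exp_le_exp.2 ?_)
      unfold gain
      linarith
    all_goals positivity
  calc _ ≤ ∫⁻ z, (ENNReal.ofReal (1 / 8) * (f₁ (z.1, z.2.1) * pb z) +
        ENNReal.ofReal (1 / 8) * f₂ z +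
        ENNReal.ofReal (1 / 8) * ((f₃ z.1 * pm (z.1, z.2.1)) * pb z) +
        ENNReal.ofReal (1 / 8) * (f₄ (z.1, z.2.1) * pb z) +
        ENNReal.ofReal (1 / 8) * (1 * pb z) + ENNReal.ofReal (3 / 8) * pm (z.1, z.2.1))
          ∂(refLaw G φ πA πB η lam t) := by
        refine lintegral_mono_ae ?_
        filter_upwards [hl.ae_refLaw_mem hAm hB hη] with z hz
        exact hpoint z hz.1 hz.2
    _ = ENNReal.ofReal (1 / 8) * ∫⁻ z, f₁ (z.1, z.2.1) * pb z ∂(refLaw G φ πA πB η lam t) +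
        ENNReal.ofReal (1 / 8) * ∫⁻ z, f₂ z ∂(refLaw G φ πA πB η lam t) +
        ENNReal.ofReal (1 / 8) * ∫⁻ z, (f₃ z.1 * pm (z.1, z.2.1)) * pb z
          ∂(refLaw G φ πA πB η lam t) +
        ENNReal.ofReal (1 / 8) * ∫⁻ z, f₄ (z.1, z.2.1) * pb z ∂(refLaw G φ πA πB η lam t) +
        ENNReal.ofReal (1 / 8) * ∫⁻ z, 1 * pb z ∂(refLaw G φ πA πB η lam t) +
        ENNReal.ofReal (3 / 8) * ∫⁻ z, pm (z.1, z.2.1) ∂(refLaw G φ πA πB η lam t) := by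
        have m1 : Measurable fun z : (Fin t → Rec H d X A B) × Param H d × Param H d =>
            f₁ (z.1, z.2.1) * pb z := (hf₁.comp mP).mul hpb
        have m3 : Measurable fun z : (Fin t → Rec H d X A B) × Param H d × Param H d =>
            (f₃ z.1 * pm (z.1, z.2.1)) * pb z :=
          ((hf₃.comp measurable_fst).mul (hpm.comp mP)).mul hpb
        have m4 : Measurable fun z : (Fin t → Rec H d X A B) × Param H d × Param H d =>
            f₄ (z.1, z.2.1) * pb z := (hf₄.comp mP).mul hpb
        have m5 : Measurable fun z : (Fin t → Rec H d X A B) × Param H d × Param H d => 1 * pb z :=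
          hpb.const_mul 1
        have m6 : Measurable fun z : (Fin t → Rec H d X A B) × Param H d × Param H d =>
            pm (z.1, z.2.1) := hpm.comp mP
        rw [lintegral_add_right _ (m6.const_mul _), lintegral_add_right _ (m5.const_mul _),
          lintegral_add_right _ (m4.const_mul _), lintegral_add_right _ (m3.const_mul _),
          lintegral_add_right _ (hf₂.const_mul _)]
        refine congr_arg₂ _ (congr_arg₂ _ (congr_arg₂ _ (congr_arg₂ _ (congr_arg₂ _ ?_ ?_) ?_) ?_)
          ?_) ?_
        · exact lintegral_const_mul _ m1
        · exact lintegral_const_mul _ hf₂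
        · exact lintegral_const_mul _ m3
        · exact lintegral_const_mul _ m4
        · exact lintegral_const_mul _ m5
        · exact lintegral_const_mul _ m6
    _ ≤ ENNReal.ofReal (1 / 8) * 1 + ENNReal.ofReal (1 / 8) * 1 + ENNReal.ofReal (1 / 8) * 1 +
        ENNReal.ofReal (1 / 8) * 1 + ENNReal.ofReal (1 / 8) * 1 + ENNReal.ofReal (3 / 8) * 1 := by
        -- All six averages are at most one. The booster's density is integrated out over `ϑ`
        -- wherever nothing else depends on `ϑ`, and the main density likewise over `θ`; the
        -- remaining loss terms are supermartingales at fixed parameters, and the mass deficits are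
        -- covered by `lintegral_exp_massGap_le`.
        have hmem := hl.ae_pi_prior_mem
        refine add_le_add (add_le_add (add_le_add (add_le_add (add_le_add ?_ ?_) ?_) ?_) ?_) ?_ <;>
          refine mul_le_mul_right ?_ _
        · refine (hl.lintegral_mul_boosterDensity hAm hB hη hf₁).le.trans ?_
          rw [lintegral_lintegral_swap hf₁.aemeasurable]
          refine (lintegral_mono_ae (g := fun _ => 1) ?_).trans (by simp)
          filter_upwards [hmem] with θ hθ
          exact hl.lintegral_exp_cumExcess_le hAm hB hη hηH hVm hθ θ
        · rw [hl.lintegral_refLaw_symm hAm hB hη hf₂]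
          refine (lintegral_mono_ae (g := fun _ => 1) ?_).trans (by simp)
          filter_upwards [Measure.quasiMeasurePreserving_snd.ae hmem] with y hy
          exact hl.lintegral_exp_cumExcess_le hAm hB hη hηH (hVb y.1) hy y.2
        · have m3 : Measurable fun z : (Fin t → Rec H d X A B) × Param H d => f₃ z.1 * pm z :=
            (hf₃.comp measurable_fst).mul hpm
          refine (hl.lintegral_mul_boosterDensity hAm hB hη m3).le.trans ?_
          have e : ∀ ω, ∫⁻ θ, f₃ ω * pm (ω, θ) ∂(Measure.pi (prior φ)) = f₃ ω := by
            intro ω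
            have hs : Measurable fun θ => pm (ω, θ) := hpm.comp measurable_prodMk_left
            rw [lintegral_const_mul _ hs]
            have := hl.lintegral_mainDensity_trajs (lam := lam) hη (trajs ω)
            rw [show ∫⁻ θ, pm (ω, θ) ∂(Measure.pi (prior φ)) = 1 from this, mul_one]
          refine (lintegral_congr e).le.trans ?_
          exact hl.lintegral_exp_massGap_le hAm hB hη hηH hVm lam hε.le hθ₀ hfix (hKm θ₀ hθ₀).1
        · refine (hl.lintegral_mul_boosterDensity hAm hB hη hf₄).le.trans ?_
          rw [lintegral_lintegral_swap hf₄.aemeasurable]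
          refine (lintegral_mono_ae (g := fun _ => 1) ?_).trans (by simp)
          filter_upwards [hmem] with θ hθ
          have key := hl.lintegral_exp_massGap_le (t := t) (lam := lam) hAm hB hη hηH (hVb θ) (-lam)
            hε.le (hg₀m θ) (hgfix θ) (hKb θ hθ (g₀ θ) (hg₀m θ)).1
          exact key
        · refine (hl.lintegral_mul_boosterDensity hAm hB hη (f := fun _ => 1)
            measurable_const).le.trans ?_
          simp
        · refine (hl.lintegral_refLaw hAm hB hη (hpm.comp mP)).le.trans ?_
          simp only [Function.comp_apply, lintegral_const, measure_univ, mul_one]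
          refine (lintegral_mono (g := fun _ => 1) fun ω => ?_).trans (by simp)
          exact (hl.lintegral_mainDensity_trajs (lam := lam) hη (trajs ω)).le
    _ = 1 := by simp only [mul_one]; exact c8

end ExponentialBound

/-! ### The elliptic potential: log-determinants of design matrices. -/

section EllipticPotential

variable {n : ℕ}

-- The rank-one matrix determinant lemma.
open Matrix in
theorem det_add_vecMulVec_self {M : Matrix (Fin n) (Fin n) ℝ} (hM : M.PosDef) (v : Fin n → ℝ) :
    (M + vecMulVec v v).det = M.det * (1 + v ⬝ᵥ M⁻¹ *ᵥ v) := by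
  rw [vecMulVec_eq Unit, det_add_replicateCol_mul_replicateRow hM.det_pos.ne'.isUnit]
  congr 1
  rw [det_unique, Matrix.mul_assoc]
  rfl

/-- `log (1 + q) ≥ q / (1 + q)`, which is at least half of `min 1 q`. -/
theorem min_one_le_two_mul_log {q : ℝ} (hq : 0 ≤ q) : min 1 q ≤ 2 * Real.log (1 + q) := by
  have h := Real.one_sub_inv_le_log_of_pos (show (0 : ℝ) < 1 + q by linarith)
  have e : 1 - (1 + q)⁻¹ = q / (1 + q) := by field_simp; ring
  rw [e] at h
  have h2 : min 1 q ≤ 2 * (q / (1 + q)) := by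
    rw [mul_div_assoc', le_div_iff₀ (by linarith)]
    rcases le_total 1 q with h1 | h1
    · rw [min_eq_left h1]; linarith
    · rw [min_eq_right h1]; nlinarith
  linarith

open Matrix in
/-- The elliptic potential bound for one prediction. -/
theorem abs_dotProduct_le_logDet {M : Matrix (Fin n) (Fin n) ℝ} (hM : M.PosDef)
    (v w : Fin n → ℝ) {R μ : ℝ} (hμ : 0 < μ) (hR : |v ⬝ᵥ w| ≤ R) :
    |v ⬝ᵥ w| ≤ (R + 1 / (2 * μ)) * (2 * (Real.log (M + vecMulVec v v).det - Real.log M.det)) +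
      μ / 2 * (w ⬝ᵥ M *ᵥ w) := by
  set q := v ⬝ᵥ M⁻¹ *ᵥ v with hq
  have hq0 : 0 ≤ q := by simpa using hM.inv.posSemidef.dotProduct_mulVec_nonneg v
  have hw0 : 0 ≤ w ⬝ᵥ M *ᵥ w := by simpa using hM.posSemidef.dotProduct_mulVec_nonneg w
  have hlog : Real.log (M + vecMulVec v v).det - Real.log M.det = Real.log (1 + q) := by
    rw [det_add_vecMulVec_self hM, Real.log_mul hM.det_pos.ne' (by linarith)]
    ring
  have hR0 : 0 ≤ R := (abs_nonneg _).trans hR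
  have hmain : |v ⬝ᵥ w| ≤ (R + 1 / (2 * μ)) * min 1 q + μ / 2 * (w ⬝ᵥ M *ᵥ w) := by
    -- The quadratic form of `M` at `w + c M⁻¹ v` is nonnegative. Taking `c = ± 1 / μ` gives
    -- Cauchy-Schwarz and Young's inequality in one stroke.
    have hsq : ∀ c : ℝ, 0 ≤ w ⬝ᵥ M *ᵥ w + 2 * c * (v ⬝ᵥ w) + c ^ 2 * q := by
      intro c
      have h1 := hM.posSemidef.dotProduct_mulVec_nonneg (w + c • (M⁻¹ *ᵥ v))
      have hinv : M *ᵥ (M⁻¹ *ᵥ v) = v := by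
        rw [mulVec_mulVec, mul_nonsing_inv _ hM.det_pos.ne'.isUnit, one_mulVec]
      have hsym : (M⁻¹ *ᵥ v) ⬝ᵥ M *ᵥ w = v ⬝ᵥ w := by
        have ht : Mᵀ = M := by
          rw [← conjTranspose_eq_transpose_of_trivial]
          exact hM.isHermitian
        rw [dotProduct_mulVec, ← mulVec_transpose, ht, hinv]
      simp only [star_trivial, mulVec_add, mulVec_smul, hinv, add_dotProduct, dotProduct_add,
        smul_dotProduct, dotProduct_smul, smul_eq_mul, hsym] at h1
      rw [dotProduct_comm w v, dotProduct_comm (M⁻¹ *ᵥ v) v, ← hq] at h1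
      nlinarith
    have hcs : |v ⬝ᵥ w| ≤ q / (2 * μ) + μ / 2 * (w ⬝ᵥ M *ᵥ w) := by
      have h1 := mul_nonneg (show 0 ≤ μ / 2 by linarith) (hsq (1 / μ))
      have h2 := mul_nonneg (show 0 ≤ μ / 2 by linarith) (hsq (-(1 / μ)))
      have e1 : μ / 2 * (w ⬝ᵥ M *ᵥ w + 2 * (1 / μ) * (v ⬝ᵥ w) + (1 / μ) ^ 2 * q) =
          μ / 2 * (w ⬝ᵥ M *ᵥ w) + v ⬝ᵥ w + q / (2 * μ) := by field_simp
      have e2 : μ / 2 * (w ⬝ᵥ M *ᵥ w + 2 * (-(1 / μ)) * (v ⬝ᵥ w) + (-(1 / μ)) ^ 2 * q) =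
          μ / 2 * (w ⬝ᵥ M *ᵥ w) - v ⬝ᵥ w + q / (2 * μ) := by field_simp; ring
      rw [e1] at h1
      rw [e2] at h2
      exact abs_le.2 ⟨by linarith, by linarith⟩
    have hμ' : 0 < 1 / (2 * μ) := by positivity
    have hp : 0 ≤ μ / 2 * (w ⬝ᵥ M *ᵥ w) := by positivity
    -- For `q ≥ 1` the a priori bound `R` suffices; for `q ≤ 1` the Cauchy-Schwarz bound does.
    rcases le_total 1 q with h1 | h1
    · rw [min_eq_left h1]
      linarith
    · rw [min_eq_right h1]
      have e : q / (2 * μ) = 1 / (2 * μ) * q := by ring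
      nlinarith [mul_nonneg hR0 hq0]
  rw [hlog]
  have := mul_le_mul_of_nonneg_left (min_one_le_two_mul_log hq0)
    (show 0 ≤ R + 1 / (2 * μ) by positivity)
  linarith

-- Every eigenvalue of a positive definite matrix is at most the trace.
open Matrix in
theorem log_det_le {M : Matrix (Fin n) (Fin n) ℝ} (hM : M.PosDef) :
    Real.log M.det ≤ n * Real.log M.trace := by
  have hd : M.det = ∏ i, hM.isHermitian.eigenvalues i := by
    simpa using hM.isHermitian.det_eq_prod_eigenvalues
  have ht : M.trace = ∑ i, hM.isHermitian.eigenvalues i := by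
    simpa using hM.isHermitian.trace_eq_sum_eigenvalues
  rw [hd, Real.log_prod fun i _ => (hM.eigenvalues_pos i).ne']
  refine (Finset.sum_le_sum (g := fun _ => Real.log M.trace) fun i _ => ?_).trans (by simp)
  refine Real.log_le_log (hM.eigenvalues_pos i) ?_
  rw [ht]
  exact Finset.single_le_sum (fun j _ => (hM.eigenvalues_pos j).le) (Finset.mem_univ i)

variable {H d : ℕ} {X A B : Type*} [MeasurableSpace X] [MeasurableSpace A] [MeasurableSpace B]
  {φ : Fin H → X × A × B → Vec d} {t : ℕ} {τ : ℝ}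

/-- The regularized design matrix `τ I + ∑ₛ φₕ φₕᵀ`. -/
noncomputable def design (φ : Fin H → X × A × B → Vec d) (τ : ℝ) (h : Fin H)
    (S : Fin t → Traj H X A B) : Matrix (Fin d) (Fin d) ℝ :=
  τ • (1 : Matrix (Fin d) (Fin d) ℝ) +
    ∑ s, Matrix.vecMulVec (φ h (S s h)).ofLp (φ h (S s h)).ofLp

theorem posDef_design (hτ : 0 < τ) (h : Fin H) (S : Fin t → Traj H X A B) :
    (design φ τ h S).PosDef := by
  refine Matrix.PosDef.add_posSemidef (Matrix.PosDef.one.smul hτ) ?_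
  refine Matrix.posSemidef_sum _ fun s _ => ?_
  simpa using Matrix.posSemidef_vecMulVec_self_star (φ h (S s h)).ofLp

theorem design_snoc (h : Fin H) (S : Fin t → Traj H X A B) (ζ : Traj H X A B) :
    design φ τ h (Fin.snoc S ζ : Fin (t + 1) → Traj H X A B) =
      design φ τ h S + Matrix.vecMulVec (φ h (ζ h)).ofLp (φ h (ζ h)).ofLp := by
  unfold design
  rw [Fin.sum_univ_castSucc, ← add_assoc]
  simp only [Fin.snoc_castSucc, Fin.snoc_last]

theorem inner_eq_dotProduct (v w : Vec d) : inner ℝ v w = dotProduct v.ofLp w.ofLp := by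
  rw [EuclideanSpace.inner_eq_star_dotProduct, star_trivial, dotProduct_comm]

theorem dotProduct_design (h : Fin H) (S : Fin t → Traj H X A B) (w : Vec d) :
    dotProduct w.ofLp ((design φ τ h S).mulVec w.ofLp) =
      τ * ‖w‖ ^ 2 + ∑ s, inner ℝ (φ h (S s h)) w ^ 2 := by
  unfold design
  rw [Matrix.add_mulVec, dotProduct_add, Matrix.smul_mulVec, Matrix.one_mulVec, dotProduct_smul,
    smul_eq_mul, ← inner_eq_dotProduct, real_inner_self_eq_norm_sq, Matrix.sum_mulVec,
    dotProduct_sum]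
  congr 1
  refine Finset.sum_congr rfl fun s _ => ?_
  rw [Matrix.vecMulVec_mulVec, inner_eq_dotProduct]
  simp [dotProduct_comm, sq]

theorem trace_design_le (hφ : ∀ h z, ‖φ h z‖ ≤ 1) (h : Fin H) (S : Fin t → Traj H X A B) :
    (design φ τ h S).trace ≤ τ * d + t := by
  unfold design
  rw [Matrix.trace_add, Matrix.trace_smul, Matrix.trace_one, Matrix.trace_sum, Fintype.card_fin,
    smul_eq_mul]
  refine add_le_add le_rfl ?_
  refine (Finset.sum_le_sum (g := fun _ => (1 : ℝ)) fun s _ => ?_).trans (by simp)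
  rw [Matrix.trace_vecMulVec, ← inner_eq_dotProduct, real_inner_self_eq_norm_sq]
  exact pow_le_one₀ (norm_nonneg _) (hφ _ _)

/-- The elliptic potential `∑ₕ log det`. -/
noncomputable def potential (φ : Fin H → X × A × B → Vec d) (τ : ℝ) (S : Fin t → Traj H X A B) :
    ℝ :=
  ∑ h, Real.log (design φ τ h S).det

theorem measurable_potential (hφ : ∀ h, Measurable (φ h)) :
    Measurable fun S : Fin t → Traj H X A B => potential φ τ S := by
  refine Finset.measurable_sum _ fun h _ => Measurable.log ?_
  have hent : ∀ i j, Measurable fun S : Fin t → Traj H X A B => design φ τ h S i j := by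
    intro i j
    have := hφ h
    unfold design
    simp only [Matrix.add_apply, Matrix.sum_apply, Matrix.vecMulVec_apply]
    refine measurable_const.add (Finset.measurable_sum _ fun s _ => ?_)
    fun_prop
  simp only [Matrix.det_apply]
  refine Finset.measurable_sum _ fun σ _ => ?_
  exact (Finset.measurable_prod _ fun i _ => hent _ _).const_smul _

theorem potential_zero (S : Fin 0 → Traj H X A B) :
    potential φ τ S = H * (d * Real.log τ) := by
  unfold potential design
  simp [Real.log_pow]

theorem potential_le (hφ : ∀ h z, ‖φ h z‖ ≤ 1) (hτ : 0 < τ) (hd : 0 < d)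
    (S : Fin t → Traj H X A B) : potential φ τ S ≤ H * (d * Real.log (τ * d + t)) := by
  have h1 : ∀ h, Real.log (design φ τ h S).det ≤ d * Real.log (τ * d + t) := by
    intro h
    have : Nonempty (Fin d) := ⟨⟨0, hd⟩⟩
    have hp := posDef_design (φ := φ) hτ h S
    refine (log_det_le hp).trans ?_
    refine mul_le_mul_of_nonneg_left (Real.log_le_log hp.trace_pos (trace_design_le hφ h S))
      (Nat.cast_nonneg d)
  exact (Finset.sum_le_sum fun h _ => h1 h).trans (by simp)

theorem log_det_design_snoc_ge (hτ : 0 < τ) (h : Fin H) (S : Fin t → Traj H X A B)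
    (ζ : Traj H X A B) : Real.log (design φ τ h S).det ≤
      Real.log (design φ τ h (Fin.snoc S ζ : Fin (t + 1) → Traj H X A B)).det := by
  have hp := posDef_design (φ := φ) hτ h S
  rw [design_snoc, det_add_vecMulVec_self hp]
  refine Real.log_le_log hp.det_pos (le_mul_of_one_le_right hp.det_pos.le ?_)
  have := hp.inv.posSemidef.dotProduct_mulVec_nonneg (φ h (ζ h)).ofLp
  rw [star_trivial] at this
  linarith

theorem le_potential (hτ : 0 < τ) (S : Fin t → Traj H X A B) :
    H * (d * Real.log τ) ≤ potential φ τ S := by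
  induction t with
  | zero => exact (potential_zero S).ge
  | succ t ih =>
    rw [← Fin.snoc_init_self S]
    exact (ih _).trans (Finset.sum_le_sum fun h _ => log_det_design_snoc_ge hτ h _ _)

end EllipticPotential

/-! ### Residuals of one episode against the potential, and the middle value gap. -/

section StageBound

variable {H d : ℕ} {X A B : Type*} [MeasurableSpace X] [MeasurableSpace A] [MeasurableSpace B]
  [Fintype A] [Fintype B] [Nonempty A] [Nonempty B] [DiscreteMeasurableSpace A]
  [DiscreteMeasurableSpace B] [NeZero H] {G : Game H X A B} {φ : Fin H → X × A × B → Vec d}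
  {πA : Fin H → Kernel (Vec d × X) A} {πB : Fin H → Kernel ((Vec d × Vec d) × X) B} {t : ℕ}
  {η lam τ : ℝ}

/-- The residual is the pairing of the feature with `θ h - b`, where `b` represents the backup. The
quadratic form of the design matrix at this vector is the past squared residuals plus `τ` times its
squared norm, and both parameters have norm at most `H √d`. -/
theorem IsLinear.abs_resid_le_potential (hl : IsLinear G φ) {V : Fin H → X → ℝ}
    (hV : ∀ h, Measurable (V h))
    (hVR : ∀ (h : Fin H) x, V h x ∈ Set.Icc (0 : ℝ) (H - (h : ℕ))) {θ : Param H d}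
    (hθ : θ ∈ classSet φ) (hτ : 0 < τ) {μ : ℝ} (hμ : 0 < μ) (h : Fin H)
    (S : Fin t → Traj H X A B) (ζ : Traj H X A B) :
    |resid G (linFun φ θ) V h (ζ h)| ≤ (H + 1 / (2 * μ)) *
      (2 * (Real.log (design φ τ h (Fin.snoc S ζ : Fin (t + 1) → Traj H X A B)).det -
        Real.log (design φ τ h S).det)) +
      μ / 2 * (τ * (4 * (H : ℝ) ^ 2 * d) + cumResid G (linFun φ θ) V h S) := by
  obtain ⟨b, hb, hbz⟩ := hl.exists_mem_paramSet hV hVR h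
  have he : ∀ z, resid G (linFun φ θ) V h z = inner ℝ (φ h z) (θ h - b) := by
    intro z
    rw [inner_sub_right, hbz]
    unfold resid linFun
    ring
  have hnorm : ‖θ h - b‖ ^ 2 ≤ 4 * (H : ℝ) ^ 2 * d := by
    have h1 : ∀ v ∈ paramSet φ h, ‖v‖ ≤ H * √(d : ℝ) := fun v hv =>
      hv.1.trans (mul_le_mul_of_nonneg_right (horizon_sub_le h) (Real.sqrt_nonneg _))
    have h2 : ‖θ h - b‖ ≤ 2 * (H * √(d : ℝ)) := by
      linarith [norm_sub_le (θ h) b, h1 _ (hθ h), h1 b hb]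
    refine (pow_le_pow_left₀ (norm_nonneg _) h2 2).trans_eq ?_
    rw [mul_pow, mul_pow, Real.sq_sqrt (Nat.cast_nonneg d)]
    ring
  have hR := abs_resid_le (G := G) (hθ h) hVR (ζ h)
  have key := abs_dotProduct_le_logDet (posDef_design (φ := φ) hτ h S) (φ h (ζ h)).ofLp
    (θ h - b).ofLp hμ (R := H) (by rwa [← inner_eq_dotProduct, ← he])
  rw [dotProduct_design, ← inner_eq_dotProduct, ← he, ← design_snoc] at key
  refine key.trans (add_le_add le_rfl (mul_le_mul_of_nonneg_left ?_ (by positivity)))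
  refine add_le_add (mul_le_mul_of_nonneg_left hnorm hτ.le) (le_of_eq ?_)
  unfold cumResid
  exact Finset.sum_congr rfl fun s _ => by rw [he]

/-- The summed Bellman residuals of both agents along an episode. -/
noncomputable def residSum (G : Game H X A B) (φ : Fin H → X × A × B → Vec d)
    (πA : Fin H → Kernel (Vec d × X) A) (θ ϑ : Param H d) (ζ : Traj H X A B) : ℝ :=
  ∑ h, (|resid G (linFun φ θ) (mainVal φ θ) h (ζ h)| +
    |resid G (linFun φ ϑ) (boostVal φ πA θ ϑ) h (ζ h)|)

/-- The Young parameter `μ = 0.4 η / λ` gives the squared residuals the coefficient `λ μ / 2 = 0.2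
η`, the one they carry in `gain`, so that they cancel there. -/
theorem IsLinear.residSum_le (hl : IsLinear G φ) (hA : ∀ h, IsMarkovKernel (πA h))
    {θ ϑ : Param H d} (hθ : θ ∈ classSet φ) (hϑ : ϑ ∈ classSet φ) (hτ : 0 < τ) (hη : 0 < η)
    (hlam : 0 < lam) (S : Fin t → Traj H X A B) (ζ : Traj H X A B) :
    lam * residSum G φ πA θ ϑ ζ ≤ 4 * lam * (H + lam / (0.8 * η)) *
      (potential φ τ (Fin.snoc S ζ : Fin (t + 1) → Traj H X A B) - potential φ τ S) +
      0.2 * η * (∑ h, cumResid G (linFun φ θ) (mainVal φ θ) h S +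
        ∑ h, cumResid G (linFun φ ϑ) (boostVal φ πA θ ϑ) h S) +
      1.6 * η * τ * (H : ℝ) ^ 3 * d := by
  have hφ := hl.measurable_feature
  have hμ : 0 < 0.4 * η / lam := by positivity
  have hVm := valueFamily_mainVal hφ
  have hVb := valueFamily_boostVal hφ hA θ
  have k1 := fun h => hl.abs_resid_le_potential (hVm.measurable_right θ) (hVm.mem_Icc θ hθ) hθ hτ
    hμ h S ζ
  have k2 := fun h => hl.abs_resid_le_potential (hVb.measurable_right ϑ) (hVb.mem_Icc ϑ hϑ) hϑ hτ
    hμ h S ζ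
  have k3 := Finset.sum_le_sum fun h (_ : h ∈ Finset.univ) => add_le_add (k1 h) (k2 h)
  have k4 := mul_le_mul_of_nonneg_left k3 hlam.le
  refine k4.trans (le_of_eq ?_)
  simp only [Finset.sum_add_distrib, ← Finset.mul_sum, Finset.sum_sub_distrib, Finset.sum_const,
    Finset.card_univ, Fintype.card_fin, nsmul_eq_mul]
  change lam * ((H + 1 / (2 * (0.4 * η / lam))) * (2 *
    (potential φ τ (Fin.snoc S ζ : Fin (t + 1) → Traj H X A B) - potential φ τ S)) + _ +
    ((H + 1 / (2 * (0.4 * η / lam))) * (2 *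
    (potential φ τ (Fin.snoc S ζ : Fin (t + 1) → Traj H X A B) - potential φ τ S)) + _)) = _
  field_simp
  ring

section Measurability

variable {Y : Type*} [MeasurableSpace Y] {f g : Y → Param H d}

theorem measurable_residSum (hφ : ∀ h, Measurable (φ h)) (hf : Measurable f) (hg : Measurable g)
    {ζ : Y → Traj H X A B} (hζ : Measurable ζ) :
    Measurable fun y => residSum G φ πA (f y) (g y) (ζ y) := by
  refine Finset.measurable_sum _ fun h _ => ?_
  have h0 : Measurable fun y => (y, ζ y h) := by fun_prop
  have h1 := (measurable_resid G (q := fun y => linFun φ (f y))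
    (fun h => measurable_linFun_comp hφ (hf.comp measurable_fst) measurable_snd h)
    (V := fun y => mainVal φ (f y))
    (fun h => measurable_mainVal_comp hφ (hf.comp measurable_fst) measurable_snd h) h).comp h0
  have h2 := (measurable_resid G (q := fun y => linFun φ (g y))
    (fun h => measurable_linFun_comp hφ (hg.comp measurable_fst) measurable_snd h)
    (V := fun y => boostVal φ πA (f y) (g y))
    (fun h => measurable_boostVal_comp hφ (hf.comp measurable_fst) (hg.comp measurable_fst)
      measurable_snd h) h).comp h0
  have h3 := h1.abs.add h2.abs
  exact h3

end Measurability

theorem residSum_nonneg (θ ϑ : Param H d) (ζ : Traj H X A B) : 0 ≤ residSum G φ πA θ ϑ ζ :=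
  Finset.sum_nonneg fun _ _ => add_nonneg (abs_nonneg _) (abs_nonneg _)

theorem IsLinear.residSum_le_sq (hl : IsLinear G φ) (hA : ∀ h, IsMarkovKernel (πA h))
    {θ ϑ : Param H d} (hθ : θ ∈ classSet φ) (hϑ : ϑ ∈ classSet φ) (ζ : Traj H X A B) :
    residSum G φ πA θ ϑ ζ ≤ H * (H + H) := by
  have hVm := valueFamily_mainVal hl.measurable_feature
  have hVb := valueFamily_boostVal hl.measurable_feature hA θ
  refine (Finset.sum_le_sum fun h _ => add_le_add (abs_resid_le (hθ h) (hVm.mem_Icc θ hθ) (ζ h))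
    (abs_resid_le (hϑ h) (hVb.mem_Icc ϑ hϑ) (ζ h))).trans ?_
  simp [mul_add]

theorem IsLinear.ae_mainPosterior_mem (hl : IsLinear G φ) (S : Fin t → Traj H X A B) :
    ∀ᵐ θ ∂(mainPosterior G φ η lam t S), θ ∈ classSet φ := by
  have h1 : mainPosterior G φ η lam t S ≪ priorKernel φ _ S :=
    Kernel.withDensity_absolutelyContinuous _ _
  exact h1.ae_le hl.ae_pi_prior_mem

theorem IsLinear.ae_boosterPosterior_mem (hl : IsLinear G φ)
    (y : (Fin t → Traj H X A B) × Param H d) :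
    ∀ᵐ ϑ ∂(boosterPosterior G φ πA η lam t y), ϑ ∈ classSet φ := by
  have h1 : boosterPosterior G φ πA η lam t y ≪ priorKernel φ _ y :=
    Kernel.withDensity_absolutelyContinuous _ _
  exact h1.ae_le hl.ae_pi_prior_mem

theorem IsLinear.ae_nextLaw_mem (hl : IsLinear G φ) (hA : ∀ h, IsMarkovKernel (πA h))
    (hB : ∀ h, IsMarkovKernel (πB h)) (hη : 0 ≤ η) :
    ∀ᵐ y ∂(nextLaw G φ πA πB η lam t), y.2.1 ∈ classSet φ ∧ y.2.2.1 ∈ classSet φ := by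
  have hs : MeasurableSet {y : (Fin t → Rec H d X A B) × Rec H d X A B |
      y.2.1 ∈ classSet φ ∧ y.2.2.1 ∈ classSet φ} :=
    (measurableSet_classSet.preimage (by fun_prop : Measurable fun y : (Fin t → Rec H d X A B) ×
      Rec H d X A B => y.2.1)).inter (measurableSet_classSet.preimage (by fun_prop : Measurable
      fun y : (Fin t → Rec H d X A B) × Rec H d X A B => y.2.2.1))
  rw [ae_iff]
  change nextLaw G φ πA πB η lam t {y | y.2.1 ∈ classSet φ ∧ y.2.2.1 ∈ classSet φ}ᶜ = 0
  rw [← lintegral_indicator_one hs.compl]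
  refine (hl.lintegral_nextLaw hA hB hη (measurable_one.indicator hs.compl)).trans ?_
  rw [← lintegral_zero (μ := runLaw G φ πA πB η lam t)]
  refine lintegral_congr fun ω => ?_
  rw [← lintegral_zero (μ := mainPosterior G φ η lam t (trajs ω))]
  refine lintegral_congr_ae ?_
  filter_upwards [hl.ae_mainPosterior_mem (trajs ω)] with θ hθ
  rw [← lintegral_zero (μ := boosterPosterior G φ πA η lam t (trajs ω, θ))]
  refine lintegral_congr_ae ?_
  filter_upwards [hl.ae_boosterPosterior_mem (trajs ω, θ)] with ϑ hϑ
  rw [← lintegral_zero (μ := episode G πA πB (θ, ϑ))]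
  refine lintegral_congr fun ζ => ?_
  have hin : (ω, θ, ϑ, ζ) ∈ {y : (Fin t → Rec H d X A B) × Rec H d X A B |
      y.2.1 ∈ classSet φ ∧ y.2.2.1 ∈ classSet φ} := ⟨hθ, hϑ⟩
  exact Set.indicator_of_notMem (Set.notMem_compl_iff.2 hin) _

/-- The expected gap between the two agents' value estimates is at most the expected sum of Bellman
residuals. -/
theorem IsLinear.integral_valueGap_le (hl : IsLinear G φ) (hA : IsMainRule φ πA)
    (hB : IsBoosterRule φ πA πB) (hη : 0 ≤ η) :
    ∫ y, (mainVal φ y.2.1 0 G.x₁ - boostVal φ πA y.2.1 y.2.2.1 0 G.x₁)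
      ∂(nextLaw G φ πA πB η lam t) ≤
    ∫ y, residSum G φ πA y.2.1 y.2.2.1 y.2.2.2 ∂(nextLaw G φ πA πB η lam t) ∧
    Integrable (fun y : (Fin t → Rec H d X A B) × Rec H d X A B =>
      mainVal φ y.2.1 0 G.x₁ - boostVal φ πA y.2.1 y.2.2.1 0 G.x₁) (nextLaw G φ πA πB η lam t) ∧
    Integrable (fun y : (Fin t → Rec H d X A B) × Rec H d X A B =>
      residSum G φ πA y.2.1 y.2.2.1 y.2.2.2) (nextLaw G φ πA πB η lam t) := by
  have hφ := hl.measurable_feature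
  have hAm := hA.markov
  have hBm := hB.markov
  have := hl.isProbabilityMeasure_nextLaw (t := t) (lam := lam) hAm hBm hη
  have := isMarkovKernel_episode (G := G) (d := d) hAm hBm
  have p1 : Measurable fun y : (Fin t → Rec H d X A B) × Rec H d X A B => y.2.1 := by fun_prop
  have p2 : Measurable fun y : (Fin t → Rec H d X A B) × Rec H d X A B => y.2.2.1 := by fun_prop
  have p3 : Measurable fun y : (Fin t → Rec H d X A B) × Rec H d X A B => y.2.2.2 := by fun_prop
  have m1 : Measurable fun y : (Fin t → Rec H d X A B) × Rec H d X A B =>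
      mainVal φ y.2.1 0 G.x₁ - boostVal φ πA y.2.1 y.2.2.1 0 G.x₁ :=
    (measurable_mainVal_comp hφ p1 measurable_const 0).sub
      (measurable_boostVal_comp hφ p1 p2 measurable_const 0)
  have m2 : Measurable fun y : (Fin t → Rec H d X A B) × Rec H d X A B =>
      residSum G φ πA y.2.1 y.2.2.1 y.2.2.2 := measurable_residSum hφ p1 p2 p3
  have hgap : ∀ θ ∈ classSet φ, ∀ ϑ ∈ classSet φ,
      |mainVal φ θ 0 G.x₁ - boostVal φ πA θ ϑ 0 G.x₁| ≤ H := by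
    intro θ hθ ϑ hϑ
    have h1 := (valueFamily_mainVal hφ).mem_Icc_horizon hθ 0 G.x₁
    have h2 := (valueFamily_boostVal hφ hAm θ).mem_Icc_horizon hϑ 0 G.x₁
    exact abs_le.2 ⟨by linarith [h1.1, h2.2], by linarith [h1.2, h2.1]⟩
  have hmem := hl.ae_nextLaw_mem (t := t) (lam := lam) hAm hBm hη
  have i1 : Integrable (fun y : (Fin t → Rec H d X A B) × Rec H d X A B =>
      mainVal φ y.2.1 0 G.x₁ - boostVal φ πA y.2.1 y.2.2.1 0 G.x₁)
      (nextLaw G φ πA πB η lam t) := by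
    refine .of_bound m1.aestronglyMeasurable H ?_
    filter_upwards [hmem] with y hy
    exact (Real.norm_eq_abs _).trans_le (hgap _ hy.1 _ hy.2)
  have i2 : Integrable (fun y : (Fin t → Rec H d X A B) × Rec H d X A B =>
      residSum G φ πA y.2.1 y.2.2.1 y.2.2.2) (nextLaw G φ πA πB η lam t) := by
    refine .of_bound m2.aestronglyMeasurable (H * (H + H)) ?_
    filter_upwards [hmem] with y hy
    rw [Real.norm_eq_abs, abs_of_nonneg (residSum_nonneg _ _ _)]
    exact hl.residSum_le_sq hAm hy.1 hy.2 _
  refine ⟨?_, i1, i2⟩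
  -- The value gap is at least `-H`; the shift by `H` makes both sides nonnegative, so the
  -- disintegration of the law for nonnegative functions can be used.
  have hlin : ∫⁻ y, ENNReal.ofReal (mainVal φ y.2.1 0 G.x₁ - boostVal φ πA y.2.1 y.2.2.1 0 G.x₁ + H)
      ∂(nextLaw G φ πA πB η lam t) ≤
      ∫⁻ y, ENNReal.ofReal (residSum G φ πA y.2.1 y.2.2.1 y.2.2.2 + H)
        ∂(nextLaw G φ πA πB η lam t) := by
    refine (hl.lintegral_nextLaw hAm hBm hη (m1.add_const _).ennreal_ofReal).le.trans ?_
    refine le_trans ?_ (hl.lintegral_nextLaw hAm hBm hη (m2.add_const _).ennreal_ofReal).ge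
    refine lintegral_mono fun ω => lintegral_mono_ae ?_
    filter_upwards [hl.ae_mainPosterior_mem (trajs ω)] with θ hθ
    refine lintegral_mono_ae ?_
    filter_upwards [hl.ae_boosterPosterior_mem (trajs ω, θ)] with ϑ hϑ
    have m3 : Measurable fun ζ : Traj H X A B => residSum G φ πA θ ϑ ζ :=
      measurable_residSum hφ measurable_const measurable_const measurable_id
    have i3 : Integrable (fun ζ => residSum G φ πA θ ϑ ζ) (episode G πA πB (θ, ϑ)) := by
      refine .of_bound m3.aestronglyMeasurable (H * (H + H)) (.of_forall fun ζ => ?_)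
      rw [Real.norm_eq_abs, abs_of_nonneg (residSum_nonneg _ _ _)]
      exact hl.residSum_le_sq hAm hθ hϑ _
    have i4 : Integrable (fun ζ => residSum G φ πA θ ϑ ζ + (H : ℝ)) (episode G πA πB (θ, ϑ)) :=
      i3.add (integrable_const _)
    rw [← ofReal_integral_eq_lintegral_ofReal i4
      (.of_forall fun ζ => add_nonneg (residSum_nonneg _ _ _) (Nat.cast_nonneg H))]
    simp only [lintegral_const, measure_univ, mul_one]
    refine ENNReal.ofReal_le_ofReal ?_
    rw [integral_add i3 (integrable_const _)]
    simp only [integral_const, probReal_univ, smul_eq_mul, one_mul]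
    exact add_le_add (mainVal_sub_boostVal_le hφ hA hB hθ hϑ) le_rfl
  have i5 : Integrable (fun y : (Fin t → Rec H d X A B) × Rec H d X A B =>
      mainVal φ y.2.1 0 G.x₁ - boostVal φ πA y.2.1 y.2.2.1 0 G.x₁ + (H : ℝ))
      (nextLaw G φ πA πB η lam t) := i1.add (integrable_const _)
  have i6 : Integrable (fun y : (Fin t → Rec H d X A B) × Rec H d X A B =>
      residSum G φ πA y.2.1 y.2.2.1 y.2.2.2 + (H : ℝ)) (nextLaw G φ πA πB η lam t) :=
    i2.add (integrable_const _)
  rw [← ofReal_integral_eq_lintegral_ofReal i5, ← ofReal_integral_eq_lintegral_ofReal i6] at hlin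
  · rw [ENNReal.ofReal_le_ofReal_iff (integral_nonneg fun y =>
      add_nonneg (residSum_nonneg _ _ _) (Nat.cast_nonneg H)), integral_add i1 (integrable_const _),
      integral_add i2 (integrable_const _)] at hlin
    linarith
  · exact .of_forall fun y => add_nonneg (residSum_nonneg _ _ _) (Nat.cast_nonneg H)
  · filter_upwards [hmem] with y hy
    have := (abs_le.1 (hgap _ hy.1 _ hy.2)).1
    simp only [Pi.zero_apply]
    linarith

end StageBound

/-! ### From one stage to the whole run. -/

section RunBound

variable {H d : ℕ} {X A B : Type*} [MeasurableSpace X] [MeasurableSpace A] [MeasurableSpace B]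
  [Fintype A] [Fintype B] [Nonempty A] [Nonempty B] [DiscreteMeasurableSpace A]
  [DiscreteMeasurableSpace B] [NeZero H] {G : Game H X A B} {φ : Fin H → X × A × B → Vec d}
  {πA : Fin H → Kernel (Vec d × X) A} {πB : Fin H → Kernel ((Vec d × Vec d) × X) B} {t : ℕ}
  {η lam τ ε : ℝ} {K : ℝ} {θ₀ : Param H d} {g₀ : Param H d → Param H d}

/-- The gap between the value of the reference parameter `θ₀` and the booster's value of `g₀ θ`. -/
noncomputable def refGap (G : Game H X A B) (φ : Fin H → X × A × B → Vec d)
    (πA : Fin H → Kernel (Vec d × X) A) (θ₀ : Param H d) (g₀ : Param H d → Param H d)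
    (θ : Param H d) : ℝ :=
  mainVal φ θ₀ 0 G.x₁ - boostVal φ πA θ (g₀ θ) 0 G.x₁

theorem measurable_refGap (hφ : ∀ h, Measurable (φ h)) (hg₀ : Measurable g₀) :
    Measurable (refGap G φ πA θ₀ g₀) :=
  (measurable_boostVal_comp (πA := πA) hφ measurable_id hg₀ (measurable_const (a := G.x₁))
    0).const_sub _

theorem abs_refGap_le (hφ : ∀ h, Measurable (φ h)) (hA : ∀ h, IsMarkovKernel (πA h))
    (hθ₀ : θ₀ ∈ classSet φ) (hg₀ : ∀ θ, g₀ θ ∈ classSet φ) (θ : Param H d) :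
    |refGap G φ πA θ₀ g₀ θ| ≤ H := by
  have h1 := (valueFamily_mainVal hφ).mem_Icc_horizon hθ₀ 0 G.x₁
  have h2 := (valueFamily_boostVal hφ hA θ).mem_Icc_horizon (hg₀ θ) 0 G.x₁
  exact abs_le.2 ⟨by unfold refGap; linarith [h1.1, h2.2], by unfold refGap; linarith [h1.2, h2.1]⟩

theorem sum_cumResid_mem {V : Fin H → X → ℝ}
    (hVR : ∀ (h : Fin H) x, V h x ∈ Set.Icc (0 : ℝ) (H - (h : ℕ))) {θ : Param H d}
    (hθ : θ ∈ classSet φ) (S : Fin t → Traj H X A B) :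
    ∑ h, cumResid G (linFun φ θ) V h S ∈ Set.Icc (0 : ℝ) (H * (t * (H : ℝ) ^ 2)) := by
  refine ⟨Finset.sum_nonneg fun h _ => Finset.sum_nonneg fun s _ => sq_nonneg _, ?_⟩
  refine (Finset.sum_le_sum (g := fun _ => (t : ℝ) * (H : ℝ) ^ 2) fun h _ =>
    (Finset.sum_le_sum (g := fun _ => (H : ℝ) ^ 2) fun s _ => ?_).trans ?_).trans ?_
  · exact sq_le_sq' (abs_le.1 (abs_resid_le (hθ h) hVR (S s h))).1
      (abs_le.1 (abs_resid_le (hθ h) hVR (S s h))).2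
  · simp
  · simp

theorem IsLinear.integrable_gain (hl : IsLinear G φ) (hA : ∀ h, IsMarkovKernel (πA h))
    (hB : ∀ h, IsMarkovKernel (πB h)) (hη : 0 ≤ η) (hθ₀ : θ₀ ∈ classSet φ) (hg₀ : Measurable g₀)
    (hg₀m : ∀ θ, g₀ θ ∈ classSet φ) :
    Integrable (fun y : (Fin t → Rec H d X A B) × Rec H d X A B =>
      gain G φ πA η lam θ₀ g₀ (trajs y.1) y.2.1 y.2.2.1) (nextLaw G φ πA πB η lam t) := by
  have hφ := hl.measurable_feature
  have := hl.isProbabilityMeasure_nextLaw (t := t) (lam := lam) hA hB hη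
  have p1 : Measurable fun y : (Fin t → Rec H d X A B) × Rec H d X A B => y.2.1 := by fun_prop
  have p2 : Measurable fun y : (Fin t → Rec H d X A B) × Rec H d X A B => y.2.2.1 := by fun_prop
  have p3 : Measurable fun y : (Fin t → Rec H d X A B) × Rec H d X A B => trajs y.1 :=
    measurable_trajs.comp measurable_fst
  have m := measurable_gain (G := G) (πA := πA) (η := η) (lam := lam) hφ θ₀ hg₀ p1 p2 p3
  refine .of_bound m.aestronglyMeasurable (|lam| * H + |lam| * H +
    0.2 * η * (H * (t * (H : ℝ) ^ 2) + H * (t * (H : ℝ) ^ 2))) ?_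
  filter_upwards [hl.ae_nextLaw_mem (t := t) (lam := lam) hA hB hη] with y hy
  have hVm := valueFamily_mainVal (A := A) (B := B) (X := X) hφ
  have hVb := valueFamily_boostVal hφ hA y.2.1
  have b1 := hVm.mem_Icc_horizon hθ₀ 0 G.x₁
  have b2 := hVm.mem_Icc_horizon hy.1 0 G.x₁
  have b3 := hVb.mem_Icc_horizon hy.2 0 G.x₁
  have b4 := hVb.mem_Icc_horizon (hg₀m y.2.1) 0 G.x₁
  have r1 := sum_cumResid_mem (G := G) (hVm.mem_Icc _ hy.1) hy.1 (trajs y.1)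
  have r2 := sum_cumResid_mem (G := G) (hVb.mem_Icc _ hy.2) hy.2 (trajs y.1)
  unfold gain
  refine (norm_add_le _ _).trans (add_le_add ((norm_add_le _ _).trans (add_le_add ?_ ?_)) ?_)
  · rw [norm_mul]
    exact mul_le_mul_of_nonneg_left (abs_le.2 ⟨by linarith [b1.1, b2.2], by linarith [b1.2, b2.1]⟩)
      (norm_nonneg _)
  · rw [norm_mul]
    exact mul_le_mul_of_nonneg_left (abs_le.2 ⟨by linarith [b3.1, b4.2], by linarith [b3.2, b4.1]⟩)
      (norm_nonneg _)
  · rw [norm_mul, Real.norm_eq_abs, Real.norm_eq_abs, abs_of_nonneg (by positivity : 0 ≤ 0.2 * η),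
      abs_of_nonneg (add_nonneg r1.1 r2.1)]
    exact mul_le_mul_of_nonneg_left (add_le_add r1.2 r2.2) (by positivity)

/-- The bound on one stage of the algorithm. -/
theorem IsLinear.integral_refGap_sub_le (hl : IsLinear G φ) (hA : IsMainRule φ πA)
    (hB : IsBoosterRule φ πA πB) (hη : 0 < η) (hηH : 4 * η * (H : ℝ) ^ 2 ≤ 1.6) (hlam : 0 < lam)
    (hε : 0 < ε) (hK : kappa G φ πA ε ≤ K) (hθ₀ : θ₀ ∈ classSet φ)
    (hfix : ∀ h z, linFun φ θ₀ h z = G.r h z + nextMean G.P (mainVal φ θ₀) h z)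
    (hg₀ : Measurable g₀) (hg₀m : ∀ θ, g₀ θ ∈ classSet φ)
    (hgfix : ∀ θ h z, linFun φ (g₀ θ) h z =
      G.r h z + nextMean G.P (boostVal φ πA θ (g₀ θ)) h z) (hτ : 0 < τ)
    (hint : Integrable (fun y : (Fin t → Rec H d X A B) × Rec H d X A B =>
      lam * refGap G φ πA θ₀ g₀ y.2.1 - 4 * lam * (H + lam / (0.8 * η)) *
        (potential φ τ (Fin.snoc (trajs y.1) y.2.2.2 : Fin (t + 1) → Traj H X A B) -
          potential φ τ (trajs y.1))) (nextLaw G φ πA πB η lam t)) :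
    ∫ y, (lam * refGap G φ πA θ₀ g₀ y.2.1 - 4 * lam * (H + lam / (0.8 * η)) *
        (potential φ τ (Fin.snoc (trajs y.1) y.2.2.2 : Fin (t + 1) → Traj H X A B) -
          potential φ τ (trajs y.1))) ∂(nextLaw G φ πA πB η lam t) ≤
      4 * K + 4 * slack H t η ε + 2 * (lam * ε) + 1.6 * η * τ * (H : ℝ) ^ 3 * d := by
  have hAm := hA.markov
  have hBm := hB.markov
  have := hl.isProbabilityMeasure_nextLaw (t := t) (lam := lam) hAm hBm hη.le
  set c₀ := 4 * K + 4 * slack H t η ε + 2 * (lam * ε) with hc₀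
  set c₃ := 1.6 * η * τ * (H : ℝ) ^ 3 * d with hc₃
  have i1 := hl.integrable_gain (t := t) (lam := lam) hAm hBm hη.le hθ₀ hg₀ hg₀m
  obtain ⟨gap, i2, i3⟩ := hl.integral_valueGap_le (t := t) (lam := lam) hA hB hη.le
  have i4 : Integrable (fun y : (Fin t → Rec H d X A B) × Rec H d X A B =>
      (gain G φ πA η lam θ₀ g₀ (trajs y.1) y.2.1 y.2.2.1 - c₀) / 2)
      (nextLaw G φ πA πB η lam t) := (i1.sub (integrable_const c₀)).div_const 2
  have hexp := hl.lintegral_exp_gain_le (t := t) (lam := lam) hA hBm hη.le hηH hlam.le hε hK hθ₀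
    hfix hg₀ hg₀m hgfix
  have g1 := integral_nonpos_of_lintegral_exp_le i4 hexp
  have i5 : Integrable (fun y : (Fin t → Rec H d X A B) × Rec H d X A B =>
      2 * ((gain G φ πA η lam θ₀ g₀ (trajs y.1) y.2.1 y.2.2.1 - c₀) / 2) +
        lam * (mainVal φ y.2.1 0 G.x₁ - boostVal φ πA y.2.1 y.2.2.1 0 G.x₁))
      (nextLaw G φ πA πB η lam t) := (i4.const_mul 2).add (i2.const_mul lam)
  have i6 : Integrable (fun y : (Fin t → Rec H d X A B) × Rec H d X A B =>
      2 * ((gain G φ πA η lam θ₀ g₀ (trajs y.1) y.2.1 y.2.2.1 - c₀) / 2) +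
        lam * (mainVal φ y.2.1 0 G.x₁ - boostVal φ πA y.2.1 y.2.2.1 0 G.x₁) -
        lam * residSum G φ πA y.2.1 y.2.2.1 y.2.2.2)
      (nextLaw G φ πA πB η lam t) := i5.sub (i3.const_mul lam)
  -- The three value gaps add up to the reference gap, and the past squared residuals of `gain`
  -- cancel those produced by the elliptic potential.
  refine (integral_mono_ae hint (i6.add (integrable_const (c₀ + c₃))) ?_).trans ?_
  · filter_upwards [hl.ae_nextLaw_mem (t := t) (lam := lam) hAm hBm hη.le] with y hy
    have key := hl.residSum_le hAm hy.1 hy.2 hτ hη hlam (trajs y.1) y.2.2.2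
    simp only [Pi.add_apply]
    unfold gain refGap
    linarith
  · have e1 := integral_add i6 (integrable_const (c₀ + c₃))
    have e2 := integral_sub i5 (i3.const_mul lam)
    have e3 := integral_add (i4.const_mul 2) (i2.const_mul lam)
    refine e1.trans_le ?_
    rw [e2, e3, integral_const_mul, integral_const_mul, integral_const_mul]
    simp only [integral_const, probReal_univ, smul_eq_mul, one_mul]
    have := mul_le_mul_of_nonneg_left gap hlam.le
    linarith

theorem slack_mono (hη : 0 ≤ η) (hε : 0 ≤ ε) {s t : ℕ} (hst : s ≤ t) :
    slack H s η ε ≤ slack H t η ε := by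
  have : (s : ℝ) ≤ t := by exact_mod_cast hst
  unfold slack
  gcongr

theorem IsLinear.integrable_sum_refGap_sub_potential (hl : IsLinear G φ) (hτ : 0 < τ)
    (hA : ∀ h, IsMarkovKernel (πA h))
    (hθ₀ : θ₀ ∈ classSet φ) (hg₀ : Measurable g₀) (hg₀m : ∀ θ, g₀ θ ∈ classSet φ) (c : ℝ)
    (m : Measure (Fin t → Rec H d X A B)) [IsFiniteMeasure m] :
    Integrable (fun ω : Fin t → Rec H d X A B => lam * ∑ s, refGap G φ πA θ₀ g₀ (ω s).1 -
      c * (potential φ τ (trajs ω) - H * (d * Real.log τ))) m := by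
  have hφ := hl.measurable_feature
  have m1 : Measurable fun ω : Fin t → Rec H d X A B => ∑ s, refGap G φ πA θ₀ g₀ (ω s).1 :=
    Finset.measurable_sum _ fun s _ => (measurable_refGap hφ hg₀).comp (by fun_prop :
      Measurable fun ω : Fin t → Rec H d X A B => (ω s).1)
  have m2 : Measurable fun ω : Fin t → Rec H d X A B => potential φ τ (trajs ω) :=
    (measurable_potential hφ).comp measurable_trajs
  have i1 : Integrable (fun ω : Fin t → Rec H d X A B => ∑ s, refGap G φ πA θ₀ g₀ (ω s).1) m := by
    refine .of_bound m1.aestronglyMeasurable (∑ _s : Fin t, (H : ℝ)) (.of_forall fun ω => ?_)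
    exact norm_sum_le_of_le _ fun s _ => abs_refGap_le hφ hA hθ₀ hg₀m _
  have hd : 0 < d := by
    have := hl.one_le_dim (0 : Fin H)
    exact_mod_cast zero_lt_one.trans_le this
  have i2 : Integrable (fun ω : Fin t → Rec H d X A B =>
      potential φ τ (trajs ω) - H * (d * Real.log τ)) m := by
    refine .of_bound (m2.sub_const _).aestronglyMeasurable
      (H * (d * Real.log (τ * d + t)) - H * (d * Real.log τ)) (.of_forall fun ω => ?_)
    rw [Real.norm_eq_abs, abs_of_nonneg (by linarith [le_potential (φ := φ) hτ (trajs ω)])]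
    linarith [potential_le hl.norm_feature_le hτ hd (trajs ω)]
  exact (i1.const_mul lam).sub (i2.const_mul c)

/-- The bound on the whole run of the algorithm. -/
theorem IsLinear.integral_runLaw_le (hl : IsLinear G φ) (hA : IsMainRule φ πA)
    (hB : IsBoosterRule φ πA πB) (hη : 0 < η) (hηH : 4 * η * (H : ℝ) ^ 2 ≤ 1.6) (hlam : 0 < lam)
    (hε : 0 < ε) (hK : kappa G φ πA ε ≤ K) (hθ₀ : θ₀ ∈ classSet φ)
    (hfix : ∀ h z, linFun φ θ₀ h z = G.r h z + nextMean G.P (mainVal φ θ₀) h z)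
    (hg₀ : Measurable g₀) (hg₀m : ∀ θ, g₀ θ ∈ classSet φ)
    (hgfix : ∀ θ h z, linFun φ (g₀ θ) h z =
      G.r h z + nextMean G.P (boostVal φ πA θ (g₀ θ)) h z) (hτ : 0 < τ) (T : ℕ) : ∀ t ≤ T,
    ∫ ω, (lam * ∑ s, refGap G φ πA θ₀ g₀ (ω s).1 - 4 * lam * (H + lam / (0.8 * η)) *
      (potential φ τ (trajs ω) - H * (d * Real.log τ))) ∂(runLaw G φ πA πB η lam t) ≤
      t * (4 * K + 4 * slack H T η ε + 2 * (lam * ε) + 1.6 * η * τ * (H : ℝ) ^ 3 * d)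
  | 0, _ => by simp [potential_zero]
  | t + 1, ht => by
    have hAm := hA.markov
    have hBm := hB.markov
    have ih := hl.integral_runLaw_le hA hB hη hηH hlam hε hK hθ₀ hfix hg₀ hg₀m hgfix hτ T t
      (Nat.le_of_succ_le ht)
    have := hl.isProbabilityMeasure_nextLaw (t := t) (lam := lam) hAm hBm hη.le
    have := hl.isProbabilityMeasure_runLaw (lam := lam) hAm hBm hη.le t
    have := hl.isProbabilityMeasure_runLaw (lam := lam) hAm hBm hη.le (t + 1)
    have := hl.isMarkovKernel_stage (lam := lam) (t := t) hAm hBm hη.le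
    set c := 4 * lam * (H + lam / (0.8 * η)) with hc
    have I1 := hl.integrable_sum_refGap_sub_potential (lam := lam) (t := t + 1) hτ hAm hθ₀ hg₀ hg₀m c
      (runLaw G φ πA πB η lam (t + 1))
    have I0 := hl.integrable_sum_refGap_sub_potential (lam := lam) (t := t) hτ hAm hθ₀ hg₀ hg₀m c
      (runLaw G φ πA πB η lam t)
    -- The integrals for `t` and `t + 1` episodes are both pulled back to the joint law of past and
    -- next record, where their difference is the quantity of a single stage.
    have hfst : (nextLaw G φ πA πB η lam t).map Prod.fst = runLaw G φ πA πB η lam t :=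
      Measure.fst_compProd _ _
    rw [runLaw_succ] at I1 ⊢
    have e1 := integral_map measurable_snoc.aemeasurable I1.aestronglyMeasurable
    have J1 := I1.comp_measurable measurable_snoc
    rw [← hfst] at I0 ih
    have e0 := integral_map measurable_fst.aemeasurable I0.aestronglyMeasurable
    have J0 := I0.comp_measurable measurable_fst
    rw [e0] at ih
    have hstep : ∀ y : (Fin t → Rec H d X A B) × Rec H d X A B,
        (lam * refGap G φ πA θ₀ g₀ y.2.1 - c *
        (potential φ τ (Fin.snoc (trajs y.1) y.2.2.2 : Fin (t + 1) → Traj H X A B) -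
          potential φ τ (trajs y.1))) =
        (lam * ∑ s, refGap G φ πA θ₀ g₀
          ((Fin.snoc y.1 y.2 : Fin (t + 1) → Rec H d X A B) s).1 -
          c * (potential φ τ (trajs (Fin.snoc y.1 y.2 : Fin (t + 1) → Rec H d X A B)) -
            H * (d * Real.log τ))) -
        (lam * ∑ s, refGap G φ πA θ₀ g₀ (y.1 s).1 -
          c * (potential φ τ (trajs y.1) - H * (d * Real.log τ))) := by
      intro y
      have h1 : trajs (Fin.snoc y.1 y.2 : Fin (t + 1) → Rec H d X A B) =
          (Fin.snoc (trajs y.1) y.2.2.2 : Fin (t + 1) → Traj H X A B) := by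
        funext s
        refine Fin.lastCases ?_ (fun s => ?_) s
        · simp [trajs]
        · simp [trajs]
      rw [h1, Fin.sum_univ_castSucc (n := t)]
      simp only [Fin.snoc_castSucc, Fin.snoc_last]
      ring
    have hint : Integrable (fun y : (Fin t → Rec H d X A B) × Rec H d X A B =>
        lam * refGap G φ πA θ₀ g₀ y.2.1 - c *
        (potential φ τ (Fin.snoc (trajs y.1) y.2.2.2 : Fin (t + 1) → Traj H X A B) -
          potential φ τ (trajs y.1))) (nextLaw G φ πA πB η lam t) := by
      have := J1.sub J0
      refine this.congr (.of_forall fun y => ?_)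
      exact (hstep y).symm
    have key := hl.integral_refGap_sub_le hA hB hη hηH hlam hε hK hθ₀ hfix hg₀ hg₀m hgfix hτ hint
    have e2 := integral_sub J1 J0
    have e3 : ∫ y, (lam * refGap G φ πA θ₀ g₀ y.2.1 - c *
        (potential φ τ (Fin.snoc (trajs y.1) y.2.2.2 : Fin (t + 1) → Traj H X A B) -
          potential φ τ (trajs y.1))) ∂(nextLaw G φ πA πB η lam t) = _ :=
      (integral_congr_ae (.of_forall hstep)).trans e2
    rw [e3] at key
    simp only [Function.comp_def] at key
    -- The slack of a stage grows with the amount of data; the final horizon `T` bounds it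
    -- uniformly.
    have hsl := slack_mono (H := H) hη.le hε.le (Nat.le_of_succ_le ht)
    refine e1.trans_le ?_
    push_cast
    linarith

end RunBound

/-! ### Arithmetic of the rate. -/

/-- The rate that results from the bound on the whole run. -/
theorem regret_rate {h d n K lam R L : ℝ} (hh : 1 ≤ h) (hd : 1 ≤ d)
    (hn : 16 * d * h ^ 2 < n) (hK : 2 / 5 ≤ K) (hlam : 0 < lam) {ℓ : ℝ} (hL : 0.69 ≤ L)
    (hℓ : 0 < ℓ) (hℓL : ℓ ≤ 4 * L) (hKL : K ≤ 4 * (h * d * L))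
    (hlam2 : lam ^ 2 * (d * h ^ 3 * ℓ) = n * K)
    (hR : lam * R ≤ 4 * lam * (h + lam / (0.8 * (0.4 / h ^ 2))) * (2 * (h * d * ℓ)) +
      n * (4 * K + 4 * (h * (0.4 / h ^ 2 * (n * (2 * (h / n ^ 2) * (3 * h))))) +
        2 * (lam * (h / n ^ 2)) + 1.6 * (0.4 / h ^ 2) * (1 / n) * h ^ 3 * d)) :
    R ≤ 300 * (h ^ 2 * d * √n * L) := by
  have hh0 : 0 < h := by linarith
  have hd0 : 0 < d := by linarith
  have hL0 : 0 < L := by linarith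
  have hhd : h * d ≤ d * h ^ 2 := by nlinarith [mul_pos hh0 hd0]
  have hd1 : 1 ≤ h * d := by nlinarith
  have hdn : h * d ≤ n := by linarith
  have hn1 : 1 ≤ n := hd1.trans hdn
  have hn0 : 0 < n := by linarith
  set s := √n with hs
  have hs2 : s ^ 2 = n := Real.sq_sqrt hn0.le
  have hs1 : 1 ≤ s := Real.one_le_sqrt.2 hn1
  have hs0 : 0 < s := by linarith
  set E := h ^ 2 * d * s * L with hE
  have hE0 : 0 < E := by positivity
  have hh2 : 1 ≤ h ^ 2 := one_le_pow₀ hh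
  have hDL : h ^ 2 * d * L ≤ E := by
    have := mul_le_mul_of_nonneg_left hs1 (by positivity : 0 ≤ h ^ 2 * d * L)
    calc h ^ 2 * d * L ≤ h ^ 2 * d * L * s := by linarith
      _ = E := by rw [hE]; ring
  have hone : 1 ≤ 2 * E := by
    have h1 : 1 ≤ h ^ 2 * d := by nlinarith
    nlinarith
  -- the leading quantity
  have hD : lam * (d * h ^ 3 * ℓ) ≤ 4 * E := by
    refine le_of_abs_le (abs_le_of_sq_le_sq ?_ (by positivity))
    calc (lam * (d * h ^ 3 * ℓ)) ^ 2 = (lam ^ 2 * (d * h ^ 3 * ℓ)) * (d * h ^ 3 * ℓ) := by ring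
      _ = n * K * (d * h ^ 3 * ℓ) := by rw [hlam2]
      _ ≤ n * (4 * (h * d * L)) * (d * h ^ 3 * (4 * L)) := by gcongr
      _ = (4 * E) ^ 2 := by rw [hE, ← hs2]; ring
  -- Only here is the lower bound on `K` used: it keeps `λ` from being too small for the terms that
  -- carry `1 / λ` alone.
  have hinv : 1 / lam * (h * d) ≤ 10 * E := by
    have h1 : 1 / lam = lam * (d * h ^ 3 * ℓ) / (n * K) := by
      rw [← hlam2]
      field_simp
    have h2 : h * d / (n * K) ≤ 5 / 2 := by
      rw [div_le_iff₀ (by positivity)]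
      nlinarith
    calc 1 / lam * (h * d) = lam * (d * h ^ 3 * ℓ) * (h * d / (n * K)) := by rw [h1]; ring
      _ ≤ 4 * E * (5 / 2) := by gcongr
      _ = 10 * E := by ring
  have hnK : n * K / lam = lam * (d * h ^ 3 * ℓ) := by
    rw [← hlam2]
    field_simp
  -- Division of the hypothesis by `λ`. With the bounds that follow, the terms contribute at most
  -- `32 + 100 + 16 + 96 + 6.4 + 4` multiples of `E`, which is below `300`.
  have hmain : R ≤ 8 * (h ^ 2 * d * ℓ) + 25 * (lam * (d * h ^ 3 * ℓ)) + 4 * (n * K / lam) +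
      9.6 * (1 / lam * h) + 0.64 * (1 / lam * (h * d)) + 2 * (h / n) := by
    refine le_of_mul_le_mul_left (hR.trans (le_of_eq ?_)) hlam
    field_simp
    ring
  have e1 : 1 / lam * h ≤ 1 / lam * (h * d) := by
    gcongr
    nlinarith
  have e2 : h / n ≤ 1 := (div_le_one hn0).2 (by nlinarith)
  have e3 : h ^ 2 * d * ℓ ≤ 4 * (h ^ 2 * d * L) := by
    calc h ^ 2 * d * ℓ ≤ h ^ 2 * d * (4 * L) := by gcongr
      _ = _ := by ring
  rw [hnK] at hmain
  linarith

/-- In the regime of few episodes the trivial bound suffices. -/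
theorem trivial_regret_rate {h d n L : ℝ} (hh : 0 ≤ h) (hd : 1 ≤ d) (hn : 0 ≤ n)
    (hnd : n ≤ 16 * d * h ^ 2) (hL : 0.69 ≤ L) : h * n ≤ 300 * (h ^ 2 * d * √n * L) := by
  have h1 : √n ≤ 4 * (d * h) := by
    rw [Real.sqrt_le_left (by positivity)]
    nlinarith [mul_nonneg (by linarith : (0 : ℝ) ≤ d - 1) (by positivity : 0 ≤ d * h ^ 2)]
  have h2 : h * n = h * √n * √n := by rw [mul_assoc, Real.mul_self_sqrt hn]
  have h3 : 0 ≤ h ^ 2 * d * √n := by positivity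
  have h4 : h * √n * √n ≤ h * √n * (4 * (d * h)) := by gcongr
  nlinarith

/-! ### The regret bound. -/

section Regret

variable {H d : ℕ} {X A B : Type*} [MeasurableSpace X] [MeasurableSpace A] [MeasurableSpace B]
  [Fintype A] [Fintype B] [Nonempty A] [Nonempty B] [DiscreteMeasurableSpace A]
  [DiscreteMeasurableSpace B] [NeZero H] {G : Game H X A B} {φ : Fin H → X × A × B → Vec d}
  {πA : Fin H → Kernel (Vec d × X) A} {πB : Fin H → Kernel ((Vec d × Vec d) × X) B} {T : ℕ}
  {η lam : ℝ}

theorem IsLinear.exists_main_fixedPoint (hl : IsLinear G φ) : ∃ θ₀ ∈ classSet φ,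
    ∀ h z, linFun φ θ₀ h z = G.r h z + nextMean G.P (mainVal φ θ₀) h z := by
  have hφ := hl.measurable_feature
  obtain ⟨g, -, hg⟩ := hl.exists_fixedPoint (Y := Unit) (fun _ h ϑ x => gameValue (qmat φ h ϑ x))
    (fun h => by
      have h1 : Measurable fun w : (Unit × Vec d) × X => (w.1.2, w.2) := by fun_prop
      exact measurable_gameValue (M := fun w : (Unit × Vec d) × X => qmat φ h w.1.2 w.2)
        fun a b => (measurable_qmat hφ h a b).comp h1)
    (fun _ h ϑ hϑ x => gameValue_mem_Icc fun a b => hϑ.2 (x, a, b))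
  exact ⟨g (), (hg ()).1, (hg ()).2⟩

theorem IsLinear.exists_booster_fixedPoint (hl : IsLinear G φ)
    (hA : ∀ h, IsMarkovKernel (πA h)) : ∃ g₀ : Param H d → Param H d, Measurable g₀ ∧
    (∀ θ, g₀ θ ∈ classSet φ) ∧ ∀ θ h z, linFun φ (g₀ θ) h z =
      G.r h z + nextMean G.P (boostVal φ πA θ (g₀ θ)) h z := by
  have hφ := hl.measurable_feature
  obtain ⟨g, hgm, hg⟩ := hl.exists_fixedPoint (Y := Param H d)
    (fun θ h ϑ x => respValue (weights (πA h (θ h, x))) (qmat φ h ϑ x))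
    (fun h => by
      have h1 : Measurable fun w : (Param H d × Vec d) × X => (w.1.2, w.2) := by fun_prop
      have h2 : Measurable fun w : (Param H d × Vec d) × X => (w.1.1 h, w.2) := by fun_prop
      exact measurable_respValue (M := fun w : (Param H d × Vec d) × X => qmat φ h w.1.2 w.2)
        (p := fun w : (Param H d × Vec d) × X => weights (πA h (w.1.1 h, w.2)))
        (fun a => (measurable_weights (πA h) a).comp h2)
        fun a b => (measurable_qmat hφ h a b).comp h1)
    (fun θ h ϑ hϑ x => respValue_mem_Icc (weights_mem_stdSimplex _)
      fun a b => hϑ.2 (x, a, b))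
  exact ⟨g, hgm, fun θ => (hg θ).1, fun θ => (hg θ).2⟩

theorem abs_regret_le (hA : ∀ h, IsMarkovKernel (πA h)) (ω : Fin T → Rec H d X A B) :
    |regret G πA ω| ≤ T * H := by
  unfold regret
  refine (Finset.abs_sum_le_sum_abs _ _).trans ((Finset.sum_le_sum (g := fun _ => (H : ℝ))
    fun s _ => ?_).trans (by simp))
  have h1 := nashValue_mem_Icc G
  have h2 := bestRespValue_mem_Icc G (μ := fun h => (πA h).comap (fun x => ((ω s).1 h, x))
    (by fun_prop)) (fun h => inferInstance)
  exact abs_le.2 ⟨by linarith [h1.1, h2.2], by linarith [h1.2, h2.1]⟩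

/-- Replaces the infimum over all opponent policies by a value depending measurably on the sampled
parameter; measurability of the regret comes from here. -/
theorem regret_eq_sum (hφ : ∀ h, Measurable (φ h)) (hA : ∀ h, IsMarkovKernel (πA h))
    {g₀ : Param H d → Param H d} (hg₀m : ∀ θ, g₀ θ ∈ classSet φ)
    (hgfix : ∀ θ h z, linFun φ (g₀ θ) h z =
      G.r h z + nextMean G.P (boostVal φ πA θ (g₀ θ)) h z) (ω : Fin T → Rec H d X A B) :
    regret G πA ω = ∑ t, (nashValue G - boostVal φ πA (ω t).1 (g₀ (ω t).1) 0 G.x₁) := by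
  unfold regret
  exact Finset.sum_congr rfl fun t _ => congr_arg _
    (bestRespValue_eq hφ hA (ω t).1 (hg₀m _) (hgfix _))

theorem IsLinear.integrable_regret (hl : IsLinear G φ) (hA : ∀ h, IsMarkovKernel (πA h))
    (m : Measure (Fin T → Rec H d X A B)) [IsFiniteMeasure m] :
    Integrable (regret G πA) m := by
  have hφ := hl.measurable_feature
  obtain ⟨g₀, hg₀, hg₀m, hgfix⟩ := hl.exists_booster_fixedPoint hA
  have hm : Measurable (regret G πA : (Fin T → Rec H d X A B) → ℝ) := by
    rw [funext (regret_eq_sum (T := T) hφ hA hg₀m hgfix)]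
    refine Finset.measurable_sum _ fun t _ => Measurable.const_sub ?_ _
    have h1 : Measurable fun ω : Fin T → Rec H d X A B => (ω t).1 := by fun_prop
    exact measurable_boostVal_comp hφ h1 (hg₀.comp h1) measurable_const 0
  exact .of_bound hm.aestronglyMeasurable (T * H) (.of_forall fun ω => abs_regret_le hA ω)

/-- The regret of a run in terms of the complexity bound `K`. -/
theorem IsLinear.mul_integral_regret_le (hl : IsLinear G φ) (hA : IsMainRule φ πA)
    (hB : IsBoosterRule φ πA πB) (hη : 0 < η) (hηH : 4 * η * (H : ℝ) ^ 2 ≤ 1.6) (hlam : 0 < lam)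
    {ε K τ : ℝ} (hε : 0 < ε) (hK : kappa G φ πA ε ≤ K) (hτ : 0 < τ) :
    lam * ∫ ω, regret G πA ω ∂(runLaw G φ πA πB η lam T) ≤ 4 * lam * (H + lam / (0.8 * η)) *
      (H * (d * Real.log (τ * d + T)) - H * (d * Real.log τ)) +
      T * (4 * K + 4 * slack H T η ε + 2 * (lam * ε) + 1.6 * η * τ * (H : ℝ) ^ 3 * d) := by
  have hφ := hl.measurable_feature
  have hAm := hA.markov
  have := hl.isProbabilityMeasure_runLaw (lam := lam) hAm hB.markov hη.le T
  obtain ⟨θ₀, hθ₀, hfix⟩ := hl.exists_main_fixedPoint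
  obtain ⟨g₀, hg₀, hg₀m, hgfix⟩ := hl.exists_booster_fixedPoint hAm
  have key := hl.integral_runLaw_le hA hB hη hηH hlam hε hK hθ₀ hfix hg₀ hg₀m hgfix hτ T T le_rfl
  set c := 4 * lam * (H + lam / (0.8 * η)) with hc
  have hc0 : 0 ≤ c := by positivity
  set b := H * (d * Real.log (τ * d + T)) - H * (d * Real.log τ) with hb
  have hd : 0 < d := by
    have := hl.one_le_dim (0 : Fin H)
    exact_mod_cast zero_lt_one.trans_le this
  have I0 := hl.integrable_sum_refGap_sub_potential (lam := lam) (t := T) hτ hAm hθ₀ hg₀ hg₀m c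
      (runLaw G φ πA πB η lam T)
  have I1 := (hl.integrable_regret hAm (runLaw G φ πA πB η lam T)).const_mul lam
  have h1 := integral_mono I1 (I0.add (integrable_const (c * b))) fun ω => ?_
  · have e := integral_add I0 (integrable_const (c * b))
    have h2 := h1.trans_eq e
    rw [integral_const_mul] at h2
    simp only [integral_const, probReal_univ, smul_eq_mul, one_mul] at h2
    linarith
  · have hreg : regret G πA ω ≤ ∑ s, refGap G φ πA θ₀ g₀ (ω s).1 := by
      rw [regret_eq_sum hφ hAm hg₀m hgfix]
      exact Finset.sum_le_sum fun s _ => sub_le_sub_right (nashValue_le hφ hθ₀ hfix) _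
    have h3 := mul_le_mul_of_nonneg_left hreg hlam.le
    have h4 : potential φ τ (trajs ω) - H * (d * Real.log τ) ≤ b :=
      sub_le_sub_right (potential_le hl.norm_feature_le hτ hd _) _
    have h5 := mul_le_mul_of_nonneg_left h4 hc0
    simp only [Pi.add_apply]
    linarith

/-- For `T ≤ 16 d H²` the trivial regret bound `H T` is already of the right order. For larger `T`
the level `ε = H / T²` lies in the range where `κ` is bounded above and below, so `λ` is positive
and the general estimate applies. -/
theorem IsLinear.integral_regret_le (hl : IsLinear G φ) (hA : IsMainRule φ πA)
    (hB : IsBoosterRule φ πA πB) (hT : 2 ≤ H * T) :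
    ∫ ω, regret G πA ω ∂(runLaw G φ πA πB (0.4 / (H : ℝ) ^ 2) (optimismWeight G φ πA T) T) ≤
      300 * ((H : ℝ) ^ 2 * d * √(T : ℝ) * Real.log (H * T)) := by
  have hAm := hA.markov
  have hH : (1 : ℝ) ≤ H := by exact_mod_cast NeZero.one_le
  have hd := hl.one_le_dim (0 : Fin H)
  have hη : 0 < 0.4 / (H : ℝ) ^ 2 := by positivity
  have hT2 : (2 : ℝ) ≤ H * T := by exact_mod_cast hT
  have hL : 0.69 ≤ Real.log (H * T) :=
    (by linarith [Real.log_two_gt_d9] : (0.69 : ℝ) ≤ Real.log 2).trans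
      (Real.log_le_log two_pos hT2)
  have := hl.isProbabilityMeasure_runLaw (lam := optimismWeight G φ πA T) hAm hB.markov hη.le T
  rcases le_or_gt (T : ℝ) (16 * d * (H : ℝ) ^ 2) with hsmall | hbig
  · refine le_trans ?_ (trivial_regret_rate (by linarith) hd (Nat.cast_nonneg T) hsmall hL)
    refine (integral_mono (hl.integrable_regret hAm _) (integrable_const ((T : ℝ) * H))
      fun ω => (abs_le.1 (abs_regret_le hAm ω)).2).trans_eq ?_
    simp [mul_comm]
  have hH2 : 1 ≤ (H : ℝ) ^ 2 := one_le_pow₀ hH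
  have hdT : 16 * (d : ℝ) ≤ T := by nlinarith
  have hHT : (H : ℝ) ≤ T := by nlinarith
  have hT1 : (1 : ℝ) ≤ T := hH.trans hHT
  have hT0 : (0 : ℝ) < T := by linarith
  have hH0 : (0 : ℝ) < H := by linarith
  set L := Real.log (H * T) with hLdef
  set ℓ := 1 + Real.log (2 * (H : ℝ) * T) with hℓdef
  have hlog2 : Real.log (2 * (H : ℝ) * T) = Real.log 2 + L := by
    rw [mul_assoc, Real.log_mul two_ne_zero (by positivity)]
  have hℓ : 0 < ℓ := by
    have := Real.log_two_gt_d9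
    linarith
  have hℓL : ℓ ≤ 4 * L := by
    have := Real.log_two_lt_d9
    linarith
  have hlogT : Real.log T ≤ L := Real.log_le_log hT0 (by nlinarith)
  set ε := (H : ℝ) / (T : ℝ) ^ 2 with hεdef
  have hε : 0 < ε := by positivity
  have hε1 : ε ≤ 1 / H := by
    rw [hεdef, div_le_div_iff₀ (by positivity) hH0]
    nlinarith
  have hε2 : ε * (16 * d) ≤ H := by
    rw [hεdef, div_mul_eq_mul_div, div_le_iff₀ (by positivity)]
    have : 16 * (d : ℝ) ≤ (T : ℝ) ^ 2 := by nlinarith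
    exact mul_le_mul_of_nonneg_left this hH0.le
  have hκ := hl.kappa_le hAm hε hε1
  have hκ' := hl.le_kappa (πA := πA) hε2
  have htop : kappa G φ πA ε ≠ ⊤ := ne_top_of_le_ne_top (EReal.coe_ne_top _) hκ
  have hbot : kappa G φ πA ε ≠ ⊥ := ne_bot_of_le_ne_bot (EReal.coe_ne_bot _) hκ'
  have hcoe := EReal.coe_toReal htop hbot
  set K := (kappa G φ πA ε).toReal with hKdef
  rw [← hcoe, EReal.coe_le_coe_iff] at hκ hκ'
  have hKL : K ≤ 4 * (H * d * L) := by
    have h1 : Real.log (1 / ε) ≤ 2 * L := by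
      rw [hεdef, one_div_div, Real.log_div (by positivity) hH0.ne', Real.log_pow]
      have := Real.log_nonneg hH
      push_cast
      linarith
    have h2 : (H : ℝ) * d * Real.log (1 / ε) ≤ H * d * (2 * L) := by gcongr
    linarith
  have hdH : (0 : ℝ) < d * H ^ 3 * ℓ := by positivity
  have hK0 : 0 < K := by linarith
  set lam := optimismWeight G φ πA T with hlamdef
  have hlam2 : lam ^ 2 * (d * (H : ℝ) ^ 3 * ℓ) = T * K := by
    rw [hlamdef, optimismWeight, Real.sq_sqrt (by positivity), div_mul_cancel₀ _ hdH.ne']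
  have hlam : 0 < lam := by
    refine (Real.sqrt_nonneg _).lt_of_ne' fun h0 => ?_
    rw [show lam = 0 from h0] at hlam2
    have : 0 < (T : ℝ) * K := by positivity
    rw [zero_pow two_ne_zero, zero_mul] at hlam2
    linarith
  -- With `τ = 1 / T` the regularization costs summed over the run do not grow with `T`, while the
  -- potential grows per step only by `d log (d + T²)`, which is at most `2 d log (2 H T)`.
  have hτ : 0 < 1 / (T : ℝ) := by positivity
  have key := hl.mul_integral_regret_le (T := T) hA hB hη (by
    have : 4 * (0.4 / (H : ℝ) ^ 2) * (H : ℝ) ^ 2 = 1.6 := by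
      field_simp
      norm_num
    exact this.le) hlam hε hcoe.ge hτ
  refine regret_rate hH hd hbig hκ' hlam hL hℓ hℓL hKL hlam2 (key.trans ?_)
  unfold slack
  refine add_le_add (mul_le_mul_of_nonneg_left ?_ (by positivity)) le_rfl
  have hlog : Real.log (1 / (T : ℝ) * d + T) - Real.log (1 / T) ≤ 2 * ℓ := by
    rw [← Real.log_div (by positivity) (by positivity)]
    have h1 : (1 / (T : ℝ) * d + T) / (1 / T) ≤ (2 * (H : ℝ) * T) ^ 2 := by
      have h2 : (1 / (T : ℝ) * d + T) / (1 / T) = d + (T : ℝ) ^ 2 := by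
        field_simp
      rw [h2]
      nlinarith
    refine (Real.log_le_log (by positivity) h1).trans ?_
    rw [Real.log_pow]
    push_cast
    linarith
  have := mul_le_mul_of_nonneg_left hlog (by positivity : (0 : ℝ) ≤ H * d)
  linarith

end Regret

end LinMG

theorem mainTheorem4 :
    ∃ C : ℝ, 0 < C ∧
      ∀ (X A B : Type*) [MeasurableSpace X]
        [Fintype A] [Nonempty A] [MeasurableSpace A] [DiscreteMeasurableSpace A]
        [Fintype B] [Nonempty B] [MeasurableSpace B] [DiscreteMeasurableSpace B]
        (H : ℕ) [NeZero H] (d : ℕ)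
        (G : LinMG.Game H X A B) (φ : Fin H → X × A × B → LinMG.Vec d)
        (πA : Fin H → Kernel (LinMG.Vec d × X) A)
        (πB : Fin H → Kernel ((LinMG.Vec d × LinMG.Vec d) × X) B),
        LinMG.IsLinear G φ → LinMG.IsMainRule φ πA → LinMG.IsBoosterRule φ πA πB →
          (∀ ε : ℝ, 0 < ε → ε ≤ 1 / (H : ℝ) →
            LinMG.kappa G φ πA ε ≤ ((C * ((H : ℝ) * (d : ℝ) * Real.log (1 / ε)) : ℝ) : EReal)) ∧
          (∀ T : ℕ, 2 ≤ H * T →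
            IsProbabilityMeasure
              (LinMG.runLaw G φ πA πB (0.4 / (H : ℝ) ^ 2) (LinMG.optimismWeight G φ πA T) T) ∧
            Integrable (LinMG.regret G πA)
              (LinMG.runLaw G φ πA πB (0.4 / (H : ℝ) ^ 2) (LinMG.optimismWeight G φ πA T) T) ∧
            ∫ ω, LinMG.regret G πA ω
              ∂(LinMG.runLaw G φ πA πB (0.4 / (H : ℝ) ^ 2) (LinMG.optimismWeight G φ πA T) T) ≤
              C * ((H : ℝ) ^ 2 * (d : ℝ) * √(T : ℝ) * Real.log ((H : ℝ) * (T : ℝ)))) := by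
  -- The regret rate dictates `300`; the bound on `κ` holds with `2`.
  refine ⟨300, by norm_num, fun X A B _ _ _ _ _ _ _ _ _ H _ d G φ πA πB hl hA hB =>
    ⟨fun ε hε hε1 => ?_, fun T hT => ?_⟩⟩
  · refine (hl.kappa_le hA.markov hε hε1).trans (EReal.coe_le_coe_iff.2 ?_)
    have hH : (1 : ℝ) ≤ H := by exact_mod_cast NeZero.one_le
    have h1 : 1 ≤ 1 / ε := by
      rw [le_div_iff₀ hε, one_mul]
      exact hε1.trans ((div_le_one (by linarith)).2 hH)
    exact mul_le_mul_of_nonneg_right (by norm_num)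
      (mul_nonneg (by positivity) (Real.log_nonneg h1))
  · have hη : (0 : ℝ) ≤ 0.4 / (H : ℝ) ^ 2 := by positivity
    have hp := hl.isProbabilityMeasure_runLaw (lam := LinMG.optimismWeight G φ πA T) hA.markov
      hB.markov hη T
    exact ⟨hp, hl.integrable_regret hA.markov _, hl.integral_regret_le hA hB hT⟩
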